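/- Let $d\ge 1$ and $p\ge d+1$ be integers. For $0\le\tau\le1$ put \[ r(\tau)=2(d-1)\tau^2+p-d,\qquad q(\tau)=(d-2)\tau^2-2(d-1)\tau+d, \] \[ h(\tau)=\begin{cases}2-\frac{d}{d+1}+\frac{pd}{pd-1}\cdot\frac{\tau^2}{q(\tau)}, & p=d+1,\\ \frac{p}{d(p-d)}+\frac{pd}{pd-1}\cdot\frac{\tau^2}{q(\tau)}, & p\ge d+2,\end{cases} \] where $q(\tau)>0$ for $0\le \tau<1$, $q(1)=0$, and by convention $h(1)=+\infty$. Let $G(x,\tau)=\max\{x(1-\tau^2)^2+2\tau^2,\ \frac{p-1}{p}\}$ if $d=1$, and if $d\ge 2$ let \[ G(x,\tau)=\begin{cases}2q(\tau)+2d\tau^2-\frac1{xd}, & xdq(\tau)\ge\max\{1,1/h(\tau)\},\\ xdq(\tau)^2+2d\tau^2, & 2-h(\tau)\le xdq(\tau)\le 1,\\ 2q(\tau)+2d\tau^2-q(\tau)h(\tau), & \text{otherwise}\end{cases} \] (for $\tau=1$ the second case applies to all $x$). For $0<x<1$ this is the supremum \[ G(x,\tau)=\sup_{0\le u\le w\le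 v\le 1,\ v>0}\left\{q(\tau)\frac uv\Big(2-\frac{pu}{p-d}\Big)+d\tau^2\,\frac wv\Big(2-\frac{pdw}{pd-1}\Big)-\frac1x\cdot\frac{\max\{1-dv,0\}\,u^2}{dv^2}\right\}. \] Define \[ \alpha_G(p,d,\tau)=\max\{\alpha\neq0:\ r(\tau)\alpha^{-1}\ge G(1-\alpha^{-1},\tau)\},\qquad \alpha_G(p,d)=\max_{0\le\tau\le1}\alpha_G(p,d,\tau). \] Then both maxima exist, and the following hold. (a) In each case below, a real number $\alpha\ne0$ that satisfies the condition on the right equals $\alpha_G(p,d,\tau)$ if and only if it equals the value on the left. For $d=1$ and $0\le\tau\le1$: \[ \alpha=\begin{cases}\frac{p-1+(1-\tau^2)^2}{2\tau^2+(1-\tau^2)^2}, & (1-\alpha^{-1})(1-\tau^2)^2+2\tau^2\ge\frac{p-1}{p},\\ p, & (1-\alpha^{-1})(1-\tau^2)^2+2\tau^2\le\frac{p-1}{p}.\end{cases} \] For $d\ge2$, $0\le\tau<1$ and $h(\tau)\ge1$: \[ \alpha=\begin{cases}\max\left\{\alpha'\ne0,1:\ \frac{r(\tau)}{\alpha'}\ge2(q(\tau)+d\tau^2)-\frac1{(1-1/\alpha')d}\right\},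 & 1-\alpha^{-1}\ge\frac1{dq(\tau)},\\ \frac{dq(\tau)^2+r(\tau)}{dq(\tau)^2+2d\tau^2}, & \frac{2-h(\tau)}{dq(\tau)}\le1-\alpha^{-1}\le\frac1{dq(\tau)},\\ \frac{r(\tau)}{2(q(\tau)+d\tau^2)-q(\tau)h(\tau)}, & 1-\alpha^{-1}\le\frac{2-h(\tau)}{dq(\tau)}.\end{cases} \] For $d\ge2$ and $\tau=1$ (where $h=+\infty$, so that only the second case above remains): $\alpha_G(p,d,1)=\frac{p+d-2}{2d}$. For $d\ge2$, $0\le\tau<1$ and $h(\tau)\le1$: \[ \alpha=\begin{cases}\max\left\{\alpha'\ne0,1:\ \frac{r(\tau)}{\alpha'}\ge2(q(\tau)+d\tau^2)-\frac1{(1-1/\alpha')d}\right\}, & 1-\alpha^{-1}\ge\frac1{dq(\tau)h(\tau)},\\ \frac{r(\tau)}{2(q(\tau)+d\tau^2)-q(\tau)h(\tau)}, & 1-\alpha^{-1}\le\frac1{dq(\tau)h(\tau)}.\end{cases} \] (b) $\alpha_G(p,1)=p$ for all $p\ge2$; and $\alpha_G(p,d)>1$ if $d\ge2$ and $p\ge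 d+2$, or if $p=d+1$ and $d\in\{2,3\}$. (c) Let $n\ge2$, let $A\in\mathbb R^{nd\times nd}$ be symmetric, let $Z\in\mathbb R^{nd\times d}$ have $n$ blocks $Z_i\in\mathrm O(d)$, and let $L=\Lambda(Z)-A$. Here, for a matrix $S\in\mathbb R^{nd\times m}$ with $d\times m$ blocks $S_1,\dots,S_n$, $\Lambda(S)$ is the block-diagonal matrix whose $i$-th $d\times d$ diagonal block is the symmetric part of the $(i,i)$ block of $ASS^\top$. Suppose $L\succeq0$, $LZ=0$, the $(d+1)$-th smallest eigenvalue satisfies $\lambda_{d+1}(L)>0$, and \[ \frac{\lambda_{\max}(L)}{\lambda_{d+1}(L)}<\alpha_G(p,d). \] Then the landscape of the minimization of $-\langle A,SS^\top\rangle$ over all $S\in\mathbb R^{nd\times p}$ with $d\times p$ blocks satisfying $S_iS_i^\top=I_d$ is benign: every second-order critical point $S$, i.e. every feasible $S$ with $(\Lambda(S)-A)S=0$ and $\langle\Lambda(S)-A,TT^\top\rangle\ge0$ for all $T\in\mathbb R^{nd\times p}$ with $T_iS_i^\top+S_iT_i^\top=0$ for all $i$, is a global minimizer and satisfies $SS^\top=ZZ^\top$;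 and every local minimizer is a global minimizer. -/

import Mathlib

open Set Matrix

namespace LowRankSync

/-! ### The scalar functions -/

/-- `r(τ) = 2(d-1)τ² + p - d`. -/
noncomputable def rFun (p d : ℕ) (τ : ℝ) : ℝ := 2 * ((d : ℝ) - 1) * τ ^ 2 + p - d

/-- `q(τ) = (d-2)τ² - 2(d-1)τ + d`.  On `[0,1]` it vanishes only at `τ = 1`. -/
noncomputable def qFun (d : ℕ) (τ : ℝ) : ℝ := ((d : ℝ) - 2) * τ ^ 2 - 2 * ((d : ℝ) - 1) * τ + d

/-- `h(τ)`, used for `0 ≤ τ < 1` only (there `q(τ) > 0`); the value at `τ = 1` is `+∞` and is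
never read off from this real-valued function. -/
noncomputable def hFun (p d : ℕ) (τ : ℝ) : ℝ :=
  if p = d + 1 then
    2 - (d : ℝ) / (d + 1) + ((p : ℝ) * d) / (p * d - 1) * (τ ^ 2 / qFun d τ)
  else
    (p : ℝ) / (d * ((p : ℝ) - d)) + ((p : ℝ) * d) / (p * d - 1) * (τ ^ 2 / qFun d τ)

/-- The function whose supremum over `0 ≤ u ≤ w ≤ v ≤ 1`, `v ≠ 0`, is taken in the dual bound. -/
noncomputable def gFun (p d : ℕ) (u v w x τ : ℝ) : ℝ :=
  qFun d τ * (u / v) * (2 - (p : ℝ) * u / ((p : ℝ) - d))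
    + d * τ ^ 2 * (w / v) * (2 - (p : ℝ) * d * w / ((p : ℝ) * d - 1))
    - 1 / x * (max (1 - d * v) 0 * u ^ 2 / (d * v ^ 2))

/-- The piecewise function `G(x,τ)`.  For `d ≥ 2` and `τ = 1` one has `q = 0` and `h = +∞`, so that
the middle case `2 - h ≤ x d q ≤ 1` applies to every `x`. -/
noncomputable def GFun (p d : ℕ) (x τ : ℝ) : ℝ :=
  if d = 1 then
    max (x * (1 - τ ^ 2) ^ 2 + 2 * τ ^ 2) (((p : ℝ) - 1) / p)
  else if τ = 1 then
    x * d * qFun d τ ^ 2 + 2 * d * τ ^ 2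
  else if max 1 (1 / hFun p d τ) ≤ x * d * qFun d τ then
    2 * qFun d τ + 2 * d * τ ^ 2 - 1 / (x * d)
  else if 2 - hFun p d τ ≤ x * d * qFun d τ ∧ x * d * qFun d τ ≤ 1 then
    x * d * qFun d τ ^ 2 + 2 * d * τ ^ 2
  else
    2 * qFun d τ + 2 * d * τ ^ 2 - qFun d τ * hFun p d τ

/-- All `α` with `r(τ) α⁻¹ ≥ G(1 - α⁻¹, τ)`. -/
def feasible (p d : ℕ) (τ : ℝ) : Set ℝ :=
  {α | α ≠ 0 ∧ GFun p d (1 - α⁻¹) τ ≤ rFun p d τ * α⁻¹}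

/-- `α_G(p,d,τ)`, the largest feasible `α`. -/
noncomputable def alphaAt (p d : ℕ) (τ : ℝ) : ℝ := sSup (feasible p d τ)

/-- `α_G(p,d)`, the maximum of `α_G(p,d,τ)` over `0 ≤ τ ≤ 1`. -/
noncomputable def alphaG (p d : ℕ) : ℝ := sSup (alphaAt p d '' Icc 0 1)

/-- All `α` with `r(τ) α⁻¹ ≥ 2 (q(τ) + d τ²) - 1 / ((1 - α⁻¹) d)`. -/
def firstCaseSet (p d : ℕ) (τ : ℝ) : Set ℝ :=
  {α | α ≠ 0 ∧ α ≠ 1 ∧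
    2 * (qFun d τ + d * τ ^ 2) - 1 / ((1 - α⁻¹) * d) ≤ rFun p d τ * α⁻¹}

/-! ### The optimization problem on `St(p,d)^n` -/

/-- The `i`-th block of `d` rows. -/
def rowBlock {n d : ℕ} {κ : Type*} (S : Matrix (Fin n × Fin d) κ ℝ) (i : Fin n) :
    Matrix (Fin d) κ ℝ :=
  Matrix.of fun a k => S (i, a) k

/-- `St(p,d)^n`: stacked `d × p` blocks with `S_i S_iᵀ = I_d`.  For `p = d` it is `O(d)^n`. -/
def stiefel (n p d : ℕ) : Set (Matrix (Fin n × Fin d) (Fin p) ℝ) :=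
  {S | ∀ i, rowBlock S i * (rowBlock S i)ᵀ = 1}

/-- Tangent vectors to `St(p,d)^n` at `S`. -/
def tangent {n p d : ℕ} (S : Matrix (Fin n × Fin d) (Fin p) ℝ) :
    Set (Matrix (Fin n × Fin d) (Fin p) ℝ) :=
  {T | ∀ i, rowBlock T i * (rowBlock S i)ᵀ + rowBlock S i * (rowBlock T i)ᵀ = 0}

/-- `⟨X, Y⟩ = Tr(X Yᵀ)`. -/
def frobInner {m k : Type*} [Fintype m] [Fintype k] (X Y : Matrix m k ℝ) : ℝ := (X * Yᵀ).trace

/-- Keep the diagonal `d × d` blocks and symmetrize them. -/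
noncomputable def symBlockDiag {n d : ℕ} (X : Matrix (Fin n × Fin d) (Fin n × Fin d) ℝ) :
    Matrix (Fin n × Fin d) (Fin n × Fin d) ℝ :=
  Matrix.of fun s t => if s.1 = t.1 then (X s t + X t s) / 2 else 0

/-- The objective `S ↦ -⟨A, S Sᵀ⟩`. -/
def objective {n p d : ℕ} (A : Matrix (Fin n × Fin d) (Fin n × Fin d) ℝ)
    (S : Matrix (Fin n × Fin d) (Fin p) ℝ) : ℝ :=
  -frobInner A (S * Sᵀ)

/-- `Λ - A` with `Λ` the symmetrized block-diagonal part of `A S Sᵀ`. -/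
noncomputable def certificate {n p d : ℕ} (A : Matrix (Fin n × Fin d) (Fin n × Fin d) ℝ)
    (S : Matrix (Fin n × Fin d) (Fin p) ℝ) : Matrix (Fin n × Fin d) (Fin n × Fin d) ℝ :=
  symBlockDiag (A * (S * Sᵀ)) - A

/-- Second-order critical points of the objective on `St(p,d)^n`: up to the factor 2, the
Riemannian gradient at `S` is `(Λ - A) S` and the Riemannian Hessian is the quadratic form
`T ↦ ⟨Λ - A, T Tᵀ⟩` on the tangent space. -/
def IsSecondOrderCritical {n p d : ℕ} (A : Matrix (Fin n × Fin d) (Fin n × Fin d) ℝ)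
    (S : Matrix (Fin n × Fin d) (Fin p) ℝ) : Prop :=
  S ∈ stiefel n p d ∧ certificate A S * S = 0 ∧
    ∀ T ∈ tangent S, 0 ≤ frobInner (certificate A S) (T * Tᵀ)

/-- The landscape on `St(p,d)^n` is benign with respect to the solution `Z`: every second-order
critical point is a global minimizer with `S Sᵀ = Z Zᵀ`, and every local minimizer is global. -/
def BenignLandscape {n d : ℕ} (p : ℕ) (A : Matrix (Fin n × Fin d) (Fin n × Fin d) ℝ)
    (Z : Matrix (Fin n × Fin d) (Fin d) ℝ) : Prop :=
  (∀ S : Matrix (Fin n × Fin d) (Fin p) ℝ, IsSecondOrderCritical A S →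
      IsMinOn (objective A) (stiefel n p d) S ∧ S * Sᵀ = Z * Zᵀ) ∧
  (∀ S ∈ stiefel n p d, IsLocalMinOn (objective A) (stiefel n p d) S →
      IsMinOn (objective A) (stiefel n p d) S)

/-- The `k`-th smallest eigenvalue, `1 ≤ k ≤ N`, of a symmetric `N × N` matrix. -/
noncomputable def kthEigenvalue {m : Type*} [Fintype m] [DecidableEq m] {L : Matrix m m ℝ}
    (hL : L.IsHermitian) (k : ℕ) : ℝ :=
  if hk : 1 ≤ k ∧ k ≤ Fintype.card m then
    hL.eigenvalues₀ ⟨Fintype.card m - k, by omega⟩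
  else 0

/-- The largest eigenvalue of a symmetric matrix. -/
noncomputable def maxEigenvalue {m : Type*} [Fintype m] [DecidableEq m] {L : Matrix m m ℝ}
    (hL : L.IsHermitian) : ℝ := ⨆ i, hL.eigenvalues i

end LowRankSync

open LowRankSync

/-! The landscape claim rests on one inequality. If a second-order critical point `S` has `S Sᵀ ≠ Z
Zᵀ`, then for every `τ` there are admissible `u ≤ w ≤ v` with `r(τ) λ ≤ μ g(u,v,w,x,τ)`, where `λ =
λ_{d+1}(L)`, `μ = λ_max(L)`, and `x > 0` satisfies `(1 - x) μ ≤ λ` (`rFun_mul_le_of_critical`). Take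
`τ` optimal, `α = alphaG p d` and `x = 1 - α⁻¹`. Then `g ≤ G ≤ r(τ) α⁻¹`, so `λ ≤ μ α⁻¹`, against
the hypothesis on `μ / λ`.

For the inequality, rotate to `R_i = Z_iᵀ S_i`. The solution becomes a constant family, and `L`
becomes a form `b` that kills constant families and lies between `λ` and `μ` times the covariance
form (`posSemidef_of_spectral_gap`). Test the Hessian on `T_i = Φ - F_i(Φ)` with one `Φ` shared by
all blocks, and sum over the standard basis of matrices `Φ`, which replaces a Gaussian average. The
constant part `Φ` drops out of `b`, while `∑ T_i T_iᵀ = r(τ) I` on each block, so `r(τ) b(R,R) ≤ ∑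
b(F,F)`. The left side is at least `r(τ) λ n d v`. On the right, `b ≤ μ cov`, and the covariance sum
is computed exactly and bounded by the spectral spreads `u`, `w` of two second-moment operators
(`exists_spread`). The loss `J = μ cov - b` cannot be too small: first-order criticality gives `b(R,
F(V)) = 0` for the polar factor `V` of the mean, and Cauchy-Schwarz for `J` then produces the term
with `1 / x`.

On the scalar side, fix `u / v` and `w / v`. Then `g` is affine in `v` up to `1 / d` and
nonincreasing afterwards, so the supremum is the larger of the values at `v → 0` and `v = 1 / d`.
This is `GEnv`, continuous and monotone in `x`. Feasibility in `y = α⁻¹` is therefore a single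
strict crossing (`feasible_root`): the largest feasible `α` is the solution of an equation, which
gives the closed forms, and compactness gives the maximum over `τ`.

Local minimizers are second-order critical by differentiating twice along `S_i exp(t Ω_i)` with
`Ω_i` skew. -/

namespace LowRankSync

/-! ### The concave envelope of the scalar problem -/

/-- `psiFun z = max_{0 ≤ a ≤ 1} (2a - a²/z)` for `z > 0`, extended by `z` to `z ≤ 0`. -/
noncomputable def psiFun (z : ℝ) : ℝ := 1 + min z 1 - 1 / max z 1

lemma psiFun_of_le {z : ℝ} (hz : z ≤ 1) : psiFun z = z := by
  simp [psiFun, hz]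

lemma psiFun_of_ge {z : ℝ} (hz : 1 ≤ z) : psiFun z = 2 - 1 / z := by
  simp only [psiFun, min_eq_right hz, max_eq_left hz]; ring

lemma continuous_psiFun : Continuous psiFun := by
  unfold psiFun
  refine Continuous.sub (by fun_prop) (Continuous.div (by fun_prop) (by fun_prop) ?_)
  intro z
  have : (0 : ℝ) < max z 1 := lt_max_of_lt_right one_pos
  exact this.ne'

lemma monotone_psiFun : Monotone psiFun := by
  intro a b hab
  unfold psiFun
  have h1 : min a 1 ≤ min b 1 := min_le_min_right _ hab
  have h2 : max a 1 ≤ max b 1 := max_le_max_right _ hab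
  have h3 : 1 / max b 1 ≤ 1 / max a 1 :=
    one_div_le_one_div_of_le (lt_max_of_lt_right one_pos) h2
  linarith

/-- The parabola in `a` has its vertex at `a = z`. For `z ≤ 1` the gap is a square; for `z ≥ 1` the
maximum over `a ≤ 1` sits at `a = 1` and the gap contains the factor `1 - a`. -/
lemma two_mul_sub_sq_div_le_psiFun {a z : ℝ} (ha1 : a ≤ 1) (hz : 0 < z) :
    2 * a - a ^ 2 / z ≤ psiFun z := by
  rcases le_total z 1 with h | h
  · rw [psiFun_of_le h]
    have : z - (2 * a - a ^ 2 / z) = (a - z) ^ 2 / z := by field_simp; ring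
    have h2 : 0 ≤ (a - z) ^ 2 / z := by positivity
    linarith
  · rw [psiFun_of_ge h]
    have : 2 - 1 / z - (2 * a - a ^ 2 / z) = (1 - a) * ((z - 1) + (z - a)) / z := by
      field_simp; ring
    have h2 : 0 ≤ (1 - a) * ((z - 1) + (z - a)) / z :=
      div_nonneg (mul_nonneg (by linarith) (by linarith)) hz.le
    linarith

lemma psiFun_attained {z : ℝ} (hz : 0 < z) :
    2 * min z 1 - min z 1 ^ 2 / z = psiFun z := by
  rcases le_total z 1 with h | h
  · rw [psiFun_of_le h, min_eq_left h]; field_simp; ring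
  · rw [psiFun_of_ge h, min_eq_right h]; ring

lemma qFun_eq (d : ℕ) (τ : ℝ) : qFun d τ = (1 - τ) * (d * (1 - τ) + 2 * τ) := by
  unfold qFun; ring

lemma qFun_pos {d : ℕ} {τ : ℝ} (hd : 1 ≤ d) (h0 : 0 ≤ τ) (h1 : τ < 1) : 0 < qFun d τ := by
  have : (1 : ℝ) ≤ d := by exact_mod_cast hd
  rw [qFun_eq]
  have : 0 < (d : ℝ) * (1 - τ) := mul_pos (by linarith) (by linarith)
  exact mul_pos (by linarith) (by linarith)

lemma qFun_one (d : ℕ) : qFun d 1 = 0 := by rw [qFun_eq]; ring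

lemma qFun_nonneg {d : ℕ} {τ : ℝ} (hd : 1 ≤ d) (hτ : τ ∈ Icc (0 : ℝ) 1) : 0 ≤ qFun d τ := by
  rcases hτ.2.lt_or_eq with h | h
  · exact (qFun_pos hd hτ.1 h).le
  · rw [h, qFun_one]

lemma continuous_qFun (d : ℕ) : Continuous (qFun d) := by unfold qFun; fun_prop

lemma rFun_pos {p d : ℕ} (hd : 1 ≤ d) (hp : d + 1 ≤ p) (τ : ℝ) : 0 < rFun p d τ := by
  have h1 : (1 : ℝ) ≤ d := by exact_mod_cast hd
  have h2 : (d : ℝ) + 1 ≤ p := by exact_mod_cast hp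
  have := mul_nonneg (by linarith : (0 : ℝ) ≤ d - 1) (sq_nonneg τ)
  unfold rFun; nlinarith

lemma continuous_rFun (p d : ℕ) : Continuous (rFun p d) := by unfold rFun; fun_prop

/-- `h(τ) - (pd/(pd-1)) τ²/q(τ)`. -/
noncomputable def hConst (p d : ℕ) : ℝ :=
  if p = d + 1 then 2 - (d : ℝ) / (d + 1) else (p : ℝ) / (d * ((p : ℝ) - d))

lemma hFun_eq (p d : ℕ) (τ : ℝ) :
    hFun p d τ = hConst p d + (p : ℝ) * d / (p * d - 1) * (τ ^ 2 / qFun d τ) := by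
  unfold hFun hConst; split_ifs <;> rfl

lemma mul_pred_pos {p d : ℕ} (hd : 1 ≤ d) (hp : d + 1 ≤ p) : (0 : ℝ) < p * d - 1 := by
  have : 2 ≤ p * d := by nlinarith
  have : (2 : ℝ) ≤ p * d := by exact_mod_cast this
  linarith

lemma hConst_pos {p d : ℕ} (hd : 1 ≤ d) (hp : d + 1 ≤ p) : 0 < hConst p d := by
  have h1 : (1 : ℝ) ≤ d := by exact_mod_cast hd
  have h2 : (d : ℝ) + 1 ≤ p := by exact_mod_cast hp
  unfold hConst
  split_ifs
  · have : (d : ℝ) / (d + 1) < 1 := by rw [div_lt_one (by linarith)]; linarith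
    linarith
  · exact div_pos (by linarith) (mul_pos (by linarith) (by linarith))

lemma hFun_pos {p d : ℕ} (hd : 1 ≤ d) (hp : d + 1 ≤ p) {τ : ℝ} (h0 : 0 ≤ τ) (h1 : τ < 1) :
    0 < hFun p d τ := by
  rw [hFun_eq]
  have := hConst_pos hd hp
  have := mul_pred_pos hd hp
  have := qFun_pos hd h0 h1
  positivity

/-- The value of the inner supremum on the slice `v = 1/d`. -/
noncomputable def sliceMax (p d : ℕ) (τ : ℝ) : ℝ :=
  if d = 1 then ((p : ℝ) - 1) / p
  else (2 - hConst p d) * qFun d τ + (2 * d - (p : ℝ) * d / (p * d - 1)) * τ ^ 2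

lemma sliceMax_eq {p d : ℕ} (hd : 2 ≤ d) {τ : ℝ} (h0 : 0 ≤ τ) (h1 : τ < 1) :
    sliceMax p d τ = 2 * qFun d τ + 2 * d * τ ^ 2 - qFun d τ * hFun p d τ := by
  have hq := qFun_pos (by omega : 1 ≤ d) h0 h1
  rw [sliceMax, if_neg (by omega), hFun_eq]
  have : qFun d τ * ((p : ℝ) * d / (p * d - 1) * (τ ^ 2 / qFun d τ))
      = (p : ℝ) * d / (p * d - 1) * τ ^ 2 := by
    field_simp
  rw [mul_add, this]; ring

lemma continuous_sliceMax (p d : ℕ) : Continuous (sliceMax p d) := by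
  unfold sliceMax
  split_ifs
  · fun_prop
  · have := continuous_qFun d
    fun_prop

/-- A form of `G` that is visibly continuous, and monotone in `x`. -/
noncomputable def GEnv (p d : ℕ) (x τ : ℝ) : ℝ :=
  max (if d = 1 then x * (1 - τ ^ 2) ^ 2 + 2 * τ ^ 2
    else qFun d τ * psiFun (x * d * qFun d τ) + 2 * d * τ ^ 2) (sliceMax p d τ)

lemma continuous_GEnv (p d : ℕ) : Continuous fun z : ℝ × ℝ => GEnv p d z.1 z.2 := by
  have h1 := continuous_qFun d
  have h2 := continuous_sliceMax p d
  have h3 := continuous_psiFun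
  unfold GEnv
  split_ifs <;> fun_prop

lemma monotone_GEnv {p d : ℕ} (hd : 1 ≤ d) {τ : ℝ} (hτ : τ ∈ Icc (0 : ℝ) 1) :
    Monotone fun x => GEnv p d x τ := by
  intro x y hxy
  have hq := qFun_nonneg hd hτ
  refine max_le_max ?_ le_rfl
  split_ifs
  · gcongr
  · have : psiFun (x * d * qFun d τ) ≤ psiFun (y * d * qFun d τ) :=
      monotone_psiFun (by gcongr)
    gcongr

lemma GEnv_one_pos {p d : ℕ} (hd : 1 ≤ d) (hp : d + 1 ≤ p) {τ : ℝ} (hτ : τ ∈ Icc (0 : ℝ) 1) :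
    0 < GEnv p d 1 τ := by
  have hd' : (1 : ℝ) ≤ d := by exact_mod_cast hd
  have hp' : (d : ℝ) + 1 ≤ p := by exact_mod_cast hp
  unfold GEnv
  by_cases h : d = 1
  · refine lt_max_of_lt_right ?_
    rw [sliceMax, if_pos h]
    exact div_pos (by linarith) (by linarith)
  · refine lt_max_of_lt_left ?_
    rw [if_neg h]
    rcases hτ.2.lt_or_eq with h1 | h1
    · have hq := qFun_pos hd hτ.1 h1
      have hz : 0 < 1 * (d : ℝ) * qFun d τ := by positivity
      have : 0 < psiFun (1 * d * qFun d τ) := by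
        rcases le_total (1 * d * qFun d τ) 1 with h' | h'
        · rwa [psiFun_of_le h']
        · rw [psiFun_of_ge h']
          have : 1 / (1 * (d : ℝ) * qFun d τ) ≤ 1 := by rwa [div_le_one hz]
          linarith
      positivity
    · rw [h1, qFun_one]; norm_num; linarith

/-- The three cases are one maximum: compare `psiFun z` with `2 - h`, where `z = x d q`. Negative
`x` is included, because feasibility is tested at every `α ≠ 0`; this is why `psiFun` is extended by
the identity. -/
lemma GFun_eq_GEnv {p d : ℕ} (hd : 1 ≤ d) (hp : d + 1 ≤ p) (x : ℝ) {τ : ℝ}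
    (hτ : τ ∈ Icc (0 : ℝ) 1) : GFun p d x τ = GEnv p d x τ := by
  unfold GFun GEnv
  by_cases h1 : d = 1
  · simp only [if_pos h1, sliceMax]
  have hd2 : 2 ≤ d := by omega
  have hd' : (2 : ℝ) ≤ d := by exact_mod_cast hd2
  have hp' : (d : ℝ) + 1 ≤ p := by exact_mod_cast hp
  rw [if_neg h1, if_neg h1]
  by_cases hτ1 : τ = 1
  · rw [if_pos hτ1, hτ1, qFun_one, sliceMax, if_neg h1, qFun_one]
    have := mul_pred_pos hd hp
    have : 0 ≤ (p : ℝ) * d / (p * d - 1) := by positivity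
    rw [max_eq_left]
    · ring
    · nlinarith
  have hlt : τ < 1 := lt_of_le_of_ne hτ.2 hτ1
  rw [if_neg hτ1, sliceMax_eq hd2 hτ.1 hlt]
  have hq := qFun_pos hd hτ.1 hlt
  have hh := hFun_pos hd hp hτ.1 hlt
  set q := qFun d τ
  set h := hFun p d τ
  set z := x * d * q with hz
  split_ifs with c1 c2
  · have hz1 : 1 ≤ z := (le_max_left _ _).trans c1
    have hz2 : 1 / h ≤ z := (le_max_right _ _).trans c1
    have hzh : 1 / z ≤ h := by
      rw [div_le_iff₀ (by linarith)]; rw [div_le_iff₀ hh] at hz2; linarith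
    have hxd : x * d ≠ 0 := by
      intro h0; rw [hz, h0] at hz1; norm_num at hz1
    have e : 1 / (x * d) = q * (1 / z) := by rw [hz]; field_simp
    rw [psiFun_of_ge hz1, max_eq_left, e]
    · ring
    · nlinarith
  · rw [psiFun_of_le c2.2, max_eq_left]
    · rw [hz]; ring
    · nlinarith [c2.1]
  · rw [max_eq_right]
    rcases le_total z 1 with h' | h'
    · rw [psiFun_of_le h']
      have : z < 2 - h := by
        by_contra hc; exact c2 ⟨not_lt.mp hc, h'⟩
      nlinarith
    · rw [psiFun_of_ge h']
      have hzh : z < 1 / h := by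
        by_contra hc; exact c1 (max_le h' (not_lt.mp hc))
      have : h ≤ 1 / z := by
        rw [le_div_iff₀ (by linarith)]; rw [lt_div_iff₀ hh] at hzh; linarith
      nlinarith

/-! ### The supremum -/

/-- The objective in the coordinates `a = u / v`, `b = w / v` on the slice `v = 1/d`. -/
noncomputable def sliceFun (p d : ℕ) (a b τ : ℝ) : ℝ :=
  qFun d τ * (2 * a - (p : ℝ) * a ^ 2 / (d * (p - d)))
    + d * τ ^ 2 * (2 * b - (p : ℝ) * b ^ 2 / (p * d - 1))

/-- The two summands separate once the constraint `a ≤ b` is dropped. Their vertices are `d(p-d)/p`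
and `(pd-1)/p`. For `d ≥ 2` the second is at least `1`, and so is the first unless `p = d + 1`,
where it equals `d/(d+1)`; for `d = 1` both are `(p-1)/p`. -/
lemma sliceFun_le {p d : ℕ} (hd : 1 ≤ d) (hp : d + 1 ≤ p) {τ a b : ℝ} (hτ : τ ∈ Icc (0 : ℝ) 1)
    (ha : a ≤ 1) (hb : b ≤ 1) :
    sliceFun p d a b τ ≤ sliceMax p d τ := by
  have hd' : (1 : ℝ) ≤ d := by exact_mod_cast hd
  have hp' : (d : ℝ) + 1 ≤ p := by exact_mod_cast hp
  have hq := qFun_nonneg hd hτ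
  have hpd := mul_pred_pos hd hp
  unfold sliceFun sliceMax
  by_cases h1 : d = 1
  · rw [if_pos h1]
    subst h1
    have key : ∀ c : ℝ, 2 * c - p * c ^ 2 / (p - 1) ≤ (p - 1) / p := by
      intro c
      have h3 : (0 : ℝ) < p - 1 := by push_cast at hp'; linarith
      have h4 : (0 : ℝ) < p := by linarith
      have : (p - 1) / p - (2 * c - p * c ^ 2 / (p - 1))
          = ((p : ℝ) * c - (p - 1)) ^ 2 / (p * (p - 1)) := by
        field_simp; ring
      have h5 : 0 ≤ ((p : ℝ) * c - (p - 1)) ^ 2 / (p * (p - 1)) := by positivity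
      linarith
    have ka := key a
    have kb := key b
    have e : qFun 1 τ = 1 - τ ^ 2 := by unfold qFun; push_cast; ring
    rw [e] at hq ⊢
    push_cast
    simp only [one_mul, mul_one]
    nlinarith [mul_le_mul_of_nonneg_left ka hq, mul_le_mul_of_nonneg_left kb (sq_nonneg τ)]
  · rw [if_neg h1]
    have hd2 : (2 : ℝ) ≤ d := by exact_mod_cast (by omega : 2 ≤ d)
    have kb : 2 * b - (p : ℝ) * b ^ 2 / (p * d - 1) ≤ 2 - (p : ℝ) / (p * d - 1) := by
      have hp1 : (p : ℝ) ≤ p * d - 1 := by nlinarith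
      have : 2 - (p : ℝ) / (p * d - 1) - (2 * b - (p : ℝ) * b ^ 2 / (p * d - 1))
          = (1 - b) * ((p * d - 1 - p) + (p * d - 1 - p * b)) / (p * d - 1) := by
        field_simp; ring
      have h2 : 0 ≤ (1 - b) * ((p * d - 1 - p) + (p * d - 1 - p * b)) / ((p : ℝ) * d - 1) := by
        refine div_nonneg (mul_nonneg (by linarith) ?_) hpd.le
        nlinarith
      linarith
    have ka : 2 * a - (p : ℝ) * a ^ 2 / (d * (p - d)) ≤ 2 - hConst p d := by
      unfold hConst
      split_ifs with h
      · have hpe : (p : ℝ) = d + 1 := by exact_mod_cast h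
        rw [hpe]
        have : 2 - (2 - (d : ℝ) / (d + 1)) - (2 * a - ((d : ℝ) + 1) * a ^ 2 / (d * (d + 1 - d)))
            = (((d : ℝ) + 1) * a - d) ^ 2 / (d * (d + 1)) := by
          rw [show (d : ℝ) + 1 - d = 1 by ring]; field_simp; ring
        have h5 : 0 ≤ (((d : ℝ) + 1) * a - d) ^ 2 / (d * (d + 1)) := by positivity
        linarith
      · have hp2 : (d : ℝ) + 2 ≤ p := by exact_mod_cast (by omega : d + 2 ≤ p)
        have hpos : (0 : ℝ) < p - d := by linarith
        have hge : (p : ℝ) ≤ d * (p - d) := by nlinarith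
        have : 2 - (p : ℝ) / (d * (p - d)) - (2 * a - (p : ℝ) * a ^ 2 / (d * (p - d)))
            = (1 - a) * ((d * (p - d) - p) + (d * (p - d) - p * a)) / (d * (p - d)) := by
          field_simp; ring
        have h2 : 0 ≤ (1 - a) * ((d * (p - d) - p) + (d * (p - d) - p * a)) / ((d : ℝ) * (p - d)) := by
          refine div_nonneg (mul_nonneg (by linarith) ?_) (by positivity)
          nlinarith
        linarith
    have e : (2 * (d : ℝ) - (p : ℝ) * d / (p * d - 1)) * τ ^ 2
        = d * τ ^ 2 * (2 - (p : ℝ) / (p * d - 1)) := by ring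
    rw [e, mul_comm (2 - hConst p d)]
    gcongr

/-- Dropping `a ≤ b` cost nothing: the separate maximizers already satisfy it. -/
lemma exists_sliceFun_eq {p d : ℕ} (hd : 1 ≤ d) (hp : d + 1 ≤ p) (τ : ℝ) :
    ∃ a b : ℝ, 0 ≤ a ∧ a ≤ b ∧ b ≤ 1 ∧ sliceFun p d a b τ = sliceMax p d τ := by
  have hd' : (1 : ℝ) ≤ d := by exact_mod_cast hd
  have hp' : (d : ℝ) + 1 ≤ p := by exact_mod_cast hp
  have hpd := mul_pred_pos hd hp
  unfold sliceFun sliceMax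
  by_cases h1 : d = 1
  · subst h1
    push_cast at hp'
    have h3 : (0 : ℝ) < p - 1 := by linarith
    have h4 : (0 : ℝ) < p := by linarith
    refine ⟨(p - 1) / p, (p - 1) / p, by positivity, le_rfl, ?_, ?_⟩
    · rw [div_le_one h4]; linarith
    · rw [if_pos rfl]
      have e : qFun 1 τ = 1 - τ ^ 2 := by unfold qFun; push_cast; ring
      rw [e]; push_cast; simp only [one_mul, mul_one]; field_simp; ring
  · rw [if_neg h1]
    by_cases h : p = d + 1
    · refine ⟨d / (d + 1), 1, by positivity, ?_, le_rfl, ?_⟩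
      · rw [div_le_one (by linarith)]; linarith
      · rw [hConst, if_pos h]
        have hpe : (p : ℝ) = d + 1 := by exact_mod_cast h
        have : 2 * ((d : ℝ) / (d + 1)) - p * (d / (d + 1)) ^ 2 / (d * (p - d))
            = 2 - (2 - (d : ℝ) / (d + 1)) := by
          rw [hpe, show (d : ℝ) + 1 - d = 1 by ring]; field_simp; ring
        rw [this]; ring
    · refine ⟨1, 1, by norm_num, le_rfl, le_rfl, ?_⟩
      rw [hConst, if_neg h]; ring

/-- With `a = u / v` and `b = w / v` fixed, `g` is affine in `v` up to `1 / d`; the two ends are `v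
→ 0` and `v = 1 / d`. -/
lemma gFun_eq_of_le {p d : ℕ} (hd : 1 ≤ d) (hp : d + 1 ≤ p) {v : ℝ} (hv : 0 < v)
    (hv1 : d * v ≤ 1) (a b x τ : ℝ) :
    gFun p d (a * v) v (b * v) x τ
      = (1 - d * v) * (qFun d τ * (2 * a) - a ^ 2 / (x * d) + d * τ ^ 2 * (2 * b))
        + d * v * sliceFun p d a b τ := by
  have hd' : (1 : ℝ) ≤ d := by exact_mod_cast hd
  have hp' : (d : ℝ) + 1 ≤ p := by exact_mod_cast hp
  have hpd := (mul_pred_pos hd hp).ne'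
  have hpd2 : (p : ℝ) - d ≠ 0 := by linarith
  have hd0 : (d : ℝ) ≠ 0 := by linarith
  unfold gFun sliceFun
  rw [max_eq_left (by linarith), mul_div_cancel_right₀ _ hv.ne', mul_div_cancel_right₀ _ hv.ne']
  have e1 : 1 / x * ((1 - d * v) * (a * v) ^ 2 / (d * v ^ 2)) = (1 - d * v) * (a ^ 2 / (x * d)) := by
    rcases eq_or_ne x 0 with rfl | hx
    · simp
    · field_simp
  rw [e1]
  field_simp
  ring

/-- Beyond `v = 1 / d` the correction vanishes and the remaining terms decrease in `v` for fixed
`a`, `b`. -/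
lemma gFun_le_of_ge {p d : ℕ} (hd : 1 ≤ d) (hp : d + 1 ≤ p) {τ : ℝ} (hτ : τ ∈ Icc (0 : ℝ) 1) {v : ℝ}
    (hv : 0 < v) (hv1 : 1 ≤ d * v) (a b x : ℝ) :
    gFun p d (a * v) v (b * v) x τ ≤ sliceFun p d a b τ := by
  have hd' : (1 : ℝ) ≤ d := by exact_mod_cast hd
  have hp' : (d : ℝ) + 1 ≤ p := by exact_mod_cast hp
  have hpd := mul_pred_pos hd hp
  have hpd2 : 0 < (p : ℝ) - d := by linarith
  have hq := qFun_nonneg hd hτ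
  unfold gFun sliceFun
  rw [max_eq_right (by linarith), mul_div_cancel_right₀ _ hv.ne', mul_div_cancel_right₀ _ hv.ne',
    zero_mul, zero_div, mul_zero, sub_zero, mul_assoc, mul_assoc]
  have e1 : a * (2 - p * (a * v) / (p - d)) ≤ 2 * a - p * a ^ 2 / (d * (p - d)) := by
    have : 2 * a - p * a ^ 2 / (d * (p - d)) - a * (2 - p * (a * v) / (p - d))
        = p * a ^ 2 * (d * v - 1) / (d * (p - d)) := by field_simp; ring
    have h2 : 0 ≤ p * a ^ 2 * (d * v - 1) / (d * ((p : ℝ) - d)) :=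
      div_nonneg (mul_nonneg (by positivity) (by linarith)) (by positivity)
    linarith
  have e2 : b * (2 - p * d * (b * v) / (p * d - 1)) ≤ 2 * b - p * b ^ 2 / (p * d - 1) := by
    have : 2 * b - p * b ^ 2 / (p * d - 1) - b * (2 - p * d * (b * v) / (p * d - 1))
        = p * b ^ 2 * (d * v - 1) / (p * d - 1) := by field_simp; ring
    have h2 : 0 ≤ p * b ^ 2 * (d * v - 1) / ((p : ℝ) * d - 1) :=
      div_nonneg (mul_nonneg (by positivity) (by linarith)) hpd.le
    linarith
  have := mul_le_mul_of_nonneg_left e1 hq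
  have := mul_le_mul_of_nonneg_left e2 (by positivity : 0 ≤ (d : ℝ) * τ ^ 2)
  simp only [mul_assoc] at *
  linarith

/-- For `d = 1` one has `q = 1 - τ²`, so `x q ≤ 1` and `psiFun` never saturates; the separate
formula for `d = 1` then agrees with the general one. -/
lemma GEnv_eq_of_lt_one {p d : ℕ} (hd : 1 ≤ d) {τ x : ℝ} (hτ : τ ∈ Icc (0 : ℝ) 1)
    (hx : x ∈ Ioo (0 : ℝ) 1) :
    GEnv p d x τ = max (qFun d τ * psiFun (x * d * qFun d τ) + 2 * d * τ ^ 2) (sliceMax p d τ) := by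
  unfold GEnv
  split_ifs with h
  · subst h
    have e : qFun 1 τ = 1 - τ ^ 2 := by unfold qFun; push_cast; ring
    have hq := qFun_nonneg le_rfl hτ
    rw [psiFun_of_le, e]
    · congr 1; push_cast; ring
    · rw [e] at hq ⊢; push_cast
      have : x * (1 - τ ^ 2) ≤ 1 * 1 :=
        mul_le_mul hx.2.le (by nlinarith [sq_nonneg τ]) hq (by norm_num)
      linarith
  · rfl

theorem isLUB_GFun {p d : ℕ} (hd : 1 ≤ d) (hp : d + 1 ≤ p) {τ : ℝ} (hτ : τ ∈ Icc (0 : ℝ) 1)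
    {x : ℝ} (hx : x ∈ Ioo (0 : ℝ) 1) :
    IsLUB {y : ℝ | ∃ u v w : ℝ, 0 ≤ u ∧ u ≤ w ∧ w ≤ v ∧ 0 < v ∧ v ≤ 1 ∧
        y = gFun p d u v w x τ} (GFun p d x τ) := by
  have hd' : (1 : ℝ) ≤ d := by exact_mod_cast hd
  have hq := qFun_nonneg hd hτ
  have hx0 := hx.1
  rw [GFun_eq_GEnv hd hp x hτ, GEnv_eq_of_lt_one hd hτ hx]
  constructor
  · rintro y ⟨u, v, w, hu, huw, hwv, hv, hv1, rfl⟩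
    have hvne := hv.ne'
    have eu : u = u / v * v := by field_simp
    have ew : w = w / v * v := by field_simp
    have ha : u / v ≤ 1 := by rw [div_le_one hv]; linarith
    have hb : w / v ≤ 1 := by rw [div_le_one hv]; linarith
    rw [eu, ew]
    set a := u / v
    set b := w / v
    have hs := sliceFun_le hd hp hτ ha hb
    rcases le_total 1 (d * v) with h | h
    · exact (gFun_le_of_ge hd hp hτ hv h a b x).trans (hs.trans (le_max_right _ _))
    · rw [gFun_eq_of_le hd hp hv h]
      have h0 : qFun d τ * (2 * a) - a ^ 2 / (x * d) + d * τ ^ 2 * (2 * b)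
          ≤ qFun d τ * psiFun (x * d * qFun d τ) + 2 * d * τ ^ 2 := by
        have hbb : d * τ ^ 2 * (2 * b) ≤ d * τ ^ 2 * 2 := by
          apply mul_le_mul_of_nonneg_left _ (by positivity); linarith
        have : qFun d τ * (2 * a) - a ^ 2 / (x * d) ≤ qFun d τ * psiFun (x * d * qFun d τ) := by
          rcases hq.eq_or_lt with h0 | h0
          · rw [← h0]
            have : 0 ≤ a ^ 2 / (x * d) := by positivity
            linarith
          · have := mul_le_mul_of_nonneg_left
              (two_mul_sub_sq_div_le_psiFun ha (by positivity : 0 < x * d * qFun d τ)) hq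
            rw [mul_sub] at this
            have e : qFun d τ * (a ^ 2 / (x * d * qFun d τ)) = a ^ 2 / (x * d) := by field_simp
            rw [e] at this
            exact this
        linarith
      have hA := h0.trans (le_max_left _ (sliceMax p d τ))
      have hB := hs.trans
        (le_max_right (qFun d τ * psiFun (x * d * qFun d τ) + 2 * d * τ ^ 2) _)
      have h1 : 0 ≤ 1 - d * v := by linarith
      have h2 : 0 ≤ d * v := by positivity
      nlinarith [mul_le_mul_of_nonneg_left hA h1, mul_le_mul_of_nonneg_left hB h2]
  · intro y hy
    refine max_le ?_ ?_
    · set z := x * d * qFun d τ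
      have hz : 0 ≤ z := by positivity
      have ha0 : 0 ≤ min z 1 := le_min hz zero_le_one
      set V := qFun d τ * psiFun z + 2 * d * τ ^ 2
      set K := sliceFun p d (min z 1) 1 τ
      have hval : qFun d τ * (2 * min z 1) - (min z 1) ^ 2 / (x * d) + d * τ ^ 2 * (2 * 1) = V := by
        rcases hq.eq_or_lt with h0 | h0
        · have : z = 0 := by simp only [z, ← h0]; ring
          simp only [V, ← h0, this]; norm_num; ring
        · have := psiFun_attained (by positivity : 0 < z)
          simp only [V]
          rw [← this, mul_sub]
          have e : qFun d τ * (min z 1 ^ 2 / z) = min z 1 ^ 2 / (x * d) := by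
            simp only [z]; field_simp
          rw [e]; ring
      -- The end `v → 0` is excluded, so its value `V` is only a limit: take `v = s / d` and let `s
      -- → 0`.
      have hle : ∀ s : ℝ, 0 < s → s ≤ 1 → (1 - s) * V + s * K ≤ y := by
        intro s hs hs1
        apply hy
        have hv : 0 < s / d := by positivity
        have hds : d * (s / d) = s := by field_simp
        have hv1 : s / d ≤ 1 := by rw [div_le_one (by linarith)]; linarith
        refine ⟨min z 1 * (s / d), s / d, 1 * (s / d), by positivity, ?_, by linarith, hv, hv1, ?_⟩
        · exact mul_le_mul_of_nonneg_right (min_le_right _ _) hv.le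
        · rw [gFun_eq_of_le hd hp hv (by linarith), hds, hval]
      by_contra hc
      push Not at hc
      have hlim : Filter.Tendsto (fun s : ℝ => (1 - s) * V + s * K) (nhdsWithin 0 (Ioi 0))
          (nhds ((1 - 0) * V + 0 * K)) :=
        (Continuous.tendsto (by fun_prop) 0).mono_left nhdsWithin_le_nhds
      have := le_of_tendsto hlim (b := y) (by
        filter_upwards [Ioc_mem_nhdsGT (zero_lt_one' ℝ)] with s hs
        exact hle s hs.1 hs.2)
      linarith
    · obtain ⟨a, b, ha, hab, hb, he⟩ := exists_sliceFun_eq hd hp τ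
      rw [← he]
      apply hy
      have hv : (0 : ℝ) < 1 / d := by positivity
      have hds : (d : ℝ) * (1 / d) = 1 := by field_simp
      have hv1 : (1 : ℝ) / d ≤ 1 := by rw [div_le_one (by linarith)]; linarith
      refine ⟨a * (1 / d), 1 / d, b * (1 / d), by positivity, by gcongr, ?_, hv, hv1, ?_⟩
      · exact mul_le_of_le_one_left hv.le hb
      · rw [gFun_eq_of_le hd hp hv hds.le, hds]; ring

/-! ### The largest feasible `α` -/

/-- In `y = α⁻¹` the condition reads `0 ≤ r y - γ (1 - y)`, a strictly increasing function that is
negative at `0`. Its unique zero is positive, so no negative `α` is feasible and the largest one is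
the inverse of the zero. -/
lemma feasible_root {γ : ℝ → ℝ} (hmono : Monotone γ) (hcont : Continuous γ) (h1 : 0 < γ 1) {r : ℝ}
    (hr : 0 < r) :
    let F := {α : ℝ | α ≠ 0 ∧ γ (1 - α⁻¹) ≤ r * α⁻¹}
    IsGreatest F (sSup F) ∧ 0 < sSup F ∧
      ∀ α, α ≠ 0 → (sSup F = α ↔ γ (1 - α⁻¹) = r * α⁻¹) := by
  intro F
  have hstrict : StrictMono fun y => r * y - γ (1 - y) := by
    intro a b hab
    have h2 : γ (1 - b) ≤ γ (1 - a) := hmono (by linarith)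
    have h3 : r * a < r * b := mul_lt_mul_of_pos_left hab hr
    simp only; linarith
  obtain ⟨y, hy, hy0⟩ : ∃ y : ℝ, 0 < y ∧ r * y - γ (1 - y) = 0 := by
    -- At `y = γ 1 / r` the linear term equals `γ 1`, which dominates `γ (1 - y)` by monotonicity,
    -- so this is a right end for the intermediate value theorem.
    have hpos : 0 < γ 1 / r := div_pos h1 hr
    have hivt := intermediate_value_Icc hpos.le
      (f := fun y => r * y - γ (1 - y)) (by fun_prop)
    have hmem : (0 : ℝ) ∈ Icc (r * 0 - γ (1 - 0)) (r * (γ 1 / r) - γ (1 - γ 1 / r)) := by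
      constructor
      · simp only [mul_zero, sub_zero]; linarith
      · have : γ (1 - γ 1 / r) ≤ γ 1 := hmono (by linarith)
        rw [mul_div_cancel₀ _ hr.ne']; linarith
    obtain ⟨y, hy, he⟩ := hivt hmem
    refine ⟨y, lt_of_le_of_ne hy.1 ?_, he⟩
    rintro rfl
    simp only [mul_zero, sub_zero] at he
    linarith
  have hgr : IsGreatest F y⁻¹ := by
    constructor
    · refine ⟨inv_ne_zero hy.ne', ?_⟩
      rw [inv_inv]; linarith
    · rintro α ⟨hα, hle⟩
      have : y ≤ α⁻¹ := hstrict.le_iff_le.mp (by linarith)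
      have := inv_anti₀ hy this
      rwa [inv_inv] at this
  have hs : sSup F = y⁻¹ := hgr.csSup_eq
  rw [hs]
  refine ⟨hgr, inv_pos.mpr hy, fun α hα => ?_⟩
  constructor
  · rintro rfl
    rw [inv_inv]; linarith
  · intro h
    have : y = α⁻¹ := hstrict.injective (by linarith)
    rw [this, inv_inv]

section
variable {p d : ℕ} (hd : 1 ≤ d) (hp : d + 1 ≤ p) {τ : ℝ} (hτ : τ ∈ Icc (0 : ℝ) 1)
include hd hp hτ

lemma feasible_eq :
    feasible p d τ = {α : ℝ | α ≠ 0 ∧ GEnv p d (1 - α⁻¹) τ ≤ rFun p d τ * α⁻¹} := by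
  ext α; simp only [feasible, mem_ofPred_eq, GFun_eq_GEnv hd hp _ hτ]

lemma feasible_spec :
    IsGreatest (feasible p d τ) (alphaAt p d τ) ∧ 0 < alphaAt p d τ ∧
      ∀ α, α ≠ 0 → (alphaAt p d τ = α ↔ GFun p d (1 - α⁻¹) τ = rFun p d τ * α⁻¹) := by
  have hc : Continuous fun x => GEnv p d x τ :=
    (continuous_GEnv p d).comp (by fun_prop : Continuous fun x : ℝ => (x, τ))
  have := feasible_root (monotone_GEnv hd hτ) hc (GEnv_one_pos hd hp hτ) (rFun_pos hd hp τ)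
  rw [alphaAt, feasible_eq hd hp hτ]
  simp only [GFun_eq_GEnv hd hp _ hτ]
  exact this

end

/-! ### Closed forms -/

lemma one_sub_inv_mul_add_eq_iff {α A B r : ℝ} (hα : α ≠ 0) (hA : 0 < A + B) :
    (1 - α⁻¹) * A + B = r * α⁻¹ ↔ α = (A + r) / (A + B) := by
  rw [eq_div_iff hA.ne']
  constructor
  · intro h
    field_simp at h
    linarith
  · intro h
    field_simp
    linarith

lemma eq_mul_inv_iff {α V r : ℝ} (hα : α ≠ 0) (hr : 0 < r) : V = r * α⁻¹ ↔ α = r / V := by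
  rcases eq_or_ne V 0 with rfl | hV
  · simp [hα, hr.ne']
  · rw [eq_div_iff hV]
    constructor
    · rintro rfl; field_simp
    · rintro h; rw [← h]; field_simp

lemma alphaAt_eq_iff_of_dim_one {p : ℕ} (hp : 2 ≤ p) {τ : ℝ} (hτ : τ ∈ Icc (0 : ℝ) 1) {α : ℝ}
    (hα : α ≠ 0) :
    (((p : ℝ) - 1) / p ≤ (1 - α⁻¹) * (1 - τ ^ 2) ^ 2 + 2 * τ ^ 2 →
        (alphaAt p 1 τ = α ↔
          α = ((p : ℝ) - 1 + (1 - τ ^ 2) ^ 2) / (2 * τ ^ 2 + (1 - τ ^ 2) ^ 2))) ∧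
      ((1 - α⁻¹) * (1 - τ ^ 2) ^ 2 + 2 * τ ^ 2 ≤ ((p : ℝ) - 1) / p →
        (alphaAt p 1 τ = α ↔ α = p)) := by
  have hspec := (feasible_spec le_rfl hp hτ).2.2 α hα
  have hp' : (2 : ℝ) ≤ p := by exact_mod_cast hp
  have hr : rFun p 1 τ = p - 1 := by unfold rFun; push_cast; ring
  have hden : 0 < (1 - τ ^ 2) ^ 2 + 2 * τ ^ 2 := by nlinarith [sq_nonneg (τ ^ 2)]
  rw [hspec, hr, GFun, if_pos rfl]
  constructor
  · intro h
    rw [max_eq_left h, one_sub_inv_mul_add_eq_iff hα hden,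
      add_comm ((1 - τ ^ 2) ^ 2), add_comm ((1 - τ ^ 2) ^ 2)]
  · intro h
    rw [max_eq_right h, eq_mul_inv_iff hα (by linarith)]
    have : ((p : ℝ) - 1) / ((p - 1) / p) = p := by
      have : (p : ℝ) - 1 ≠ 0 := by linarith
      field_simp
    rw [this]

section
variable {p d : ℕ} (hd : 2 ≤ d) (hp : d + 1 ≤ p) {τ : ℝ} (hτ : τ ∈ Icc (0 : ℝ) 1)
include hd

/-- On `x > 0` the gap is strictly increasing and continuous in `x`, so a largest element must turn
the inequality into an equality. -/
lemma isGreatest_firstCaseSet_iff (hr : 0 < rFun p d τ) {α : ℝ} (hα : α ≠ 0) (hx : 0 < 1 - α⁻¹) :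
    IsGreatest (firstCaseSet p d τ) α ↔
      2 * qFun d τ + 2 * d * τ ^ 2 - 1 / ((1 - α⁻¹) * d) = rFun p d τ * α⁻¹ := by
  have hd' : (2 : ℝ) ≤ d := by exact_mod_cast hd
  set r := rFun p d τ
  set C := 2 * (qFun d τ + d * τ ^ 2) with hC
  -- In fact `C = (d - 1)(2τ - 1)² + d + 1`.
  have hC1 : 1 < C := by
    rw [hC]; unfold qFun
    nlinarith [mul_nonneg (by linarith : (0 : ℝ) ≤ d - 1) (sq_nonneg (2 * τ - 1))]
  have hCe : 2 * qFun d τ + 2 * d * τ ^ 2 = C := by rw [hC]; ring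
  rw [hCe]
  -- along `x = 1 - α⁻¹ > 0` the defining function increases strictly
  let f : ℝ → ℝ := fun x => C - 1 / (x * d) - r * (1 - x)
  have hf : ∀ x y : ℝ, 0 < x → x < y → f x < f y := by
    intro x y hx0 hxy
    have h1 : 1 / (y * d) ≤ 1 / (x * d) :=
      one_div_le_one_div_of_le (by positivity) (by gcongr)
    have h2 : r * (1 - y) < r * (1 - x) := mul_lt_mul_of_pos_left (by linarith) hr
    simp only [f]; linarith
  have hf1 : 0 < f 1 := by
    have : 1 / (1 * (d : ℝ)) ≤ 1 := by rw [div_le_one (by linarith)]; linarith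
    simp only [f]; linarith
  have hmem : ∀ β : ℝ, β ∈ firstCaseSet p d τ ↔ β ≠ 0 ∧ β ≠ 1 ∧ f (1 - β⁻¹) ≤ 0 := by
    intro β
    simp only [firstCaseSet, mem_ofPred_eq, f, sub_sub_cancel]
    constructor <;> rintro ⟨h1, h2, h3⟩ <;> exact ⟨h1, h2, by linarith⟩
  have hα1 : α ≠ 1 := by rintro rfl; norm_num at hx
  -- Since `f > 0` for `x ≥ 1`, feasibility forces `x < 1`, which excludes negative `α`; then `x >
  -- 0` excludes `α ≤ 1`.
  have key : f (1 - α⁻¹) ≤ 0 → 1 < α := by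
    intro h
    have h1 : 1 - α⁻¹ < 1 := by
      by_contra hc
      push Not at hc
      rcases hc.eq_or_lt with h' | h'
      · rw [← h'] at h; linarith
      · have := hf 1 _ one_pos h'; linarith
    have hpos : 0 < α := inv_pos.mp (by linarith)
    by_contra hc
    push Not at hc
    have : 1 ≤ α⁻¹ := (one_le_inv₀ hpos).mpr hc
    linarith
  have hgoal : f (1 - α⁻¹) = 0 ↔ C - 1 / ((1 - α⁻¹) * d) = r * α⁻¹ := by
    simp only [f, sub_sub_cancel]
    constructor <;> intro h <;> linarith
  rw [← hgoal]
  constructor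
  · rintro ⟨hm, hub⟩
    have hle := ((hmem α).mp hm).2.2
    have hgt := key hle
    by_contra hne
    have hlt : f (1 - α⁻¹) < 0 := lt_of_le_of_ne hle hne
    -- A strict inequality would survive a small increase of `α`.
    have hcont : ContinuousAt (fun β : ℝ => f (1 - β⁻¹)) α := by
      simp only [f]
      have : (1 - α⁻¹) * d ≠ 0 := by positivity
      fun_prop (disch := assumption)
    have hev := (hcont.eventually (gt_mem_nhds hlt)).filter_mono
      (nhdsWithin_le_nhds (s := Ioi α))
    obtain ⟨β, hβ, hβα⟩ := (hev.and self_mem_nhdsWithin).exists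
    have hβα' : α < β := hβα
    have := hub ((hmem β).mpr ⟨by linarith, by linarith, hβ.le⟩)
    linarith
  · intro h
    have hgt := key h.le
    refine ⟨(hmem α).mpr ⟨hα, hα1, h.le⟩, fun β hβ => ?_⟩
    have hle := ((hmem β).mp hβ).2.2
    by_contra hc
    push Not at hc
    have hinv : β⁻¹ < α⁻¹ := inv_strictAnti₀ (by linarith) hc
    have := hf (1 - α⁻¹) (1 - β⁻¹) hx (by linarith)
    linarith

include hp

/-- For `h ≥ 1` the slice value overtakes `psiFun z` at `z = 2 - h ≤ 1`, on the linear branch, so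
all three cases can occur. -/
lemma alphaAt_eq_iff_of_one_le_hFun (hτ : τ ∈ Ico (0 : ℝ) 1) (hh : 1 ≤ hFun p d τ) {α : ℝ}
    (hα : α ≠ 0) :
    (1 / (d * qFun d τ) ≤ 1 - α⁻¹ →
        (alphaAt p d τ = α ↔ IsGreatest (firstCaseSet p d τ) α)) ∧
      ((2 - hFun p d τ) / (d * qFun d τ) ≤ 1 - α⁻¹ → 1 - α⁻¹ ≤ 1 / (d * qFun d τ) →
        (alphaAt p d τ = α ↔
          α = (d * qFun d τ ^ 2 + rFun p d τ) / (d * qFun d τ ^ 2 + 2 * d * τ ^ 2))) ∧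
      (1 - α⁻¹ ≤ (2 - hFun p d τ) / (d * qFun d τ) →
        (alphaAt p d τ = α ↔
          α = rFun p d τ / (2 * (qFun d τ + d * τ ^ 2) - qFun d τ * hFun p d τ))) := by
  have hd1 : 1 ≤ d := by omega
  have hspec := (feasible_spec hd1 hp (Ico_subset_Icc_self hτ)).2.2 α hα
  have hr := rFun_pos hd1 hp τ
  have hd' : (2 : ℝ) ≤ d := by exact_mod_cast hd
  have hq := qFun_pos hd1 hτ.1 hτ.2
  have hdq : 0 < d * qFun d τ := by positivity
  have hG := GFun_eq_GEnv hd1 hp (1 - α⁻¹) (Ico_subset_Icc_self hτ)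
  rw [GEnv, if_neg (by omega), sliceMax_eq hd hτ.1 hτ.2] at hG
  rw [hspec, hG]
  have ez : (1 - α⁻¹) * d * qFun d τ = (1 - α⁻¹) * (d * qFun d τ) := by ring
  rw [ez]
  set q := qFun d τ
  set h := hFun p d τ
  set x := 1 - α⁻¹ with hx
  refine ⟨fun c => ?_, fun c1 c2 => ?_, fun c => ?_⟩
  · have hx0 : 0 < x := lt_of_lt_of_le (by positivity) c
    rw [div_le_iff₀ hdq] at c
    rw [isGreatest_firstCaseSet_iff hd hr hα hx0, psiFun_of_ge c, max_eq_left]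
    · have e : q * (2 - 1 / (x * (d * q))) + 2 * d * τ ^ 2
          = 2 * q + 2 * d * τ ^ 2 - 1 / (x * d) := by field_simp; ring
      rw [e]
    · have : 1 / (x * (d * q)) ≤ 1 := by rw [div_le_one (by positivity)]; exact c
      nlinarith
  · rw [div_le_iff₀ hdq] at c1
    rw [le_div_iff₀ hdq] at c2
    rw [psiFun_of_le c2, max_eq_left (by nlinarith), add_comm (d * q ^ 2) (rFun p d τ),
      show q * (x * (d * q)) + 2 * d * τ ^ 2 = x * (d * q ^ 2) + 2 * d * τ ^ 2 by ring, hx,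
      one_sub_inv_mul_add_eq_iff hα (by positivity), add_comm (rFun p d τ)]
  · rw [le_div_iff₀ hdq] at c
    rw [psiFun_of_le (by linarith), max_eq_right (by nlinarith),
      show 2 * q + 2 * d * τ ^ 2 = 2 * (q + d * τ ^ 2) by ring, eq_mul_inv_iff hα hr]

/-- For `h ≤ 1` the crossing solves `2 - 1 / z = 2 - h`, that is `z = 1 / h ≥ 1`, on the saturated
branch; the middle case disappears. -/
lemma alphaAt_eq_iff_of_hFun_le_one (hτ : τ ∈ Ico (0 : ℝ) 1) (hh : hFun p d τ ≤ 1) {α : ℝ}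
    (hα : α ≠ 0) :
    (1 / (d * qFun d τ * hFun p d τ) ≤ 1 - α⁻¹ →
        (alphaAt p d τ = α ↔ IsGreatest (firstCaseSet p d τ) α)) ∧
      (1 - α⁻¹ ≤ 1 / (d * qFun d τ * hFun p d τ) →
        (alphaAt p d τ = α ↔
          α = rFun p d τ / (2 * (qFun d τ + d * τ ^ 2) - qFun d τ * hFun p d τ))) := by
  have hd1 : 1 ≤ d := by omega
  have hspec := (feasible_spec hd1 hp (Ico_subset_Icc_self hτ)).2.2 α hα
  have hr := rFun_pos hd1 hp τ
  have hd' : (2 : ℝ) ≤ d := by exact_mod_cast hd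
  have hq := qFun_pos hd1 hτ.1 hτ.2
  have hh0 := hFun_pos hd1 hp hτ.1 hτ.2
  have hdq : 0 < d * qFun d τ * hFun p d τ := by positivity
  have hG := GFun_eq_GEnv hd1 hp (1 - α⁻¹) (Ico_subset_Icc_self hτ)
  rw [GEnv, if_neg (by omega), sliceMax_eq hd hτ.1 hτ.2] at hG
  rw [hspec, hG]
  set q := qFun d τ
  set h := hFun p d τ
  set x := 1 - α⁻¹ with hx
  refine ⟨fun c => ?_, fun c => ?_⟩
  · have hx0 : 0 < x := lt_of_lt_of_le (by positivity) c
    rw [div_le_iff₀ hdq] at c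
    have hz : 0 < x * d * q := by positivity
    have hz1 : 1 ≤ x * d * q := by nlinarith
    rw [isGreatest_firstCaseSet_iff hd hr hα hx0, psiFun_of_ge hz1, max_eq_left]
    · have e : q * (2 - 1 / (x * d * q)) + 2 * d * τ ^ 2
          = 2 * q + 2 * d * τ ^ 2 - 1 / (x * d) := by field_simp; ring
      rw [e]
    · have : 1 / (x * d * q) ≤ h := by rw [div_le_iff₀ hz]; linarith
      nlinarith
  · rw [le_div_iff₀ hdq] at c
    rw [max_eq_right, show 2 * q + 2 * d * τ ^ 2 = 2 * (q + d * τ ^ 2) by ring,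
      eq_mul_inv_iff hα hr]
    rcases le_total (x * d * q) 1 with h' | h'
    · rw [psiFun_of_le h']; nlinarith
    · rw [psiFun_of_ge h']
      have : h ≤ 1 / (x * d * q) := by rw [le_div_iff₀ (by linarith)]; linarith
      nlinarith

omit hp in
lemma alphaAt_one (hp : d + 1 ≤ p) : alphaAt p d 1 = ((p : ℝ) + d - 2) / (2 * d) := by
  have hd' : (2 : ℝ) ≤ d := by exact_mod_cast hd
  have hp' : (d : ℝ) + 1 ≤ p := by exact_mod_cast hp
  have hr : rFun p d 1 = p + d - 2 := by unfold rFun; ring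
  have hα : ((p : ℝ) + d - 2) / (2 * d) ≠ 0 := (div_pos (by linarith) (by linarith)).ne'
  rw [(feasible_spec (by omega) hp ⟨zero_le_one, le_rfl⟩).2.2 _ hα, hr, GFun, if_neg (by omega),
    if_pos rfl, qFun_one]
  have : (p : ℝ) + d - 2 ≠ 0 := by linarith
  field_simp
  ring

end

/-! ### The maximum over `τ` -/

/-- Continuity of `alphaAt` in `τ` is not needed: minimize `y = α⁻¹` over the compact set of
feasible pairs `(τ, y)`, where joint continuity of `GEnv` suffices. The value at `τ = 0` supplies
the upper bound `y0`. -/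
lemma isGreatest_alphaG {p d : ℕ} (hd : 1 ≤ d) (hp : d + 1 ≤ p) :
    IsGreatest (alphaAt p d '' Icc 0 1) (alphaG p d) := by
  have hspec := fun τ (hτ : τ ∈ Icc (0 : ℝ) 1) => feasible_spec hd hp hτ
  have h0 : (0 : ℝ) ∈ Icc (0 : ℝ) 1 := ⟨le_rfl, zero_le_one⟩
  set y0 := (alphaAt p d 0)⁻¹ with hy0
  have hG := continuous_GEnv p d
  have hrc := continuous_rFun p d
  let K : Set (ℝ × ℝ) := (Icc 0 1 ×ˢ Icc 0 y0) ∩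
    {z | GEnv p d (1 - z.2) z.1 ≤ rFun p d z.1 * z.2}
  have hKc : IsCompact K := by
    refine (isCompact_Icc.prod isCompact_Icc).inter_right (isClosed_le ?_ (by fun_prop))
    exact hG.comp (by fun_prop : Continuous fun z : ℝ × ℝ => (1 - z.2, z.1))
  have hmem : ∀ τ ∈ Icc (0 : ℝ) 1, (alphaAt p d τ)⁻¹ ≤ y0 → (τ, (alphaAt p d τ)⁻¹) ∈ K := by
    intro τ hτ hle
    refine ⟨⟨hτ, inv_nonneg.mpr (hspec τ hτ).2.1.le, hle⟩, ?_⟩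
    have := (hspec τ hτ).1.1.2
    rwa [GFun_eq_GEnv hd hp _ hτ] at this
  obtain ⟨⟨τ₁, y₁⟩, ⟨⟨hτ₁, hy₁⟩, hle₁⟩, hmin⟩ :=
    hKc.exists_isMinOn ⟨_, hmem 0 h0 le_rfl⟩ (f := Prod.snd) continuous_snd.continuousOn
  simp only at hτ₁ hy₁
  have hle₁' : GEnv p d (1 - y₁) τ₁ ≤ rFun p d τ₁ * y₁ := hle₁
  -- The minimum is not at `y = 0`, because `GEnv` is positive at `x = 1`.
  have hy₁pos : 0 < y₁ := by
    refine lt_of_le_of_ne hy₁.1 ?_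
    rintro rfl
    have := GEnv_one_pos hd hp hτ₁
    simp only [sub_zero, mul_zero] at hle₁'
    linarith
  have hge : y₁⁻¹ ≤ alphaAt p d τ₁ := by
    refine (hspec τ₁ hτ₁).1.2 ⟨inv_ne_zero hy₁pos.ne', ?_⟩
    rwa [inv_inv, GFun_eq_GEnv hd hp _ hτ₁]
  have hgr : IsGreatest (alphaAt p d '' Icc 0 1) (alphaAt p d τ₁) := by
    refine ⟨⟨τ₁, hτ₁, rfl⟩, ?_⟩
    rintro _ ⟨τ, hτ, rfl⟩
    refine le_trans ?_ hge
    have hy : y₁ ≤ (alphaAt p d τ)⁻¹ := by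
      rcases le_total (alphaAt p d τ)⁻¹ y0 with h | h
      · exact hmin (hmem τ hτ h)
      · exact hy₁.2.trans h
    have := inv_anti₀ hy₁pos hy
    rwa [inv_inv] at this
  rw [alphaG, hgr.csSup_eq]
  exact hgr

/-- The floor `(p - 1) / p` of `G` against `r = p - 1` caps every `α` at `p`; at `τ = 0` and `α = p`
both branches of `G` equal this floor. -/
lemma alphaG_of_dim_one {p : ℕ} (hp : 2 ≤ p) : alphaG p 1 = p := by
  have hp' : (2 : ℝ) ≤ p := by exact_mod_cast hp
  have h0 : (0 : ℝ) ∈ Icc (0 : ℝ) 1 := ⟨le_rfl, zero_le_one⟩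
  have hgr : IsGreatest (alphaAt p 1 '' Icc 0 1) (p : ℝ) := by
    constructor
    · refine ⟨0, h0, ?_⟩
      refine ((alphaAt_eq_iff_of_dim_one hp h0 (by linarith : (p : ℝ) ≠ 0)).2 ?_).mpr rfl
      refine le_of_eq ?_
      field_simp; ring
    · rintro _ ⟨τ, hτ, rfl⟩
      obtain ⟨h1, h2, -⟩ := feasible_spec le_rfl hp hτ
      have hr : rFun p 1 τ = p - 1 := by unfold rFun; push_cast; ring
      have := h1.1.2
      rw [hr, GFun, if_pos rfl] at this
      have h3 := (le_max_right _ _).trans this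
      rw [← div_eq_mul_inv, div_le_div_iff₀ (by linarith) h2] at h3
      exact le_of_mul_le_mul_left h3 (by linarith)
  rw [alphaG, hgr.csSup_eq]

/-- At `α = 1` one has `x = 0` and `psiFun 0 = 0`, so the two hypotheses are the two terms of the
maximum; strictness pushes the root past `1`. -/
lemma one_lt_alphaG_of_exists {p d : ℕ} (hd : 2 ≤ d) (hp : d + 1 ≤ p) {τ : ℝ}
    (hτ : τ ∈ Icc (0 : ℝ) 1) (h1 : 2 * d * τ ^ 2 < rFun p d τ) (h2 : sliceMax p d τ < rFun p d τ) :
    1 < alphaG p d := by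
  refine lt_of_lt_of_le ?_ ((isGreatest_alphaG (by omega) hp).2 ⟨τ, hτ, rfl⟩)
  obtain ⟨hgr, hpos, heq⟩ := feasible_spec (by omega : 1 ≤ d) hp hτ
  have hG : GFun p d (1 - (1 : ℝ)⁻¹) τ < rFun p d τ * (1 : ℝ)⁻¹ := by
    rw [GFun_eq_GEnv (by omega) hp _ hτ, GEnv, if_neg (by omega)]
    norm_num
    rw [psiFun_of_le zero_le_one]
    exact ⟨by linarith, h2⟩
  have hle : 1 ≤ alphaAt p d τ := hgr.2 ⟨one_ne_zero, hG.le⟩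
  refine lt_of_le_of_ne hle fun h => ?_
  exact hG.ne ((heq 1 one_ne_zero).mp h.symm)

lemma one_lt_alphaG {p d : ℕ}
    (h : (2 ≤ d ∧ d + 2 ≤ p) ∨ (p = d + 1 ∧ (d = 2 ∨ d = 3))) : 1 < alphaG p d := by
  rcases h with ⟨hd, hp⟩ | ⟨rfl, rfl | rfl⟩
  · have hd' : (2 : ℝ) ≤ d := by exact_mod_cast hd
    have hp' : (d : ℝ) + 2 ≤ p := by exact_mod_cast hp
    -- The condition `2 d τ² < r(τ)` means `2 τ² < p - d`, which holds for all `τ < 1` as `p - d ≥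
    -- 2`. The slice condition holds strictly at `τ = 1`, hence slightly below.
    have hc : Continuous fun τ => rFun p d τ - sliceMax p d τ :=
      (continuous_rFun p d).sub (continuous_sliceMax p d)
    have hone : 0 < rFun p d 1 - sliceMax p d 1 := by
      have := mul_pred_pos (by omega : 1 ≤ d) (by omega : d + 1 ≤ p)
      have : 0 < (p : ℝ) * d / (p * d - 1) := div_pos (by nlinarith) this
      rw [sliceMax, if_neg (by omega), qFun_one, rFun]
      nlinarith
    have hev := ((hc.tendsto 1).eventually (lt_mem_nhds hone)).filter_mono
      (nhdsWithin_le_nhds (s := Iio 1))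
    obtain ⟨τ, h1, h2⟩ := (hev.and (Ioo_mem_nhdsLT (zero_lt_one' ℝ))).exists
    refine one_lt_alphaG_of_exists hd (by omega) ⟨h2.1.le, h2.2.le⟩ ?_ (by linarith)
    have : τ ^ 2 < 1 := by nlinarith [h2.1, h2.2]
    unfold rFun; nlinarith
  -- For `p = d + 1` the first condition is `2 τ² < 1`. Both sample values, `1/2` here and `7/10`
  -- below, respect it.
  · refine one_lt_alphaG_of_exists le_rfl le_rfl (τ := 1 / 2) ⟨by norm_num, by norm_num⟩ ?_ ?_
    · norm_num [rFun]
    · norm_num [rFun, sliceMax, hConst, qFun]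
  · refine one_lt_alphaG_of_exists (by norm_num) le_rfl (τ := 7 / 10) ⟨by norm_num, by norm_num⟩ ?_ ?_
    · norm_num [rFun]
    · norm_num [rFun, sliceMax, hConst, qFun]

/-! ### The Frobenius form -/

section Frobenius
variable {m k l : Type*} [Fintype m] [Fintype k] [Fintype l]

lemma frobInner_eq_sum (X Y : Matrix m k ℝ) : frobInner X Y = ∑ i, ∑ j, X i j * Y i j := by
  simp [frobInner, Matrix.trace, Matrix.mul_apply]

lemma frobInner_comm (X Y : Matrix m k ℝ) : frobInner X Y = frobInner Y X := by
  simp only [frobInner_eq_sum, mul_comm]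

lemma frobInner_add_left (X Y Z : Matrix m k ℝ) :
    frobInner (X + Y) Z = frobInner X Z + frobInner Y Z := by
  simp [frobInner, Matrix.add_mul]

lemma frobInner_sub_left (X Y Z : Matrix m k ℝ) :
    frobInner (X - Y) Z = frobInner X Z - frobInner Y Z := by
  simp [frobInner, Matrix.sub_mul]

lemma frobInner_smul_left (c : ℝ) (X Y : Matrix m k ℝ) :
    frobInner (c • X) Y = c * frobInner X Y := by
  simp [frobInner]

lemma frobInner_add_right (X Y Z : Matrix m k ℝ) :
    frobInner X (Y + Z) = frobInner X Y + frobInner X Z := by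
  simp [frobInner, Matrix.mul_add]

lemma frobInner_sub_right (X Y Z : Matrix m k ℝ) :
    frobInner X (Y - Z) = frobInner X Y - frobInner X Z := by
  simp [frobInner, Matrix.mul_sub]

lemma frobInner_smul_right (c : ℝ) (X Y : Matrix m k ℝ) :
    frobInner X (c • Y) = c * frobInner X Y := by
  simp [frobInner]

lemma frobInner_zero_left (X : Matrix m k ℝ) : frobInner 0 X = 0 := by simp [frobInner]

lemma frobInner_sum_left {ι : Type*} (s : Finset ι) (X : ι → Matrix m k ℝ) (Y : Matrix m k ℝ) :
    frobInner (∑ i ∈ s, X i) Y = ∑ i ∈ s, frobInner (X i) Y := by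
  simp [frobInner, Matrix.sum_mul, Matrix.trace_sum]

lemma frobInner_sum_right {ι : Type*} (s : Finset ι) (X : ι → Matrix m k ℝ) (Y : Matrix m k ℝ) :
    frobInner Y (∑ i ∈ s, X i) = ∑ i ∈ s, frobInner Y (X i) := by
  simp only [frobInner_comm Y, frobInner_sum_left]

lemma frobInner_self_nonneg (X : Matrix m k ℝ) : 0 ≤ frobInner X X := by
  rw [frobInner_eq_sum]
  exact Finset.sum_nonneg fun i _ => Finset.sum_nonneg fun j _ => mul_self_nonneg _

lemma sq_entry_le_frobInner (X : Matrix m k ℝ) (i : m) (j : k) : X i j ^ 2 ≤ frobInner X X := by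
  rw [frobInner_eq_sum, sq]
  refine (Finset.single_le_sum (f := fun j => X i j * X i j) (fun j _ => mul_self_nonneg _)
    (Finset.mem_univ j)).trans ?_
  exact Finset.single_le_sum (f := fun i => ∑ j, X i j * X i j)
    (fun i _ => Finset.sum_nonneg fun j _ => mul_self_nonneg _) (Finset.mem_univ i)

lemma eq_zero_of_frobInner_self {X : Matrix m k ℝ} (h : frobInner X X ≤ 0) : X = 0 := by
  ext i j
  have := sq_entry_le_frobInner X i j
  exact pow_eq_zero_iff (two_ne_zero) |>.mp (le_antisymm (this.trans h) (sq_nonneg _))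

lemma frobInner_sq_le (X Y : Matrix m k ℝ) :
    frobInner X Y ^ 2 ≤ frobInner X X * frobInner Y Y := by
  have h : ∀ c : ℝ, 0 ≤ frobInner Y Y * (c * c) + (2 * frobInner X Y) * c + frobInner X X := by
    intro c
    have := frobInner_self_nonneg (X + c • Y)
    simp only [frobInner_add_left, frobInner_add_right, frobInner_smul_left, frobInner_smul_right,
      frobInner_comm Y X] at this
    linarith
  have := discrim_le_zero h
  rw [discrim] at this
  nlinarith

lemma frobInner_mul_left (A : Matrix m l ℝ) (B : Matrix l k ℝ) (C : Matrix m k ℝ) :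
    frobInner (A * B) C = frobInner B (Aᵀ * C) := by
  rw [frobInner, frobInner, Matrix.transpose_mul, Matrix.transpose_transpose, Matrix.mul_assoc,
    Matrix.trace_mul_comm, Matrix.mul_assoc]

lemma frobInner_mul_right (A : Matrix m l ℝ) (B : Matrix l k ℝ) (C : Matrix m k ℝ) :
    frobInner (A * B) C = frobInner A (C * Bᵀ) := by
  rw [frobInner, frobInner, Matrix.transpose_mul, Matrix.transpose_transpose, Matrix.mul_assoc]

lemma frobInner_transpose (A B : Matrix m k ℝ) : frobInner Aᵀ Bᵀ = frobInner A B := by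
  simp only [frobInner_eq_sum, Matrix.transpose_apply]
  exact Finset.sum_comm

lemma frobInner_one_right [DecidableEq m] (A : Matrix m m ℝ) : frobInner A 1 = A.trace := by
  simp [frobInner]

lemma frobInner_eq_zero_of_symm_of_skew {A B : Matrix m m ℝ} (hA : Aᵀ = A) (hB : Bᵀ = -B) :
    frobInner A B = 0 := by
  have h := frobInner_transpose A B
  rw [hA, hB] at h
  have : frobInner A (-B) = -frobInner A B := by simp [frobInner]
  linarith

/-- The Frobenius bound confines every entry to a fixed interval, so the set is closed in a compact
box and no matrix norm has to be chosen. -/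
lemma isCompact_of_frobInner_le {C : Set (Matrix m k ℝ)} (hC : IsClosed C) {c : ℝ}
    (hc : ∀ X ∈ C, frobInner X X ≤ c) : IsCompact C := by
  have hK : IsCompact (Set.pi univ fun _ : m => Set.pi univ fun _ : k => Icc (-(c + 1)) (c + 1)) :=
    isCompact_univ_pi fun _ => isCompact_univ_pi fun _ => isCompact_Icc
  refine hK.of_isClosed_subset hC fun X hX i _ j _ => ?_
  have h1 := (sq_entry_le_frobInner X i j).trans (hc X hX)
  have h0 : 0 ≤ c := (sq_nonneg _).trans h1
  exact abs_le.mp (abs_le_of_sq_le_sq (by nlinarith) (by linarith))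

lemma continuous_frobInner : Continuous fun z : Matrix m k ℝ × Matrix m k ℝ =>
    frobInner z.1 z.2 := by
  unfold frobInner
  fun_prop

end Frobenius

/-! ### Sums over the standard basis of matrices -/

section Basis
variable {m k : Type*} [Fintype m] [Fintype k] [DecidableEq m] [DecidableEq k]

/-- This and the next three sums play the role of second moments of a standard Gaussian matrix: with
the basis in its place, averaging over `Φ` becomes a finite sum. -/
lemma sum_single_mul_mul_transpose (M : Matrix k k ℝ) :
    ∑ a : m, ∑ b : k, single a b (1 : ℝ) * M * (single a b (1 : ℝ))ᵀ = M.trace • 1 := by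
  ext i j
  simp [Matrix.sum_apply, Matrix.mul_apply, Matrix.single, Matrix.trace, Matrix.one_apply,
    Finset.sum_ite_eq, ite_and, eq_comm]

lemma sum_single_mul_mul (N : Matrix k m ℝ) :
    ∑ a : m, ∑ b : k, single a b (1 : ℝ) * N * single a b (1 : ℝ) = Nᵀ := by
  ext i j
  simp [Matrix.sum_apply, Matrix.mul_apply, Matrix.single, Finset.sum_ite_eq, ite_and]

lemma sum_transpose_single_mul_mul (M : Matrix m m ℝ) :
    ∑ a : m, ∑ b : k, (single a b (1 : ℝ))ᵀ * M * single a b (1 : ℝ) = M.trace • 1 := by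
  rw [Finset.sum_comm, ← sum_single_mul_mul_transpose (m := k) M]
  simp only [Matrix.transpose_single]

lemma sum_transpose_single_mul_mul_transpose (N : Matrix m k ℝ) :
    ∑ a : m, ∑ b : k, (single a b (1 : ℝ))ᵀ * N * (single a b (1 : ℝ))ᵀ = Nᵀ := by
  rw [Finset.sum_comm, ← sum_single_mul_mul (m := k) N]
  simp only [Matrix.transpose_single]

lemma sum_smul_single (B : Matrix m k ℝ) : ∑ a, ∑ b, B a b • single a b (1 : ℝ) = B := by
  conv_rhs => rw [Matrix.matrix_eq_sum_single B]
  simp [Matrix.smul_single]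

end Basis

/-! ### Spectral tools -/

section Spectral
variable {m : Type*} [Fintype m] [DecidableEq m]

lemma exists_orthogonal_diagonal {G : Matrix m m ℝ} (hG : G.IsHermitian) :
    ∃ U : Matrix m m ℝ, Uᵀ * U = 1 ∧ U * Uᵀ = 1 ∧ G = U * Matrix.diagonal hG.eigenvalues * Uᵀ := by
  refine ⟨hG.eigenvectorUnitary, ?_, ?_, ?_⟩
  · have := (Unitary.mem_iff.mp hG.eigenvectorUnitary.2).1
    rwa [Matrix.star_eq_conjTranspose, Matrix.conjTranspose_eq_transpose_of_trivial] at this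
  · have := (Unitary.mem_iff.mp hG.eigenvectorUnitary.2).2
    rwa [Matrix.star_eq_conjTranspose, Matrix.conjTranspose_eq_transpose_of_trivial] at this
  · have := hG.spectral_theorem
    rw [Unitary.conjStarAlgAut_apply, Matrix.star_eq_conjTranspose,
      Matrix.conjTranspose_eq_transpose_of_trivial] at this
    exact this

lemma trace_mul_nonneg_of_posSemidef {A B : Matrix m m ℝ} (hA : A.PosSemidef)
    (hB : B.PosSemidef) : 0 ≤ (A * B).trace := by
  obtain ⟨U, -, -, hU⟩ := exists_orthogonal_diagonal hB.isHermitian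
  rw [hU, ← Matrix.mul_assoc, Matrix.trace_mul_comm, ← Matrix.mul_assoc, ← Matrix.mul_assoc]
  have hA' := hA.conjTranspose_mul_mul_same U
  rw [Matrix.conjTranspose_eq_transpose_of_trivial] at hA'
  simp only [Matrix.trace, Matrix.diag_apply, Matrix.mul_diagonal]
  exact Finset.sum_nonneg fun i _ => mul_nonneg hA'.diag_nonneg (hB.eigenvalues_nonneg i)

/-- Orthogonal projections of trace `k`. -/
def projections (m : Type*) [Fintype m] (k : ℕ) : Set (Matrix m m ℝ) :=
  {P | P * P = P ∧ Pᵀ = P ∧ P.trace = k}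

lemma conj_diagonal_mul {U : Matrix m m ℝ} (hU : Uᵀ * U = 1) (a b : m → ℝ) :
    U * Matrix.diagonal a * Uᵀ * (U * Matrix.diagonal b * Uᵀ) = U * Matrix.diagonal (fun i => a i * b i) * Uᵀ := by
  calc U * Matrix.diagonal a * Uᵀ * (U * Matrix.diagonal b * Uᵀ)
      = U * Matrix.diagonal a * (Uᵀ * U) * diagonal b * Uᵀ := by simp only [Matrix.mul_assoc]
    _ = U * (diagonal a * diagonal b) * Uᵀ := by rw [hU, Matrix.mul_one]; simp only [Matrix.mul_assoc]
    _ = _ := by rw [Matrix.diagonal_mul_diagonal]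

lemma transpose_conj_diagonal (U : Matrix m m ℝ) (a : m → ℝ) :
    (U * Matrix.diagonal a * Uᵀ)ᵀ = U * Matrix.diagonal a * Uᵀ := by
  simp [Matrix.transpose_mul, Matrix.mul_assoc]

lemma trace_conj_diagonal {U : Matrix m m ℝ} (hU : Uᵀ * U = 1) (a : m → ℝ) :
    (U * Matrix.diagonal a * Uᵀ).trace = ∑ i, a i := by
  rw [Matrix.trace_mul_comm, ← Matrix.mul_assoc, hU, Matrix.one_mul, Matrix.trace_diagonal]

lemma posSemidef_conj_diagonal (U : Matrix m m ℝ) {a : m → ℝ} (ha : ∀ i, 0 ≤ a i) :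
    (U * Matrix.diagonal a * Uᵀ).PosSemidef := by
  have h : (diagonal a).PosSemidef := Matrix.PosSemidef.diagonal ha
  have := h.mul_mul_conjTranspose_same U
  rwa [Matrix.conjTranspose_eq_transpose_of_trivial] at this

lemma conj_diagonal_mem_projections {U : Matrix m m ℝ} (hU : Uᵀ * U = 1) (T : Finset m) :
    U * Matrix.diagonal (fun i => if i ∈ T then (1 : ℝ) else 0) * Uᵀ ∈ projections m T.card := by
  refine ⟨?_, transpose_conj_diagonal _ _, ?_⟩
  · rw [conj_diagonal_mul hU]
    congr 3; ext i; split_ifs <;> simp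
  · rw [trace_conj_diagonal hU]; simp

omit [DecidableEq m] in
lemma frobInner_self_of_mem_projections {k : ℕ} {P : Matrix m m ℝ} (hP : P ∈ projections m k) :
    frobInner P P = k := by
  rw [frobInner, hP.2.1, hP.1, hP.2.2]

omit [DecidableEq m] in
lemma isCompact_projections (k : ℕ) : IsCompact (projections m k) := by
  refine isCompact_of_frobInner_le (c := k) ?_ fun P hP =>
    (frobInner_self_of_mem_projections hP).le
  refine (isClosed_eq (by fun_prop) (by fun_prop)).inter
    ((isClosed_eq (by fun_prop) (by fun_prop)).inter (isClosed_eq (by fun_prop) (by fun_prop)))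

lemma projections_nonempty {k : ℕ} (hk : k ≤ Fintype.card m) : (projections m k).Nonempty := by
  obtain ⟨T, -, hT⟩ := Finset.exists_subset_card_eq (s := (Finset.univ : Finset m))
    (n := k) (by simpa using hk)
  have := conj_diagonal_mem_projections (U := (1 : Matrix m m ℝ)) (by simp) T
  rw [hT] at this
  exact ⟨_, this⟩

/-- The rows of a matrix lie in the range of a projection of any trace above the rank. -/
lemma exists_mem_projections_mul_eq {k : ℕ} (hk : k ≤ Fintype.card m) (B : Matrix (Fin k) m ℝ) :
    ∃ P ∈ projections m k, B * P = B := by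
  have hG : (Bᵀ * B).IsHermitian := by
    rw [Matrix.IsHermitian, Matrix.conjTranspose_eq_transpose_of_trivial]; simp
  obtain ⟨U, hU1, hU2, hGe⟩ := exists_orthogonal_diagonal hG
  -- Having `k` rows, `B` has rank at most `k`, so `BᵀB` has at most `k` nonzero eigenvalues; their
  -- index set is padded to size exactly `k`.
  have hcard : (Finset.univ.filter fun i => hG.eigenvalues i ≠ 0).card ≤ k := by
    have h1 := hG.rank_eq_card_non_zero_eigs
    rw [Fintype.card_subtype] at h1
    rw [← h1, Matrix.rank_transpose_mul_self]
    simpa using B.rank_le_card_height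
  obtain ⟨T, hsub, hT⟩ := Finset.exists_superset_card_eq hcard hk
  have hP := conj_diagonal_mem_projections hU1 T
  rw [hT] at hP
  set P := U * Matrix.diagonal (fun i => if i ∈ T then (1 : ℝ) else 0) * Uᵀ
  refine ⟨P, hP, ?_⟩
  have hz : Bᵀ * B * P = Bᵀ * B := by
    conv_lhs => rw [hGe]
    conv_rhs => rw [hGe]
    rw [conj_diagonal_mul hU1]
    congr 3; ext i
    by_cases h : hG.eigenvalues i = 0
    · simp [h]
    · have : i ∈ T := hsub (by simp [h])
      simp [this]
  have : B * P - B = 0 := by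
    apply eq_zero_of_frobInner_self
    have e : B * P - B = B * (P - 1) := by rw [Matrix.mul_sub, Matrix.mul_one]
    rw [e, frobInner_mul_left, ← Matrix.mul_assoc, Matrix.mul_sub, hz, Matrix.mul_one, sub_self,
      frobInner_comm, frobInner_zero_left]
  exact sub_eq_zero.mp this

/-- Cauchy-Schwarz on the range of a projection and on its complement. -/
lemma le_frobInner_self_of_projection {k : ℕ} {P Q : Matrix m m ℝ} (hP : P ∈ projections m k)
    (hk : 0 < k) (hkm : k < Fintype.card m) :
    frobInner Q P ^ 2 / k + (Q.trace - frobInner Q P) ^ 2 / (Fintype.card m - k)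
      ≤ frobInner Q Q := by
  have hk' : (0 : ℝ) < k := by exact_mod_cast hk
  have hkm' : (0 : ℝ) < Fintype.card m - k := by
    have : (k : ℝ) < Fintype.card m := by exact_mod_cast hkm
    linarith
  have hPP := frobInner_self_of_mem_projections hP
  set M : ℝ := (Fintype.card m : ℝ)
  set t := frobInner Q P
  set a := t / k
  set b := (Q.trace - t) / (M - k)
  -- The subtracted matrix is `a P + b (1 - P)`, where `a` and `b` are the average eigenvalue
  -- weights of `Q` on the range of `P` and on its complement.
  have h := frobInner_self_nonneg (Q - (a - b) • P - b • (1 : Matrix m m ℝ))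
  have h11 : frobInner (1 : Matrix m m ℝ) 1 = M := by
    rw [frobInner_one_right, Matrix.trace_one]
  simp only [frobInner_sub_left, frobInner_sub_right, frobInner_smul_left, frobInner_smul_right,
    frobInner_comm P Q, frobInner_comm 1 Q, frobInner_comm 1 P, frobInner_one_right, hP.2.2, hPP,
    Matrix.trace_sub, Matrix.trace_smul, smul_eq_mul, Matrix.trace_one] at h
  have ha : a * k = t := by simp only [a]; field_simp
  have hb : b * (M - k) = Q.trace - t := by simp only [b]; field_simp
  have e1 : t ^ 2 / k = a * t := by simp only [a]; ring
  have e2 : (Q.trace - t) ^ 2 / (M - k) = b * (Q.trace - t) := by simp only [b]; ring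
  rw [e1, e2]
  change 0 ≤ frobInner Q Q - (a - b) * t - b * Q.trace - (a - b) * (t - (a - b) * k - b * k)
    - b * (Q.trace - (a - b) * k - b * M) at h
  linear_combination h + a * ha + b * hb

end Spectral

/-- A quantitative polar decomposition of a contraction with large Frobenius norm. -/
lemma exists_polar {d p : ℕ} {R : Matrix (Fin d) (Fin p) ℝ} (hR : (1 - R * Rᵀ).PosSemidef)
    {σ : ℝ} (hσ : 0 < σ) (hs : frobInner R R = d - 1 + σ ^ 2) :
    ∃ (H : Matrix (Fin d) (Fin d) ℝ) (V : Matrix (Fin d) (Fin p) ℝ),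
      Hᵀ = H ∧ R = H * V ∧ V * Vᵀ = 1 ∧ (H - σ • (1 : Matrix (Fin d) (Fin d) ℝ)).PosSemidef := by
  have hG : (R * Rᵀ).IsHermitian := by
    rw [Matrix.IsHermitian, Matrix.conjTranspose_eq_transpose_of_trivial]; simp
  obtain ⟨U, hU1, hU2, hGe⟩ := exists_orthogonal_diagonal hG
  set g := hG.eigenvalues
  have hone : U * Matrix.diagonal (fun _ => (1 : ℝ)) * Uᵀ = 1 := by
    rw [show Matrix.diagonal (fun _ : Fin d => (1 : ℝ)) = 1 from Matrix.diagonal_one, Matrix.mul_one, hU2]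
  have hg1 : ∀ i, g i ≤ 1 := by
    intro i
    have h2 := (hR.conjTranspose_mul_mul_same U).diag_nonneg (i := i)
    rw [hGe, Matrix.conjTranspose_eq_transpose_of_trivial] at h2
    have : Uᵀ * (1 - U * Matrix.diagonal g * Uᵀ) * U = 1 - diagonal g := by
      calc Uᵀ * (1 - U * Matrix.diagonal g * Uᵀ) * U
          = Uᵀ * U - (Uᵀ * U) * diagonal g * (Uᵀ * U) := by
            simp only [Matrix.mul_sub, Matrix.sub_mul, Matrix.mul_assoc, Matrix.mul_one]
        _ = _ := by rw [hU1, Matrix.one_mul, Matrix.mul_one]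
    rw [this] at h2
    simp at h2
    linarith
  have hsum : ∑ i, g i = d - 1 + σ ^ 2 := by
    rw [← hs, frobInner, hGe, trace_conj_diagonal hU1]
  -- The other `d - 1` eigenvalues contribute at most `1` each to the sum `d - 1 + σ²`.
  have hgσ : ∀ i, σ ^ 2 ≤ g i := by
    intro i
    have h1 := Finset.add_sum_erase Finset.univ g (Finset.mem_univ i)
    have h2 : ∑ j ∈ Finset.univ.erase i, g j ≤ ∑ j ∈ Finset.univ.erase i, (1 : ℝ) :=
      Finset.sum_le_sum fun j _ => hg1 j
    have hd : 1 ≤ d := by have := i.2; omega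
    rw [Finset.sum_const, Finset.card_erase_of_mem (Finset.mem_univ i), Finset.card_univ,
      Fintype.card_fin, nsmul_eq_mul, mul_one, Nat.cast_sub hd] at h2
    push_cast at h2
    linarith
  have hgpos : ∀ i, 0 < g i := fun i => lt_of_lt_of_le (by positivity) (hgσ i)
  have hsq : ∀ i, √(g i) ≠ 0 := fun i => (Real.sqrt_pos.mpr (hgpos i)).ne'
  -- The factors are `H = (R Rᵀ)^{1/2}` and `V = H⁻¹ R`.
  refine ⟨U * Matrix.diagonal (fun i => √(g i)) * Uᵀ, U * Matrix.diagonal (fun i => (√(g i))⁻¹) * Uᵀ * R,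
    transpose_conj_diagonal _ _, ?_, ?_, ?_⟩
  · rw [← Matrix.mul_assoc, conj_diagonal_mul hU1]
    simp only [mul_inv_cancel₀ (hsq _), hone, Matrix.one_mul]
  · rw [Matrix.transpose_mul, transpose_conj_diagonal,
      show ∀ X Y : Matrix (Fin d) (Fin d) ℝ, X * R * (Rᵀ * Y) = X * (R * Rᵀ) * Y by
        intros; simp only [Matrix.mul_assoc], hGe, conj_diagonal_mul hU1, conj_diagonal_mul hU1]
    have h1 : ∀ i, (√(g i))⁻¹ * g i * (√(g i))⁻¹ = 1 := by
      intro i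
      rw [mul_right_comm, ← mul_inv, Real.mul_self_sqrt (hgpos i).le,
        inv_mul_cancel₀ (hgpos i).ne']
    simp only [h1, hone]
  · have : U * Matrix.diagonal (fun i => √(g i)) * Uᵀ - σ • (1 : Matrix (Fin d) (Fin d) ℝ)
        = U * Matrix.diagonal (fun i => √(g i) - σ) * Uᵀ := by
      rw [← hone, ← Matrix.smul_mul, ← Matrix.mul_smul, ← Matrix.sub_mul, ← Matrix.mul_sub]
      congr 2
      ext i j
      by_cases h : i = j
      · subst h; simp
      · simp [h]
    rw [this]
    refine posSemidef_conj_diagonal U fun i => ?_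
    have := Real.le_sqrt_of_sq_le (hgσ i)
    linarith

/-! ### The random tangent directions -/

section Tangent
variable {d p : ℕ}

/-- The negative of the part of the tangent direction that depends on `S`; the direction itself is
`Φ - tangentCorr τ S Φ = Φ (1 - SᵀS) + τ (Φ Sᵀ - S Φᵀ) S`. -/
def tangentCorr (τ : ℝ) (S Φ : Matrix (Fin d) (Fin p) ℝ) : Matrix (Fin d) (Fin p) ℝ :=
  (1 - τ) • (Φ * Sᵀ * S) + τ • (S * Φᵀ * S)

lemma tangentCorr_sum {ι : Type*} (s : Finset ι) (τ : ℝ) (S : Matrix (Fin d) (Fin p) ℝ)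
    (Φ : ι → Matrix (Fin d) (Fin p) ℝ) :
    tangentCorr τ S (∑ i ∈ s, Φ i) = ∑ i ∈ s, tangentCorr τ S (Φ i) := by
  simp only [tangentCorr, Matrix.sum_mul, Matrix.mul_sum, Matrix.transpose_sum, Finset.smul_sum,
    Finset.sum_add_distrib]

lemma tangentCorr_smul (c τ : ℝ) (S Φ : Matrix (Fin d) (Fin p) ℝ) :
    tangentCorr τ S (c • Φ) = c • tangentCorr τ S Φ := by
  simp only [tangentCorr, Matrix.smul_mul, Matrix.mul_smul, Matrix.transpose_smul, smul_add,
    smul_comm c]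

variable {S R : Matrix (Fin d) (Fin p) ℝ} (hS : S * Sᵀ = 1)
include hS

/-- Multiplying the direction by `Sᵀ` leaves only `τ (Φ Sᵀ - S Φᵀ)`, which is skew. Thus `τ` weights
the rotational component freely, and `τ = 1/2` is the orthogonal projection. -/
lemma isTangent_sub_tangentCorr (τ : ℝ) (Φ : Matrix (Fin d) (Fin p) ℝ) :
    (Φ - tangentCorr τ S Φ) * Sᵀ + S * (Φ - tangentCorr τ S Φ)ᵀ = 0 := by
  have h1 : (Φ - tangentCorr τ S Φ) * Sᵀ = τ • (Φ * Sᵀ - S * Φᵀ) := by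
    simp only [tangentCorr, Matrix.sub_mul, Matrix.add_mul, Matrix.smul_mul, Matrix.mul_assoc, hS,
      Matrix.mul_one]
    module
  have h2 : S * (Φ - tangentCorr τ S Φ)ᵀ = ((Φ - tangentCorr τ S Φ) * Sᵀ)ᵀ := by
    rw [Matrix.transpose_mul, Matrix.transpose_transpose]
  rw [h2, h1]
  simp only [Matrix.transpose_smul, Matrix.transpose_sub, Matrix.transpose_mul,
    Matrix.transpose_transpose]
  module

/-- This is the origin of `r(τ)`: the five terms contribute `p`, `d(τ² - 1)`, `-τ²`, `-τ²` and
`dτ²`. That the sum is scalar lets the multipliers enter the averaged Hessian only through their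
traces. -/
lemma sum_tangent_mul_transpose (τ : ℝ) :
    ∑ a : Fin d, ∑ b : Fin p, (single a b (1 : ℝ) - tangentCorr τ S (single a b 1)) *
      (single a b (1 : ℝ) - tangentCorr τ S (single a b 1))ᵀ = rFun p d τ • 1 := by
  have hSx : ∀ {k : ℕ} (X : Matrix (Fin d) (Fin k) ℝ), S * (Sᵀ * X) = X := by
    intro k X; rw [← Matrix.mul_assoc, hS, Matrix.one_mul]
  have expand : ∀ Φ : Matrix (Fin d) (Fin p) ℝ,
      (Φ - tangentCorr τ S Φ) * (Φ - tangentCorr τ S Φ)ᵀ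
      = Φ * (1 : Matrix (Fin p) (Fin p) ℝ) * Φᵀ + ((1 - τ) ^ 2 - 2 * (1 - τ)) • (Φ * (Sᵀ * S) * Φᵀ)
        + ((1 - τ) * τ - τ) • (Φ * Sᵀ * Φ * Sᵀ) + ((1 - τ) * τ - τ) • (S * (Φᵀ * S * Φᵀ))
        + τ ^ 2 • (S * (Φᵀ * (1 : Matrix (Fin d) (Fin d) ℝ) * Φ) * Sᵀ) := by
    intro Φ
    simp only [tangentCorr, Matrix.sub_mul, Matrix.mul_sub, Matrix.add_mul, Matrix.mul_add,
      Matrix.smul_mul, Matrix.mul_smul, Matrix.transpose_sub, Matrix.transpose_add,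
      Matrix.transpose_smul, Matrix.transpose_mul, Matrix.transpose_transpose, Matrix.mul_assoc,
      hSx, Matrix.mul_one]
    module
  simp only [expand, Finset.sum_add_distrib, ← Finset.smul_sum, ← Matrix.sum_mul, ← Matrix.mul_sum,
    sum_single_mul_mul_transpose, sum_single_mul_mul, sum_transpose_single_mul_mul_transpose,
    sum_transpose_single_mul_mul]
  have htr : (Sᵀ * S).trace = d := by rw [Matrix.trace_mul_comm, hS, Matrix.trace_one]; simp
  simp only [htr, Matrix.trace_one, Fintype.card_fin, Matrix.transpose_transpose, Matrix.mul_smul,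
    Matrix.smul_mul, Matrix.mul_one, hS, smul_smul, ← add_smul]
  congr 1
  unfold rFun
  ring

omit hS in
-- This is the origin of `q(τ) = d(1-τ)² + 2τ(1-τ)`: the square of the first part and the two cross
-- terms all give the same trace.
lemma sum_frobInner_tangentCorr (τ : ℝ) :
    ∑ a : Fin d, ∑ b : Fin p,
      frobInner (tangentCorr τ S (single a b 1)) (tangentCorr τ R (single a b 1))
      = qFun d τ * frobInner (Sᵀ * S) (Rᵀ * R) + τ ^ 2 * frobInner S R ^ 2 := by
  have expand : ∀ Φ : Matrix (Fin d) (Fin p) ℝ,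
      frobInner (tangentCorr τ S Φ) (tangentCorr τ R Φ)
      = ((1 - τ) ^ 2 • (Φ * (Sᵀ * S * (Rᵀ * R)) * Φᵀ)
        + ((1 - τ) * τ) • (Φ * (Sᵀ * S * Rᵀ) * Φ * Rᵀ)
        + ((1 - τ) * τ) • (S * (Φᵀ * (S * (Rᵀ * R)) * Φᵀ))
        + τ ^ 2 • (S * (Φᵀ * (S * Rᵀ) * Φ) * Rᵀ)).trace := by
    intro Φ
    rw [frobInner]
    congr 1
    simp only [tangentCorr, Matrix.add_mul, Matrix.mul_add,
      Matrix.smul_mul, Matrix.mul_smul, Matrix.transpose_add,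
      Matrix.transpose_smul, Matrix.transpose_mul, Matrix.transpose_transpose, Matrix.mul_assoc]
    module
  simp only [expand, ← Matrix.trace_sum]
  simp only [Finset.sum_add_distrib, ← Finset.smul_sum, ← Matrix.sum_mul, ← Matrix.mul_sum,
    sum_single_mul_mul_transpose, sum_single_mul_mul, sum_transpose_single_mul_mul_transpose,
    sum_transpose_single_mul_mul]
  have e1 : (R * (Sᵀ * S) * Rᵀ).trace = (Sᵀ * S * (Rᵀ * R)).trace := by
    rw [Matrix.mul_assoc, Matrix.trace_mul_comm, Matrix.mul_assoc (Sᵀ * S)]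
  have e2 : (S * (Rᵀ * R * Sᵀ)).trace = (Sᵀ * S * (Rᵀ * R)).trace := by
    rw [Matrix.trace_mul_comm, Matrix.mul_assoc, Matrix.trace_mul_comm]
  simp only [Matrix.trace_add, Matrix.trace_smul, Matrix.mul_smul, Matrix.smul_mul,
    Matrix.mul_one, Matrix.trace_one, Fintype.card_fin, smul_eq_mul, frobInner,
    Matrix.transpose_mul, Matrix.transpose_transpose]
  rw [e1, e2, qFun_eq]
  ring

end Tangent

/-! ### Second moments of a family of frames -/

section Moments
variable {n d p : ℕ}

/-- The mean of a family. -/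
noncomputable def famMean (U : Fin n → Matrix (Fin d) (Fin p) ℝ) : Matrix (Fin d) (Fin p) ℝ :=
  (n : ℝ)⁻¹ • ∑ i, U i

/-- The covariance form `∑ ⟨U_i, V_i⟩ - n ⟨Ū, V̄⟩`. -/
noncomputable def covForm (n d p : ℕ) :
    LinearMap.BilinForm ℝ (Fin n → Matrix (Fin d) (Fin p) ℝ) :=
  LinearMap.mk₂ ℝ (fun U V => ∑ i, frobInner (U i) (V i)
      - (n : ℝ)⁻¹ * frobInner (∑ i, U i) (∑ i, V i))
    (by intro U V W
        simp only [Pi.add_apply, frobInner_add_left, Finset.sum_add_distrib]; ring)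
    (by intro c U W
        simp only [Pi.smul_apply, frobInner_smul_left, ← Finset.mul_sum, ← Finset.smul_sum,
          smul_eq_mul]; ring)
    (by intro U V W
        simp only [Pi.add_apply, frobInner_add_right, Finset.sum_add_distrib]; ring)
    (by intro c U W
        simp only [Pi.smul_apply, frobInner_smul_right, ← Finset.mul_sum, ← Finset.smul_sum,
          smul_eq_mul]; ring)

lemma covForm_apply (U V : Fin n → Matrix (Fin d) (Fin p) ℝ) :
    covForm n d p U V = ∑ i, frobInner (U i) (V i)
      - (n : ℝ)⁻¹ * frobInner (∑ i, U i) (∑ i, V i) := rfl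

lemma covForm_comm (U V : Fin n → Matrix (Fin d) (Fin p) ℝ) :
    covForm n d p U V = covForm n d p V U := by
  simp only [covForm_apply, frobInner_comm]

/-- The mean of the row space projections. -/
noncomputable def famGram (S : Fin n → Matrix (Fin d) (Fin p) ℝ) : Matrix (Fin p) (Fin p) ℝ :=
  (n : ℝ)⁻¹ • ∑ i, (S i)ᵀ * S i

lemma frobInner_transpose_mul_self_of_projection {k : ℕ} (S : Matrix (Fin d) (Fin p) ℝ)
    {P : Matrix (Fin p) (Fin p) ℝ} (hP : P ∈ projections (Fin p) k) :
    frobInner (Sᵀ * S) P = frobInner (S * P) (S * P) := by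
  rw [frobInner_mul_right S P, hP.2.1, Matrix.mul_assoc, hP.1, frobInner_mul_left,
    Matrix.transpose_transpose]

variable {S : Fin n → Matrix (Fin d) (Fin p) ℝ} (hS : ∀ i, S i * (S i)ᵀ = 1)
include hS

lemma frobInner_self_frame (i : Fin n) : frobInner (S i) (S i) = d := by
  rw [frobInner, hS i, Matrix.trace_one, Fintype.card_fin]

lemma frobInner_transpose_mul_self_le {k : ℕ} (i : Fin n) {P : Matrix (Fin p) (Fin p) ℝ}
    (hP : P ∈ projections (Fin p) k) : frobInner ((S i)ᵀ * S i) P ≤ d := by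
  rw [frobInner_transpose_mul_self_of_projection _ hP]
  have h := frobInner_self_nonneg (S i - S i * P)
  have e : frobInner (S i) (S i * P) = frobInner (S i * P) (S i * P) := by
    rw [frobInner_comm, frobInner_mul_right, frobInner_mul_right, hP.2.1, Matrix.mul_assoc, hP.1]
  simp only [frobInner_sub_left, frobInner_sub_right, frobInner_comm (S i * P) (S i), e,
    frobInner_self_frame hS] at h
  linarith

/-- The share `u` is the part of the trace of `famGram` missed by the best `d`-dimensional subspace.
Splitting the spectrum into `d` and `p - d` directions bounds the Frobenius norm from below. -/
lemma exists_spread_row (hn : 0 < n) (hd : 1 ≤ d) (hp : d + 1 ≤ p) :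
    ∃ u : ℝ, 0 ≤ u ∧ (∀ P ∈ projections (Fin p) d, frobInner (famGram S) P ≤ d * (1 - u)) ∧
      (∃ P ∈ projections (Fin p) d, frobInner (famGram S) P = d * (1 - u)) ∧
      (n : ℝ) ^ 2 * d * (1 - u * (2 - p * u / (p - d)))
        ≤ ∑ i, ∑ j, frobInner ((S i)ᵀ * S i) ((S j)ᵀ * S j) := by
  have hn' : (0 : ℝ) < n := by exact_mod_cast hn
  have hd' : (1 : ℝ) ≤ d := by exact_mod_cast hd
  have hp' : (d : ℝ) + 1 ≤ p := by exact_mod_cast hp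
  obtain ⟨P, hP, hmax⟩ := (isCompact_projections (m := Fin p) d).exists_isMaxOn
    (projections_nonempty (by simp; omega)) (f := fun P => frobInner (famGram S) P)
    (continuous_frobInner.comp (by fun_prop : Continuous fun P => (famGram S, P))).continuousOn
  have hmul : d * (1 - (1 - frobInner (famGram S) P / d)) = frobInner (famGram S) P := by
    field_simp; ring
  have hsum : frobInner (famGram S) P = (n : ℝ)⁻¹ * ∑ i, frobInner ((S i)ᵀ * S i) P := by
    rw [famGram, frobInner_smul_left, frobInner_sum_left]
  refine ⟨1 - frobInner (famGram S) P / d, ?_, fun P' hP' => ?_, ⟨P, hP, hmul.symm⟩, ?_⟩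
  · have : ∑ i, frobInner ((S i)ᵀ * S i) P ≤ ∑ _i : Fin n, (d : ℝ) :=
      Finset.sum_le_sum fun i _ => frobInner_transpose_mul_self_le hS i hP
    rw [Finset.sum_const, Finset.card_univ, Fintype.card_fin, nsmul_eq_mul] at this
    rw [sub_nonneg, div_le_one (by linarith), hsum, inv_mul_le_iff₀ hn']
    exact this
  · rw [hmul]; exact hmax hP'
  · have h := le_frobInner_self_of_projection (Q := famGram S) hP hd (by simp; omega)
    have htr : (famGram S).trace = d := by
      rw [famGram, Matrix.trace_smul, Matrix.trace_sum]
      simp only [Matrix.trace_mul_comm _ (S _), hS, Matrix.trace_one, Fintype.card_fin,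
        Finset.sum_const, Finset.card_univ, nsmul_eq_mul, smul_eq_mul]
      field_simp
    have hgg : (n : ℝ) ^ 2 * frobInner (famGram S) (famGram S)
        = ∑ i, ∑ j, frobInner ((S i)ᵀ * S i) ((S j)ᵀ * S j) := by
      simp only [famGram, frobInner_smul_left, frobInner_smul_right, frobInner_sum_left,
        frobInner_sum_right, ← Finset.mul_sum]
      rw [Finset.sum_comm]
      field_simp
    rw [← hgg, mul_assoc]
    refine mul_le_mul_of_nonneg_left (le_trans (le_of_eq ?_) h) (by positivity)
    rw [htr, Fintype.card_fin]
    have : (p : ℝ) - d ≠ 0 := by linarith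
    field_simp
    ring

/-- The same argument for the operator `∑ vec(S_i) vec(S_i)ᵀ` on a space of dimension `pd`, with its
best one-dimensional subspace; `w` is the share of the trace left over. -/
lemma exists_spread_vec (hn : 0 < n) (hd : 1 ≤ d) (hp : d + 1 ≤ p) :
    ∃ w : ℝ, w ≤ 1 ∧
      (∃ B : Matrix (Fin d) (Fin p) ℝ, frobInner B B = 1 ∧
        ∑ i, frobInner B (S i) ^ 2 = n * d * (1 - w)) ∧
      (∀ B : Matrix (Fin d) (Fin p) ℝ,
        ∑ i, frobInner B (S i) ^ 2 ≤ n * d * (1 - w) * frobInner B B) ∧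
      (n : ℝ) ^ 2 * d ^ 2 * (1 - w * (2 - p * d * w / (p * d - 1)))
        ≤ ∑ i, ∑ j, frobInner (S i) (S j) ^ 2 := by
  have hn' : (0 : ℝ) < n := by exact_mod_cast hn
  have hd' : (1 : ℝ) ≤ d := by exact_mod_cast hd
  have hpd := mul_pred_pos hd hp
  have hcomp : IsCompact {B : Matrix (Fin d) (Fin p) ℝ | frobInner B B = 1} :=
    isCompact_of_frobInner_le (c := 1) (isClosed_eq
      (continuous_frobInner.comp (by fun_prop : Continuous fun B => (B, B))) continuous_const)
      fun B hB => le_of_eq hB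
  have hne : {B : Matrix (Fin d) (Fin p) ℝ | frobInner B B = 1}.Nonempty := by
    refine ⟨single ⟨0, hd⟩ ⟨0, by omega⟩ 1, ?_⟩
    simp [frobInner]
  have hcont : Continuous fun B : Matrix (Fin d) (Fin p) ℝ => ∑ i, frobInner B (S i) ^ 2 := by
    refine continuous_finsetSum _ fun i _ => ?_
    exact (continuous_frobInner.comp (by fun_prop : Continuous fun B => (B, S i))).pow 2
  obtain ⟨B, hB, hmax⟩ := hcomp.exists_isMaxOn hne hcont.continuousOn
  have hB1 : frobInner B B = 1 := hB
  set φ := ∑ i, frobInner B (S i) ^ 2 with hφ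
  have hφ0 : 0 ≤ φ := Finset.sum_nonneg fun i _ => sq_nonneg _
  have hmul : n * d * (1 - (1 - φ / (n * d))) = φ := by field_simp; ring
  refine ⟨1 - φ / (n * d), ?_, ⟨B, hB1, by rw [hmul]⟩, fun C => ?_, ?_⟩
  · have : 0 ≤ φ / (n * d) := by positivity
    linarith
  · rw [hmul]
    rcases (frobInner_self_nonneg C).eq_or_lt with h0 | h0
    · rw [eq_zero_of_frobInner_self h0.symm.le]
      simp [frobInner_zero_left]
    · have hs := Real.sqrt_pos.mpr h0
      have hss := Real.mul_self_sqrt h0.le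
      have hmem : (√(frobInner C C))⁻¹ • C ∈ {B : Matrix (Fin d) (Fin p) ℝ | frobInner B B = 1} := by
        change frobInner _ _ = 1
        rw [frobInner_smul_left, frobInner_smul_right, ← mul_assoc, ← mul_inv, hss,
          inv_mul_cancel₀ h0.ne']
      have h1 : ∑ i, frobInner ((√(frobInner C C))⁻¹ • C) (S i) ^ 2 ≤ φ := hmax hmem
      simp only [frobInner_smul_left, mul_pow, ← Finset.mul_sum] at h1
      rw [inv_pow, sq (√_), hss, inv_mul_le_iff₀ h0] at h1
      linarith
  · let vec : Matrix (Fin d) (Fin p) ℝ → Fin d × Fin p → ℝ := fun X z => X z.1 z.2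
    have hdot : ∀ X Y : Matrix (Fin d) (Fin p) ℝ, ∑ z, vec X z * vec Y z = frobInner X Y := by
      intro X Y
      rw [frobInner_eq_sum, Fintype.sum_prod_type]
    have hvv : ∀ X Y : Matrix (Fin d) (Fin p) ℝ,
        frobInner (vecMulVec (vec X) (vec X)) (vecMulVec (vec Y) (vec Y)) = frobInner X Y ^ 2 := by
      intro X Y
      rw [← hdot, sq, Finset.sum_mul_sum, frobInner_eq_sum]
      simp only [vecMulVec_apply]
      exact Finset.sum_congr rfl fun i _ => Finset.sum_congr rfl fun j _ => by ring
    have htr : ∀ X : Matrix (Fin d) (Fin p) ℝ, (vecMulVec (vec X) (vec X)).trace = frobInner X X := by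
      intro X
      rw [← hdot]
      simp [Matrix.trace, vecMulVec_apply]
    have hproj : vecMulVec (vec B) (vec B) ∈ projections (Fin d × Fin p) 1 := by
      refine ⟨?_, ?_, ?_⟩
      · ext y z
        simp only [Matrix.mul_apply, vecMulVec_apply]
        have := hdot B B
        rw [hB1] at this
        calc ∑ x, vec B y * vec B x * (vec B x * vec B z)
            = vec B y * (∑ x, vec B x * vec B x) * vec B z := by
              rw [Finset.mul_sum, Finset.sum_mul]
              exact Finset.sum_congr rfl fun x _ => by ring
          _ = _ := by rw [this, mul_one]
      · ext y z; simp [vecMulVec_apply, mul_comm]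
      · rw [htr, hB1]; norm_num
    have hcard : (Fintype.card (Fin d × Fin p) : ℝ) = p * d := by simp [mul_comm]
    have h := le_frobInner_self_of_projection
      (Q := ∑ i, vecMulVec (vec (S i)) (vec (S i))) hproj one_pos (by
        simp only [Fintype.card_prod, Fintype.card_fin]; nlinarith)
    simp only [frobInner_sum_left, frobInner_sum_right, hvv, Matrix.trace_sum, htr,
      frobInner_self_frame hS, frobInner_comm (S _) B, ← hφ, hcard, Finset.sum_const,
      Finset.card_univ, Fintype.card_fin, nsmul_eq_mul, Nat.cast_one, div_one] at h
    rw [Finset.sum_comm]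
    refine le_trans (le_of_eq ?_) h
    generalize hM : (p : ℝ) * d - 1 = M at hpd ⊢
    rw [show (p : ℝ) * d = M + 1 by linarith]
    field_simp
    ring

lemma covForm_frames (hn : 0 < n) (hd : 1 ≤ d) :
    covForm n d p S S = n * d * (1 - frobInner (famMean S) (famMean S) / d) := by
  have hn' : (0 : ℝ) < n := by exact_mod_cast hn
  have hd' : (1 : ℝ) ≤ d := by exact_mod_cast hd
  rw [covForm_apply, famMean, frobInner_smul_left, frobInner_smul_right]
  simp only [frobInner_self_frame hS, Finset.sum_const, Finset.card_univ, Fintype.card_fin,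
    nsmul_eq_mul]
  field_simp

/-- The parameters `u ≤ w ≤ v` of the scalar bound. -/
lemma exists_spread (hn : 0 < n) (hd : 1 ≤ d) (hp : d + 1 ≤ p) :
    ∃ u w : ℝ, 0 ≤ u ∧ u ≤ w ∧ w ≤ 1 - frobInner (famMean S) (famMean S) / d ∧
      (∀ P ∈ projections (Fin p) d, frobInner (famGram S) P ≤ d * (1 - u)) ∧
      (n : ℝ) ^ 2 * d * (1 - u * (2 - p * u / (p - d)))
        ≤ ∑ i, ∑ j, frobInner ((S i)ᵀ * S i) ((S j)ᵀ * S j) ∧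
      (n : ℝ) ^ 2 * d ^ 2 * (1 - w * (2 - p * d * w / (p * d - 1)))
        ≤ ∑ i, ∑ j, frobInner (S i) (S j) ^ 2 := by
  have hn' : (0 : ℝ) < n := by exact_mod_cast hn
  have hd' : (1 : ℝ) ≤ d := by exact_mod_cast hd
  obtain ⟨u, hu0, hu1, -, hu2⟩ := exists_spread_row hS hn hd hp
  obtain ⟨w, hw1, ⟨B, hB, hBw⟩, hw2, hw3⟩ := exists_spread_vec hS hn hd hp
  refine ⟨u, w, hu0, ?_, ?_, hu1, hu2, hw3⟩
  -- For `u ≤ w`: the row space of the optimal `B` lies in a `d`-dimensional subspace, which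
  -- captures at least as much of each `S_i` as `B` does.
  · obtain ⟨P, hP, hBP⟩ := exists_mem_projections_mul_eq (m := Fin p) (by simp; omega) B
    have h1 : ∀ i, frobInner B (S i) ^ 2 ≤ frobInner ((S i)ᵀ * S i) P := by
      intro i
      have e : frobInner B (S i) = frobInner B (S i * P) := by
        conv_lhs => rw [← hBP]
        rw [frobInner_mul_right, hP.2.1]
      rw [e, frobInner_transpose_mul_self_of_projection _ hP]
      have := frobInner_sq_le B (S i * P)
      rwa [hB, one_mul] at this
    have h2 := Finset.sum_le_sum fun i (_ : i ∈ Finset.univ) => h1 i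
    have h3 := hu1 P hP
    rw [famGram, frobInner_smul_left, frobInner_sum_left, inv_mul_le_iff₀ hn'] at h3
    have h4 : n * d * (1 - w) ≤ n * d * (1 - u) := by linarith
    have := le_of_mul_le_mul_left h4 (by positivity)
    linarith
  -- For `w ≤ v`: test the maximality behind `w` with the mean itself and use Cauchy-Schwarz over
  -- the blocks.
  · set s := frobInner (famMean S) (famMean S) with hs
    have hs0 : 0 ≤ s := frobInner_self_nonneg _
    rcases hs0.eq_or_lt with h0 | h0
    · rw [← h0]; simpa using hw1
    · have h1 := hw2 (famMean S)
      have h2 : (∑ i, frobInner (famMean S) (S i)) ^ 2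
          ≤ n * ∑ i, frobInner (famMean S) (S i) ^ 2 := by
        have := sq_sum_le_card_mul_sum_sq (s := Finset.univ)
          (f := fun i => frobInner (famMean S) (S i))
        simpa using this
      have h3 : ∑ i, frobInner (famMean S) (S i) = n * s := by
        rw [← frobInner_sum_right, hs]
        conv_rhs => rw [famMean, frobInner_smul_right]
        rw [← famMean]; field_simp
      rw [h3] at h2
      have h4 : (n : ℝ) * s * (n * s) ≤ n * s * (n * (d * (1 - w))) := by
        calc (n : ℝ) * s * (n * s) = (n * s) ^ 2 := by ring
          _ ≤ n * (n * d * (1 - w) * s) := h2.trans (by gcongr)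
          _ = _ := by ring
      have h5 := le_of_mul_le_mul_left (le_of_mul_le_mul_left h4 (by positivity)) hn'
      have : s / d ≤ 1 - w := by rw [div_le_iff₀ (by linarith)]; linarith
      linarith

end Moments

lemma sum_sum_sum_rotate {ι κ l : Type*} [Fintype ι] [Fintype κ] [Fintype l] (f : l → ι → κ → ℝ) :
    ∑ a, ∑ b, ∑ i, f i a b = ∑ i, ∑ a, ∑ b, f i a b := by
  have h : ∀ a, ∑ b, ∑ i, f i a b = ∑ i, ∑ b, f i a b := fun a => Finset.sum_comm
  rw [Finset.sum_congr rfl fun a _ => h a]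
  exact Finset.sum_comm

/-! ### The correction from first-order criticality -/

section Correction
variable {d p : ℕ}

lemma posSemidef_one_sub_mul_transpose {V S : Matrix (Fin d) (Fin p) ℝ} (hV : V * Vᵀ = 1)
    (hS : S * Sᵀ = 1) : (1 - V * Sᵀ * (V * Sᵀ)ᵀ).PosSemidef := by
  have e : 1 - V * Sᵀ * (V * Sᵀ)ᵀ = (V - V * Sᵀ * S) * (V - V * Sᵀ * S)ᴴ := by
    have hSx : S * (Sᵀ * (S * Vᵀ)) = S * Vᵀ := by
      rw [← Matrix.mul_assoc S, hS, Matrix.one_mul]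
    simp only [Matrix.conjTranspose_eq_transpose_of_trivial, Matrix.sub_mul, Matrix.mul_sub,
      Matrix.transpose_sub, Matrix.transpose_mul, Matrix.transpose_transpose, Matrix.mul_assoc,
      hV, hSx]
    abel
  rw [e]
  exact Matrix.posSemidef_self_mul_conjTranspose _

lemma smul_trace_le_trace_mul {H M : Matrix (Fin d) (Fin d) ℝ} {σ : ℝ}
    (hH : (H - σ • (1 : Matrix (Fin d) (Fin d) ℝ)).PosSemidef) (hM : M.PosSemidef) :
    σ * M.trace ≤ (M * H).trace := by
  have := trace_mul_nonneg_of_posSemidef hM hH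
  rw [Matrix.mul_sub, Matrix.mul_smul, Matrix.mul_one, Matrix.trace_sub, Matrix.trace_smul,
    smul_eq_mul] at this
  linarith

/-- With `Y = V Sᵀ` the inner product is `(1-τ) tr(Y Yᵀ H) + τ tr(Yᵀ Yᵀ H)`. Each part is compared
with `tr H` separately, using `H ⪰ σ` against a positive semidefinite matrix: `1 - Y Yᵀ` for the
first, and for the second `2 - Y² - (Yᵀ)²`, a sum of three positive semidefinite terms. -/
lemma smul_le_trace_sub_frobInner_tangentCorr {V S : Matrix (Fin d) (Fin p) ℝ} (hV : V * Vᵀ = 1)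
    (hS : S * Sᵀ = 1) {H : Matrix (Fin d) (Fin d) ℝ} {σ τ : ℝ} (hτ : τ ∈ Icc (0 : ℝ) 1)
    (hσ : 0 ≤ σ) (hHt : Hᵀ = H) (hH : (H - σ • (1 : Matrix (Fin d) (Fin d) ℝ)).PosSemidef) :
    σ * (d - frobInner (Sᵀ * S) (Vᵀ * V))
      ≤ H.trace - frobInner (tangentCorr τ S V) (H * V) := by
  set Y := V * Sᵀ with hY
  have hYY : frobInner (Sᵀ * S) (Vᵀ * V) = (Y * Yᵀ).trace := by
    rw [frobInner, hY]
    simp only [Matrix.transpose_mul, Matrix.transpose_transpose]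
    rw [← Matrix.mul_assoc, Matrix.trace_mul_comm]
    simp only [Matrix.mul_assoc]
  have hfr : frobInner (tangentCorr τ S V) (H * V)
      = (1 - τ) * (Y * Yᵀ * H).trace + τ * (Yᵀ * Yᵀ * H).trace := by
    rw [tangentCorr, frobInner_add_left, frobInner_smul_left, frobInner_smul_left, frobInner,
      frobInner, hY]
    simp only [Matrix.transpose_mul, Matrix.transpose_transpose, hHt, Matrix.mul_assoc]
  have hM1 := posSemidef_one_sub_mul_transpose hV hS
  rw [← hY] at hM1
  have hM1' := posSemidef_one_sub_mul_transpose hS hV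
  have hYt : S * Vᵀ = Yᵀ := by rw [hY]; simp
  rw [hYt, Matrix.transpose_transpose] at hM1'
  have h1 := smul_trace_le_trace_mul hH hM1
  have hM2 : ((1 - Y * Yᵀ) + (1 - Yᵀ * Y) + (Y - Yᵀ) * (Y - Yᵀ)ᴴ).PosSemidef :=
    (hM1.add hM1').add (Matrix.posSemidef_self_mul_conjTranspose _)
  have h2 := smul_trace_le_trace_mul hH hM2
  have h3 : 0 ≤ ((Y - Yᵀ) * (Y - Yᵀ)ᵀ).trace := frobInner_self_nonneg _
  have e : (1 - Y * Yᵀ) + (1 - Yᵀ * Y) + (Y - Yᵀ) * (Y - Yᵀ)ᴴ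
      = (2 : ℝ) • 1 - Y * Y - Yᵀ * Yᵀ := by
    simp only [Matrix.conjTranspose_eq_transpose_of_trivial, Matrix.sub_mul, Matrix.mul_sub,
      Matrix.transpose_sub, Matrix.transpose_transpose]
    module
  rw [e] at h2
  have e2 : (Y * Y * H).trace = (Yᵀ * Yᵀ * H).trace := by
    rw [← Matrix.trace_transpose (Y * Y * H)]
    simp only [Matrix.transpose_mul, hHt]
    rw [Matrix.trace_mul_comm]
  have e3 : (Yᵀ * Yᵀ).trace = (Y * Y).trace := by
    have h := Matrix.trace_transpose (Y * Y)
    rwa [Matrix.transpose_mul] at h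
  simp only [Matrix.sub_mul, Matrix.mul_sub, Matrix.transpose_sub, Matrix.transpose_transpose,
    Matrix.trace_sub, e3, Matrix.trace_mul_comm Yᵀ Y] at h3
  simp only [Matrix.sub_mul, Matrix.trace_sub, Matrix.smul_mul, Matrix.one_mul, Matrix.trace_smul,
    smul_eq_mul, Matrix.trace_one, Fintype.card_fin, e2, e3] at h1 h2
  rw [hfr, hYY]
  have h4 : σ * (d - (Y * Yᵀ).trace) ≤ H.trace - (Yᵀ * Yᵀ * H).trace := by nlinarith
  nlinarith [hτ.1, hτ.2, mul_le_mul_of_nonneg_left h1 (by linarith [hτ.2] : 0 ≤ 1 - τ),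
    mul_le_mul_of_nonneg_left h4 hτ.1]

variable {n : ℕ} {S : Fin n → Matrix (Fin d) (Fin p) ℝ} (hS : ∀ i, S i * (S i)ᵀ = 1)
include hS

lemma posSemidef_one_sub_famMean (hn : 0 < n) :
    (1 - famMean S * (famMean S)ᵀ).PosSemidef := by
  have hn' : (0 : ℝ) < n := by exact_mod_cast hn
  have hsum : ∑ i, S i = (n : ℝ) • famMean S := by
    rw [famMean, smul_smul, mul_inv_cancel₀ hn'.ne', one_smul]
  have e : 1 - famMean S * (famMean S)ᵀ
      = (n : ℝ)⁻¹ • ∑ i, (S i - famMean S) * (S i - famMean S)ᴴ := by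
    simp only [Matrix.conjTranspose_eq_transpose_of_trivial, Matrix.sub_mul, Matrix.mul_sub,
      Matrix.transpose_sub, Finset.sum_sub_distrib, hS, ← Matrix.sum_mul, ← Matrix.mul_sum,
      ← Matrix.transpose_sum, hsum, Matrix.transpose_smul, Matrix.smul_mul, Matrix.mul_smul,
      Finset.sum_const, Finset.card_univ, Fintype.card_fin]
    rw [← Nat.cast_smul_eq_nsmul ℝ, ← Nat.cast_smul_eq_nsmul ℝ, smul_sub, smul_sub, smul_sub]
    simp only [smul_smul, inv_mul_cancel₀ hn'.ne', one_smul]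
    abel
  rw [e]
  refine Matrix.PosSemidef.smul ?_ (by positivity)
  exact Matrix.posSemidef_sum _ fun i _ => Matrix.posSemidef_self_mul_conjTranspose _

/-- Summed over the blocks, `d - ⟨S_iᵀ S_i, Vᵀ V⟩` is at least `n d u`, because `Vᵀ V` is one of the
projections over which `u` was defined. -/
lemma le_covForm_tangentCorr (hn : 0 < n) {τ : ℝ} (hτ : τ ∈ Icc (0 : ℝ) 1) {u : ℝ}
    (hu : ∀ P ∈ projections (Fin p) d, frobInner (famGram S) P ≤ d * (1 - u))
    {H : Matrix (Fin d) (Fin d) ℝ} {V : Matrix (Fin d) (Fin p) ℝ} {σ : ℝ} (hσ : 0 ≤ σ)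
    (hHt : Hᵀ = H) (hR : famMean S = H * V) (hV : V * Vᵀ = 1)
    (hH : (H - σ • (1 : Matrix (Fin d) (Fin d) ℝ)).PosSemidef) :
    n * (σ * (d * u)) ≤ covForm n d p (fun i => tangentCorr τ (S i) V) S := by
  have hn' : (0 : ℝ) < n := by exact_mod_cast hn
  have hsum : ∑ i, S i = (n : ℝ) • famMean S := by
    rw [famMean, smul_smul, mul_inv_cancel₀ hn'.ne', one_smul]
  have hVP : Vᵀ * V ∈ projections (Fin p) d := by
    refine ⟨?_, by simp, ?_⟩
    · rw [Matrix.mul_assoc, ← Matrix.mul_assoc V, hV, Matrix.one_mul]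
    · rw [Matrix.trace_mul_comm, hV, Matrix.trace_one, Fintype.card_fin]
  have h1 : ∀ i, frobInner (tangentCorr τ (S i) V) (S i) = frobInner (S i) V := by
    intro i
    simp only [tangentCorr, frobInner_add_left, frobInner_smul_left]
    rw [frobInner_mul_right _ (S i), frobInner_mul_right _ (S i), hS i, frobInner_one_right,
      frobInner_one_right, ← frobInner, ← frobInner, frobInner_comm V]
    ring
  have h2 : covForm n d p (fun i => tangentCorr τ (S i) V) S
      = ∑ i, (H.trace - frobInner (tangentCorr τ (S i) V) (H * V)) := by
    rw [covForm_apply, hsum, frobInner_smul_right, ← mul_assoc, inv_mul_cancel₀ hn'.ne', one_mul,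
      frobInner_sum_left, hR]
    simp only [h1, ← frobInner_sum_left, hsum, frobInner_smul_left, hR, Finset.sum_sub_distrib,
      Finset.sum_const, Finset.card_univ, Fintype.card_fin, nsmul_eq_mul]
    rw [frobInner_mul_right H V, hV, frobInner_one_right]
  rw [h2]
  have h3 := Finset.sum_le_sum fun i (_ : i ∈ Finset.univ) =>
    smul_le_trace_sub_frobInner_tangentCorr hV (hS i) hτ hσ hHt hH
  refine le_trans ?_ h3
  rw [← Finset.mul_sum, Finset.sum_sub_distrib, ← frobInner_sum_left]
  have h4 := hu _ hVP
  rw [famGram, frobInner_smul_left, inv_mul_le_iff₀ hn'] at h4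
  simp only [Finset.sum_const, Finset.card_univ, Fintype.card_fin, nsmul_eq_mul]
  have h5 : n * (d * u) ≤ n * d - frobInner (∑ i, (S i)ᵀ * S i) (Vᵀ * V) := by linarith
  have := mul_le_mul_of_nonneg_left h5 hσ
  linarith

lemma sum_covForm_tangentCorr_le (hn : 0 < n) (hd : 1 ≤ d) {τ : ℝ} (hτ : τ ∈ Icc (0 : ℝ) 1)
    {A B : ℝ} (hA : (n : ℝ) ^ 2 * d * (1 - A) ≤ ∑ i, ∑ j, frobInner ((S i)ᵀ * S i) ((S j)ᵀ * S j))
    (hB : (n : ℝ) ^ 2 * d ^ 2 * (1 - B) ≤ ∑ i, ∑ j, frobInner (S i) (S j) ^ 2) :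
    ∑ a : Fin d, ∑ b : Fin p, covForm n d p (fun i => tangentCorr τ (S i) (single a b 1))
        (fun i => tangentCorr τ (S i) (single a b 1))
      ≤ n * d * (qFun d τ * A + d * τ ^ 2 * B) := by
  have hn' : (0 : ℝ) < n := by exact_mod_cast hn
  have hq := qFun_nonneg hd hτ
  have hdiag : ∀ i, frobInner ((S i)ᵀ * S i) ((S i)ᵀ * S i) = d := by
    intro i
    rw [frobInner_mul_left, Matrix.transpose_transpose, ← Matrix.mul_assoc, hS, Matrix.one_mul,
      frobInner_self_frame hS]
  have hcov : ∑ a : Fin d, ∑ b : Fin p,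
      covForm n d p (fun i => tangentCorr τ (S i) (single a b 1))
        (fun i => tangentCorr τ (S i) (single a b 1))
      = n * (qFun d τ * d + τ ^ 2 * d ^ 2)
        - (n : ℝ)⁻¹ * (qFun d τ * (∑ i, ∑ j, frobInner ((S i)ᵀ * S i) ((S j)ᵀ * S j))
          + τ ^ 2 * ∑ i, ∑ j, frobInner (S i) (S j) ^ 2) := by
    have hswap := fun f : Fin n → Fin d → Fin p → ℝ => sum_sum_sum_rotate f
    simp only [covForm_apply, frobInner_sum_left, frobInner_sum_right, Finset.sum_sub_distrib,
      ← Finset.mul_sum]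
    rw [hswap, hswap]
    simp only [hswap, sum_frobInner_tangentCorr, hdiag, frobInner_self_frame hS,
      Finset.sum_add_distrib, ← Finset.mul_sum, Finset.sum_const, Finset.card_univ,
      Fintype.card_fin, nsmul_eq_mul]
    rw [Finset.sum_comm (f := fun i j => frobInner ((S i)ᵀ * S i) ((S j)ᵀ * S j)),
      Finset.sum_comm (f := fun i j => frobInner (S i) (S j) ^ 2)]
    ring
  rw [hcov]
  have h1 := mul_le_mul_of_nonneg_left hA hq
  have h2 := mul_le_mul_of_nonneg_left hB (sq_nonneg τ)
  have h3 := mul_le_mul_of_nonneg_left (add_le_add h1 h2) (inv_nonneg.mpr hn'.le)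
  have e : (n : ℝ)⁻¹ * (qFun d τ * ((n : ℝ) ^ 2 * d * (1 - A)) + τ ^ 2 * ((n : ℝ) ^ 2 * d ^ 2 * (1 - B)))
      = n * (qFun d τ * d * (1 - A) + τ ^ 2 * d ^ 2 * (1 - B)) := by field_simp
  rw [e] at h3
  linarith

end Correction

/-! ### The dual bound -/

/-- Second-order criticality forces the scalar inequality of the dual bound, unless the family is
constant. -/
theorem rFun_mul_le_of_critical {n d p : ℕ} (hn : 0 < n) (hd : 1 ≤ d) (hp : d + 1 ≤ p)
    {S : Fin n → Matrix (Fin d) (Fin p) ℝ} (hS : ∀ i, S i * (S i)ᵀ = 1)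
    (b : LinearMap.BilinForm ℝ (Fin n → Matrix (Fin d) (Fin p) ℝ))
    (hsymm : ∀ U V, b U V = b V U)
    (hconst : ∀ C U, b (fun _ => C) U = 0) {μ lam x : ℝ} (hμ : 0 < μ) (hx : 0 < x)
    (hlam : (1 - x) * μ ≤ lam)
    (hlo : ∀ U, lam * covForm n d p U U ≤ b U U) (hhi : ∀ U, b U U ≤ μ * covForm n d p U U)
    {D : Fin n → Matrix (Fin d) (Fin d) ℝ} (hD : ∀ i, (D i)ᵀ = D i)
    (hgrad : ∀ U, b S U = -∑ i, frobInner (D i * S i) (U i))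
    (hhess : ∀ T : Fin n → Matrix (Fin d) (Fin p) ℝ, (∀ i, T i * (S i)ᵀ + S i * (T i)ᵀ = 0) →
      0 ≤ b T T + ∑ i, frobInner (D i) (T i * (T i)ᵀ))
    (hv : 0 < 1 - frobInner (famMean S) (famMean S) / d) {τ : ℝ} (hτ : τ ∈ Icc (0 : ℝ) 1) :
    ∃ u v w : ℝ, 0 ≤ u ∧ u ≤ w ∧ w ≤ v ∧ 0 < v ∧ v ≤ 1 ∧
      rFun p d τ * lam ≤ μ * gFun p d u v w x τ := by
  have hn' : (0 : ℝ) < n := by exact_mod_cast hn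
  have hd' : (1 : ℝ) ≤ d := by exact_mod_cast hd
  have hr := rFun_pos hd hp τ
  obtain ⟨u, w, hu0, huw, hwv, hu1, hA, hB⟩ := exists_spread hS hn hd hp
  have hcovS := covForm_frames hS hn hd
  set s := frobInner (famMean S) (famMean S) with hs
  have hs0 : 0 ≤ s := frobInner_self_nonneg _
  set v := 1 - s / d with hvdef
  refine ⟨u, v, w, hu0, huw, hwv, hv, by have : 0 ≤ s / d := by positivity
                                         linarith, ?_⟩
  let F : Fin d → Fin p → Fin n → Matrix (Fin d) (Fin p) ℝ :=
    fun a c i => tangentCorr τ (S i) (single a c 1)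
  -- the averaged Hessian inequality
  have hbSS : b S S = -∑ i, (D i).trace := by
    rw [hgrad]
    simp only [frobInner, Matrix.mul_assoc, hS, Matrix.mul_one]
  have hess : rFun p d τ * b S S ≤ ∑ a, ∑ c, b (F a c) (F a c) := by
    have h1 : ∀ a c, 0 ≤ b (F a c) (F a c) + ∑ i, frobInner (D i)
        ((single a c (1 : ℝ) - F a c i) * (single a c (1 : ℝ) - F a c i)ᵀ) := by
      intro a c
      have h := hhess (fun i => single a c (1 : ℝ) - F a c i)
        (fun i => isTangent_sub_tangentCorr (hS i) τ _)
      have e : (fun i => single a c (1 : ℝ) - F a c i)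
          = (fun _ => single a c (1 : ℝ)) - F a c := rfl
      rw [e] at h
      -- The shared matrix `Φ` is a constant family, so `b` sees only the correction `F a c`.
      simp only [map_sub, LinearMap.sub_apply, hconst, hsymm (F a c) (fun _ => single a c 1)] at h
      simpa using h
    have h2 : 0 ≤ ∑ a, ∑ c, (b (F a c) (F a c) + ∑ i, frobInner (D i)
        ((single a c (1 : ℝ) - F a c i) * (single a c (1 : ℝ) - F a c i)ᵀ)) :=
      Finset.sum_nonneg fun a _ => Finset.sum_nonneg fun c _ => h1 a c
    have h3 : ∑ a, ∑ c, ∑ i, frobInner (D i)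
        ((single a c (1 : ℝ) - F a c i) * (single a c (1 : ℝ) - F a c i)ᵀ)
        = rFun p d τ * ∑ i, (D i).trace := by
      rw [sum_sum_sum_rotate]
      simp only [← frobInner_sum_right, F, sum_tangent_mul_transpose (hS _) τ,
        frobInner_smul_right, frobInner_one_right, ← Finset.mul_sum]
    simp only [Finset.sum_add_distrib] at h2
    rw [h3] at h2
    rw [hbSS]; linarith
  have hSlo := hlo S
  rw [hcovS] at hSlo
  have hcov := sum_covForm_tangentCorr_le hS hn hd hτ hA hB
  -- the slack form
  set J : LinearMap.BilinForm ℝ (Fin n → Matrix (Fin d) (Fin p) ℝ) := μ • covForm n d p - b with hJ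
  have hJapp : ∀ U V, J U V = μ * covForm n d p U V - b U V := fun U V => rfl
  have hJ0 : ∀ U, 0 ≤ J U U := fun U => by rw [hJapp]; linarith [hhi U]
  have hJsymm : ∀ U V, J U V = J V U := fun U V => by
    rw [hJapp, hJapp, hsymm, covForm_comm]
  have hJS : J S S ≤ x * μ * (n * d * v) := by
    rw [hJapp, hcovS]
    have : (1 - x) * μ * (n * d * v) ≤ lam * (n * d * v) :=
      mul_le_mul_of_nonneg_right hlam (by positivity)
    linarith
  -- A lower bound on what `b ≤ μ cov` gives away. It is nontrivial only for `d v < 1`, when the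
  -- mean has full rank and `σ² = 1 - d v` bounds the spectrum of its Gram matrix from below.
  have hcorr : μ * n * (1 / x * (max (1 - d * v) 0 * u ^ 2 / v)) ≤ ∑ a, ∑ c, J (F a c) (F a c) := by
    rcases le_or_gt (1 - d * v) 0 with hneg | hpos
    · rw [max_eq_right hneg]
      simp only [zero_mul, zero_div, mul_zero]
      exact Finset.sum_nonneg fun a _ => Finset.sum_nonneg fun c _ => hJ0 _
    · rw [max_eq_left hpos.le]
      set σ := √(1 - d * v) with hσdef
      have hσ : 0 < σ := Real.sqrt_pos.mpr hpos
      have hσ2 : σ ^ 2 = 1 - d * v := Real.sq_sqrt hpos.le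
      have hfr : frobInner (famMean S) (famMean S) = d - 1 + σ ^ 2 := by
        rw [hσ2, ← hs, hvdef]; field_simp; ring
      obtain ⟨H, V, hHt, hR, hV, hH⟩ :=
        exists_polar (posSemidef_one_sub_famMean hS hn) hσ hfr
      have hcovV := le_covForm_tangentCorr hS hn hτ hu1 hσ.le hHt hR hV hH
      set FV : Fin n → Matrix (Fin d) (Fin p) ℝ := fun i => tangentCorr τ (S i) V
      have hFV : FV = ∑ a, ∑ c, V a c • F a c := by
        ext1 i
        simp only [Finset.sum_apply, Pi.smul_apply, FV, F, ← tangentCorr_smul, ← tangentCorr_sum,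
          sum_smul_single]
      -- Stationarity against constants gives `∑ D_i S_i = 0`. Pairing `D_i S_i` with either term of
      -- the correction equals pairing it with `V`; the second term uses the symmetry of `D_i`.
      have hbFV : b S FV = 0 := by
        have hDS : ∀ C : Matrix (Fin d) (Fin p) ℝ, ∑ i, frobInner (D i * S i) C = 0 := by
          intro C
          have := hgrad (fun _ => C)
          rw [hsymm, hconst] at this
          linarith
        rw [hgrad, neg_eq_zero, ← hDS V]
        refine Finset.sum_congr rfl fun i _ => ?_
        have e1 : frobInner (D i * S i) (V * (S i)ᵀ * S i) = frobInner (D i * S i) V := by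
          rw [frobInner_comm, frobInner_mul_right, Matrix.mul_assoc (D i), hS, Matrix.mul_one,
            frobInner_mul_right, Matrix.transpose_transpose, frobInner_comm]
        have e2 : frobInner (D i * S i) (S i * Vᵀ * S i) = frobInner (D i * S i) V := by
          rw [frobInner_comm, frobInner_mul_right, Matrix.mul_assoc (D i), hS, Matrix.mul_one,
            ← frobInner_transpose, Matrix.transpose_mul, Matrix.transpose_transpose, hD,
            frobInner_mul_right, Matrix.transpose_transpose, frobInner_comm]
        simp only [FV, tangentCorr, frobInner_add_right, frobInner_smul_right, e1, e2]
        ring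
      have hJFV : μ * (n * (σ * (d * u))) ≤ J FV S := by
        rw [hJapp, hsymm, hbFV, sub_zero]
        exact mul_le_mul_of_nonneg_left hcovV hμ.le
      have hVV : ∑ a, ∑ c, V a c ^ 2 = d := by
        have : frobInner V V = d := by rw [frobInner, hV, Matrix.trace_one, Fintype.card_fin]
        rw [← this, frobInner_eq_sum]; simp only [sq]
      -- Expand `J ≥ 0` at `F a e - c V_{ae} S` and sum; `‖V‖² = d`. This is Cauchy-Schwarz with a
      -- free parameter, avoiding division by `J S S`.
      have hyoung : ∀ c : ℝ, 2 * c * J FV S - c ^ 2 * d * J S S ≤ ∑ a, ∑ e, J (F a e) (F a e) := by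
        intro c
        have h1 : ∀ a e, 2 * c * (V a e * J (F a e) S) - c ^ 2 * (V a e ^ 2 * J S S)
            ≤ J (F a e) (F a e) := by
          intro a e
          have := hJ0 (F a e - (c * V a e) • S)
          simp only [map_sub, LinearMap.sub_apply, map_smul, LinearMap.smul_apply, smul_eq_mul,
            hJsymm S (F a e)] at this
          linarith
        have h2 := Finset.sum_le_sum fun a (_ : a ∈ Finset.univ) =>
          Finset.sum_le_sum fun e (_ : e ∈ Finset.univ) => h1 a e
        refine le_trans (le_of_eq ?_) h2
        simp only [Finset.sum_sub_distrib, ← Finset.mul_sum, ← Finset.sum_mul, hVV, hFV, map_sum,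
          LinearMap.sum_apply, map_smul, LinearMap.smul_apply, smul_eq_mul]
        ring
      -- This `c` is the optimal one, `J FV S / (d J S S)`, with both values replaced by their
      -- bounds.
      refine le_trans ?_ (hyoung (σ * u / (x * d * v)))
      have hc0 : 0 ≤ σ * u / (x * d * v) := by positivity
      have h1 := mul_le_mul_of_nonneg_left hJFV (by positivity : 0 ≤ 2 * (σ * u / (x * d * v)))
      have h2 := mul_le_mul_of_nonneg_left hJS
        (by positivity : 0 ≤ (σ * u / (x * d * v)) ^ 2 * d)
      refine le_trans (le_of_eq ?_) (sub_le_sub h1 h2)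
      rw [← hσ2]
      field_simp
      ring
  have hJsum : ∑ a, ∑ c, J (F a c) (F a c)
      = μ * (∑ a, ∑ c, covForm n d p (F a c) (F a c)) - ∑ a, ∑ c, b (F a c) (F a c) := by
    simp only [hJapp, Finset.sum_sub_distrib, ← Finset.mul_sum]
  rw [hJsum] at hcorr
  have hfin : rFun p d τ * (lam * (n * d * v))
      ≤ μ * (n * d * (qFun d τ * (u * (2 - p * u / (p - d)))
          + d * τ ^ 2 * (w * (2 - p * d * w / (p * d - 1)))))
        - μ * n * (1 / x * (max (1 - d * v) 0 * u ^ 2 / v)) := by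
    have h1 := mul_le_mul_of_nonneg_left hSlo hr.le
    have h2 := mul_le_mul_of_nonneg_left hcov hμ.le
    linarith
  have hndv : (0 : ℝ) < n * d * v := by positivity
  refine le_of_mul_le_mul_right ?_ hndv
  refine le_trans (le_of_eq (by ring)) (hfin.trans (le_of_eq ?_))
  unfold gFun
  generalize (2 - p * u / ((p : ℝ) - d)) = A'
  generalize (2 - p * d * w / ((p : ℝ) * d - 1)) = B'
  field_simp

/-! ### The spectral gap -/

section Gap
variable {m : Type*} [Fintype m] [DecidableEq m] {L : Matrix m m ℝ}

/-- `eigenvalues₀` is sorted decreasingly from index `0`, so the `k`-th smallest of `N` values has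
index `N - k`. -/
lemma kthEigenvalue_le_eigenvalues₀ (hL : L.IsHermitian) {k : ℕ} (h1 : 1 ≤ k)
    (h2 : k ≤ Fintype.card m) (i : Fin (Fintype.card m)) (hi : (i : ℕ) + k ≤ Fintype.card m) :
    kthEigenvalue hL k ≤ hL.eigenvalues₀ i := by
  rw [kthEigenvalue, dif_pos ⟨h1, h2⟩]
  refine hL.eigenvalues₀_antitone ?_
  rw [Fin.le_def]; simp only; omega

/-- If `L` annihilates the `d`-dimensional range of `Z` and its `(d+1)`-st eigenvalue is positive,
then it is pinched between multiples of the projection onto the complement of that range. -/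
lemma posSemidef_of_spectral_gap (hL : L.PosSemidef) {d : ℕ} {c : ℝ} (hc : 0 < c)
    {Z : Matrix m (Fin d) ℝ} (hZ : Zᵀ * Z = c • 1) (hLZ : L * Z = 0) (hcard : d + 1 ≤ Fintype.card m)
    (hpos : 0 < kthEigenvalue hL.isHermitian (d + 1)) :
    (L - kthEigenvalue hL.isHermitian (d + 1) • (1 - c⁻¹ • (Z * Zᵀ))).PosSemidef ∧
      (maxEigenvalue hL.isHermitian • (1 - c⁻¹ • (Z * Zᵀ)) - L).PosSemidef := by
  set lam := kthEigenvalue hL.isHermitian (d + 1)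
  set μ := maxEigenvalue hL.isHermitian with hμ
  obtain ⟨U, hU1, hU2, hUL⟩ := exists_orthogonal_diagonal hL.isHermitian
  set ev := hL.isHermitian.eigenvalues with hev
  set P := 1 - c⁻¹ • (Z * Zᵀ) with hP
  let T : Finset m := Finset.univ.filter fun i => ev i ≠ 0
  set Q := U * Matrix.diagonal (fun i => if i ∈ T then (1 : ℝ) else 0) * Uᵀ with hQ
  have hQproj : Q ∈ projections m T.card := conj_diagonal_mem_projections hU1 T
  -- the nonzero eigenvalues
  let e : Fin (Fintype.card m) ≃ m := Fintype.equivOfCardEq (Fintype.card_fin _)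
  have heve : ∀ i, ev (e i) = hL.isHermitian.eigenvalues₀ i := by
    intro i
    simp [hev, Matrix.IsHermitian.eigenvalues, e]
  let K : Finset (Fin (Fintype.card m)) := Finset.univ.filter fun i => (i : ℕ) < Fintype.card m - d
  have hKcard : K.card = Fintype.card m - d := by
    rw [Fin.card_filter_val_lt]; omega
  have hKge : ∀ i ∈ K, lam ≤ ev (e i) := by
    intro i hi
    rw [heve]
    refine kthEigenvalue_le_eigenvalues₀ _ (by omega) hcard i ?_
    have := (Finset.mem_filter.mp hi).2
    omega
  have hKT : K.map e.toEmbedding ⊆ T := by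
    intro x hx
    obtain ⟨i, hi, rfl⟩ := Finset.mem_map.mp hx
    exact Finset.mem_filter.mpr ⟨Finset.mem_univ _, (hpos.trans_le (hKge i hi)).ne'⟩
  have hTcard : Fintype.card m - d ≤ T.card := by
    have := Finset.card_le_card hKT
    rwa [Finset.card_map, hKcard] at this
  -- the spectral projection is `P`
  have hQZ : Q * Z = 0 := by
    -- `Q` is the pseudoinverse of `L` times `L`; inverses of zero eigenvalues are `0` by
    -- convention.
    have : Q = U * Matrix.diagonal (fun i => (ev i)⁻¹) * Uᵀ * L := by
      conv_rhs => rw [hUL]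
      rw [conj_diagonal_mul hU1, hQ]
      congr 3
      ext i
      by_cases h : ev i = 0 <;> simp [T, h]
    rw [this, Matrix.mul_assoc, hLZ, Matrix.mul_zero]
  have hQP : Q * P = Q := by
    rw [hP, Matrix.mul_sub, Matrix.mul_one, Matrix.mul_smul, ← Matrix.mul_assoc, hQZ,
      Matrix.zero_mul, smul_zero, sub_zero]
  have hPt : Pᵀ = P := by
    rw [hP]; simp [Matrix.transpose_sub, Matrix.transpose_smul, Matrix.transpose_mul]
  have hPQ : P * Q = Q := by
    have := congrArg Matrix.transpose hQP
    rwa [Matrix.transpose_mul, hPt, hQproj.2.1] at this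
  have hPP : P * P = P := by
    have h1 : Z * Zᵀ * (Z * Zᵀ) = c • (Z * Zᵀ) := by
      rw [Matrix.mul_assoc, ← Matrix.mul_assoc Zᵀ, hZ]; simp
    rw [hP]
    simp only [Matrix.sub_mul, Matrix.mul_sub, Matrix.one_mul, Matrix.mul_one, Matrix.smul_mul,
      Matrix.mul_smul, h1, smul_smul]
    rw [inv_mul_cancel₀ hc.ne', one_smul]
    simp
  have hPtr : P.trace = Fintype.card m - d := by
    rw [hP, Matrix.trace_sub, Matrix.trace_one, Matrix.trace_smul, Matrix.trace_mul_comm, hZ,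
      Matrix.trace_smul, Matrix.trace_one, Fintype.card_fin, smul_eq_mul, smul_eq_mul]
    field_simp
  -- As `Q` is dominated by `P`, the squared distance is the difference of the traces, and the
  -- eigenvalue count makes it nonpositive.
  have hfro : frobInner (P - Q) (P - Q) = Fintype.card m - d - T.card := by
    rw [frobInner, Matrix.transpose_sub, hPt, hQproj.2.1, Matrix.sub_mul P Q,
      Matrix.mul_sub P P, Matrix.mul_sub Q P, hPP, hQP, hPQ, hQproj.1, Matrix.trace_sub, Matrix.trace_sub, hPtr,
      hQproj.2.2]
    simp
  have hTcard' : (Fintype.card m : ℝ) - d ≤ T.card := by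
    rw [← Nat.cast_sub (by omega)]; exact_mod_cast hTcard
  have hPQe : P = Q := sub_eq_zero.mp (eq_zero_of_frobInner_self (by linarith))
  have hTeq : T.card = Fintype.card m - d := by
    have h0 := frobInner_self_nonneg (P - Q)
    rw [hfro, ← Nat.cast_sub (by omega)] at h0
    refine le_antisymm ?_ hTcard
    exact_mod_cast sub_nonneg.mp h0
  have hKTe : K.map e.toEmbedding = T :=
    Finset.eq_of_subset_of_card_le hKT (by rw [Finset.card_map, hKcard, hTeq])
  have hge : ∀ i ∈ T, lam ≤ ev i := by
    intro i hi
    rw [← hKTe] at hi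
    obtain ⟨j, hj, rfl⟩ := Finset.mem_map.mp hi
    exact hKge j hj
  have hle : ∀ i, ev i ≤ μ := fun i =>
    le_ciSup (f := ev) (Set.finite_range _).bddAbove i
  have hzero : ∀ i, i ∉ T → ev i = 0 := fun i hi => by
    by_contra h
    exact hi (Finset.mem_filter.mpr ⟨Finset.mem_univ _, h⟩)
  have hsm : ∀ a : ℝ, a • Q = U * Matrix.diagonal (fun i => if i ∈ T then a else 0) * Uᵀ := by
    intro a
    rw [hQ, ← Matrix.smul_mul, ← Matrix.mul_smul, ← Matrix.diagonal_smul]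
    congr 3
    ext i
    simp
  clear_value μ
  rw [hPQe, hsm, hsm]
  constructor
  · have : L - U * Matrix.diagonal (fun i => if i ∈ T then lam else 0) * Uᵀ
        = U * Matrix.diagonal (fun i => ev i - if i ∈ T then lam else 0) * Uᵀ := by
      conv_lhs => rw [hUL]
      rw [← Matrix.sub_mul, ← Matrix.mul_sub, Matrix.diagonal_sub]
    rw [this]
    refine posSemidef_conj_diagonal U fun i => ?_
    split_ifs with h
    · linarith [hge i h]
    · rw [hzero i h]; simp
  · have : U * Matrix.diagonal (fun i => if i ∈ T then μ else 0) * Uᵀ - L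
        = U * Matrix.diagonal
          (fun i => (if i ∈ T then μ else 0) - ev i) * Uᵀ := by
      conv_lhs => rw [hUL]
      rw [← Matrix.sub_mul, ← Matrix.mul_sub, Matrix.diagonal_sub]
    rw [this]
    refine posSemidef_conj_diagonal U fun i => ?_
    split_ifs with h
    · linarith [hle i]
    · rw [hzero i h]; simp

lemma kthEigenvalue_le_maxEigenvalue (hL : L.IsHermitian) {k : ℕ} (h1 : 1 ≤ k)
    (h2 : k ≤ Fintype.card m) : kthEigenvalue hL k ≤ maxEigenvalue hL := by
  rw [kthEigenvalue, dif_pos ⟨h1, h2⟩]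
  let e : Fin (Fintype.card m) ≃ m := Fintype.equivOfCardEq (Fintype.card_fin _)
  have heve : ∀ i, hL.eigenvalues (e i) = hL.eigenvalues₀ i := by
    intro i
    simp [Matrix.IsHermitian.eigenvalues, e]
  rw [← heve]
  exact le_ciSup (Set.finite_range _).bddAbove _

end Gap

/-! ### Local minimizers are second-order critical -/

lemma deriv_zero_and_nonneg_of_isLocalMin {f f' : ℝ → ℝ} {c : ℝ} (hf : ∀ t, HasDerivAt f (f' t) t)
    (hf' : HasDerivAt f' c 0) (hmin : IsLocalMin f 0) : f' 0 = 0 ∧ 0 ≤ c := by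
  have h0 : f' 0 = 0 := hmin.hasDerivAt_eq_zero (hf 0)
  refine ⟨h0, ?_⟩
  by_contra hc
  push Not at hc
  -- If `c < 0`, subtracting `(c / 4) t²` leaves second derivative `c / 2 < 0`, so the new function
  -- still has a local maximum at `0`. This makes the maximum of `f` strict, against minimality.
  have hg : ∀ t, HasDerivAt (fun t => f t - c / 4 * t ^ 2) (f' t - c / 4 * (2 * t)) t := by
    intro t
    have := (hf t).fun_sub (((hasDerivAt_id t).pow 2).const_mul (c / 4))
    simpa using this
  have hg' : HasDerivAt (fun t => f' t - c / 4 * (2 * t)) (c - c / 4 * 2) 0 := by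
    have := hf'.fun_sub ((((hasDerivAt_id (0 : ℝ)).const_mul 2)).const_mul (c / 4))
    simpa using this
  have hd : deriv (fun t => f t - c / 4 * t ^ 2) = fun t => f' t - c / 4 * (2 * t) :=
    funext fun t => (hg t).deriv
  have hmax := isLocalMax_of_deriv_deriv_neg (f := fun t => f t - c / 4 * t ^ 2) (x₀ := 0)
    (by rw [hd, hg'.deriv]; linarith) (by rw [hd]; simp [h0]) (hg 0).continuousAt
  have hev := (hmin.and hmax).filter_mono (nhdsWithin_le_nhds (s := {0}ᶜ))
  obtain ⟨t, ⟨h1, h2⟩, ht⟩ := (hev.and self_mem_nhdsWithin).exists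
  have ht' : t ≠ 0 := ht
  have : 0 < t ^ 2 := by positivity
  simp only at h2
  nlinarith

section Curve
variable {m k : Type*} [Fintype m] [Fintype k]

lemma hasDerivAt_frobInner (A : Matrix m m ℝ) {X Y : ℝ → Matrix m k ℝ} {X' Y' : Matrix m k ℝ} {t : ℝ}
    (hX : ∀ i j, HasDerivAt (fun t => X t i j) (X' i j) t)
    (hY : ∀ i j, HasDerivAt (fun t => Y t i j) (Y' i j) t) :
    HasDerivAt (fun t => frobInner (A * X t) (Y t))
      (frobInner (A * X') (Y t) + frobInner (A * X t) Y') t := by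
  have h : HasDerivAt (fun t => ∑ i, ∑ j, (∑ l, A i l * X t l j) * Y t i j)
      (∑ i, ∑ j, ((∑ l, A i l * X' l j) * Y t i j + (∑ l, A i l * X t l j) * Y' i j)) t :=
    HasDerivAt.fun_sum fun i _ => HasDerivAt.fun_sum fun j _ =>
      (HasDerivAt.fun_sum fun l _ => (hX l j).const_mul (A i l)).mul (hY i j)
  simp only [frobInner_eq_sum, Matrix.mul_apply]
  simpa only [Finset.sum_add_distrib] using h

end Curve

lemma hasDerivAt_exp_smul_entry {p : ℕ} (Ω : Matrix (Fin p) (Fin p) ℝ) (t : ℝ) (i j : Fin p) :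
    HasDerivAt (fun t : ℝ => NormedSpace.exp (t • Ω) i j) ((NormedSpace.exp (t • Ω) * Ω) i j) t := by
  open scoped Norms.Operator in
  have h := hasDerivAt_exp_smul_const (𝕂 := ℝ) Ω t
  have := (LinearMap.toContinuousLinearMap
    (Matrix.entryLinearMap ℝ ℝ i j : Matrix (Fin p) (Fin p) ℝ →ₗ[ℝ] ℝ)).hasFDerivAt.comp_hasDerivAt t h
  exact this

lemma exp_mul_transpose_of_skew {p : ℕ} {Ω : Matrix (Fin p) (Fin p) ℝ} (hΩ : Ωᵀ = -Ω) :
    NormedSpace.exp Ω * (NormedSpace.exp Ω)ᵀ = 1 := by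
  have hc : Commute Ω (-Ω) := (Commute.refl Ω).neg_right
  rw [← Matrix.exp_transpose, hΩ, ← Matrix.exp_add_of_commute _ _ hc]
  simp

/-! ### Blocks -/

section Blocks
variable {n d : ℕ} {κ : Type*}

/-- The matrix with given blocks of rows. -/
def stack (U : Fin n → Matrix (Fin d) κ ℝ) : Matrix (Fin n × Fin d) κ ℝ :=
  Matrix.of fun s k => U s.1 s.2 k

lemma rowBlock_stack (U : Fin n → Matrix (Fin d) κ ℝ) (i : Fin n) : rowBlock (stack U) i = U i := rfl

lemma stack_rowBlock (S : Matrix (Fin n × Fin d) κ ℝ) : stack (fun i => rowBlock S i) = S := rfl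

lemma ext_rowBlock {S T : Matrix (Fin n × Fin d) κ ℝ} (h : ∀ i, rowBlock S i = rowBlock T i) :
    S = T := by
  rw [← stack_rowBlock S, ← stack_rowBlock T]
  simp only [h]

lemma frobInner_eq_sum_rowBlock [Fintype κ] (S T : Matrix (Fin n × Fin d) κ ℝ) :
    frobInner S T = ∑ i, frobInner (rowBlock S i) (rowBlock T i) := by
  simp only [frobInner_eq_sum, Fintype.sum_prod_type]
  rfl

/-- A diagonal block, symmetrized. -/
noncomputable def symBlock (X : Matrix (Fin n × Fin d) (Fin n × Fin d) ℝ) (i : Fin n) :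
    Matrix (Fin d) (Fin d) ℝ :=
  Matrix.of fun a b => (X (i, a) (i, b) + X (i, b) (i, a)) / 2

lemma transpose_symBlock (X : Matrix (Fin n × Fin d) (Fin n × Fin d) ℝ) (i : Fin n) :
    (symBlock X i)ᵀ = symBlock X i := by
  ext a b; simp [symBlock, add_comm]

lemma rowBlock_symBlockDiag_mul (X : Matrix (Fin n × Fin d) (Fin n × Fin d) ℝ)
    (S : Matrix (Fin n × Fin d) κ ℝ) (i : Fin n) :
    rowBlock (symBlockDiag X * S) i = symBlock X i * rowBlock S i := by
  ext a k
  simp only [rowBlock, symBlockDiag, symBlock, Matrix.of_apply, Matrix.mul_apply,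
    Fintype.sum_prod_type]
  rw [Finset.sum_eq_single i]
  · simp
  · intro j _ hj
    simp [hj.symm]
  · simp

lemma symBlock_mul_mul_transpose {p : ℕ} (A : Matrix (Fin n × Fin d) (Fin n × Fin d) ℝ)
    (S : Matrix (Fin n × Fin d) (Fin p) ℝ) (i : Fin n) :
    symBlock (A * (S * Sᵀ)) i = (1 / 2 : ℝ) • (rowBlock (A * S) i * (rowBlock S i)ᵀ
      + (rowBlock (A * S) i * (rowBlock S i)ᵀ)ᵀ) := by
  rw [← Matrix.mul_assoc]
  ext a b
  simp only [symBlock, rowBlock, Matrix.of_apply, Matrix.mul_apply (M := A * S), Matrix.smul_apply,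
    Matrix.add_apply, Matrix.transpose_apply, smul_eq_mul,
    Matrix.mul_apply (M := Matrix.of fun a k => (A * S) (i, a) k)]
  ring

end Blocks

section Critical
variable {n p d : ℕ} {A : Matrix (Fin n × Fin d) (Fin n × Fin d) ℝ}
  {S : Matrix (Fin n × Fin d) (Fin p) ℝ}

lemma objective_eq (A : Matrix (Fin n × Fin d) (Fin n × Fin d) ℝ)
    (S : Matrix (Fin n × Fin d) (Fin p) ℝ) : objective A S = -frobInner (A * S) S := by
  rw [objective, frobInner_mul_right]

lemma hasDerivAt_mul_exp_mul_entry (B : Matrix (Fin d) (Fin p) ℝ) (Ω C : Matrix (Fin p) (Fin p) ℝ)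
    (t : ℝ) (a : Fin d) (k : Fin p) :
    HasDerivAt (fun t : ℝ => (B * NormedSpace.exp (t • Ω) * C) a k)
      ((B * (NormedSpace.exp (t • Ω) * Ω) * C) a k) t := by
  simp only [Matrix.mul_apply (N := C), Matrix.mul_apply (M := B)]
  exact HasDerivAt.fun_sum fun j _ => (HasDerivAt.fun_sum fun l _ =>
    (hasDerivAt_exp_smul_entry Ω t l j).const_mul (B a l)).mul_const (C j k)

/-- The derivatives of the objective along the curves `S_i exp(t Ω_i)`. -/
lemma critical_along_exp (hA : A.IsSymm) (hS : S ∈ stiefel n p d)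
    (hmin : IsLocalMinOn (objective A) (stiefel n p d) S)
    {Ω : Fin n → Matrix (Fin p) (Fin p) ℝ} (hΩ : ∀ i, (Ω i)ᵀ = -Ω i) :
    frobInner (A * S) (stack fun i => rowBlock S i * Ω i) = 0 ∧
      frobInner (A * stack fun i => rowBlock S i * Ω i) (stack fun i => rowBlock S i * Ω i)
        + frobInner (A * S) (stack fun i => rowBlock S i * Ω i * Ω i) ≤ 0 := by
  let γ : ℝ → Matrix (Fin n × Fin d) (Fin p) ℝ := fun t =>
    stack fun i => rowBlock S i * NormedSpace.exp (t • Ω i) * (1 : Matrix (Fin p) (Fin p) ℝ)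
  let γ₁ : ℝ → Matrix (Fin n × Fin d) (Fin p) ℝ := fun t =>
    stack fun i => rowBlock S i * NormedSpace.exp (t • Ω i) * Ω i
  let T := stack fun i => rowBlock S i * Ω i
  let γ₂ := stack fun i => rowBlock S i * Ω i * Ω i
  have hγ0 : γ 0 = S := by
    simp only [γ, zero_smul, NormedSpace.exp_zero, Matrix.mul_one]; rfl
  have hγ₁0 : γ₁ 0 = T := by
    simp only [γ₁, T, zero_smul, NormedSpace.exp_zero, Matrix.mul_one]
  have hγ : ∀ t s k, HasDerivAt (fun t => γ t s k) (γ₁ t s k) t := by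
    intro t s k
    have h := hasDerivAt_mul_exp_mul_entry (rowBlock S s.1) (Ω s.1) 1 t s.2 k
    rw [Matrix.mul_one, ← Matrix.mul_assoc] at h
    exact h
  have hγ₁ : ∀ s k, HasDerivAt (fun t => γ₁ t s k) (γ₂ s k) 0 := by
    intro s k
    have h := hasDerivAt_mul_exp_mul_entry (rowBlock S s.1) (Ω s.1) (Ω s.1) 0 s.2 k
    rw [zero_smul, NormedSpace.exp_zero, Matrix.one_mul] at h
    exact h
  have hmem : ∀ t, γ t ∈ stiefel n p d := by
    intro t i
    have hsk : (t • Ω i)ᵀ = -(t • Ω i) := by rw [Matrix.transpose_smul, hΩ, smul_neg]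
    simp only [γ, rowBlock_stack, Matrix.mul_one, Matrix.transpose_mul]
    rw [Matrix.mul_assoc, ← Matrix.mul_assoc (NormedSpace.exp _), exp_mul_transpose_of_skew hsk,
      Matrix.one_mul, hS i]
  have htend : Filter.Tendsto γ (nhds 0) (nhdsWithin S (stiefel n p d)) := by
    refine tendsto_nhdsWithin_iff.mpr ⟨?_, Filter.Eventually.of_forall hmem⟩
    refine tendsto_pi_nhds.mpr fun s => tendsto_pi_nhds.mpr fun k => ?_
    have := (hγ 0 s k).continuousAt.tendsto
    rwa [hγ0] at this
  have hlocal : IsLocalMin (fun t => objective A (γ t)) 0 := by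
    have := htend.eventually hmin
    filter_upwards [this] with t ht
    simpa only [hγ0] using ht
  have hsymA : ∀ X Y : Matrix (Fin n × Fin d) (Fin p) ℝ,
      frobInner (A * X) Y = frobInner (A * Y) X := by
    intro X Y
    rw [frobInner_mul_left, hA, frobInner_comm]
  have hf : ∀ t, HasDerivAt (fun t => objective A (γ t)) (-(2 * frobInner (A * γ t) (γ₁ t))) t := by
    intro t
    simp only [objective_eq]
    have := (hasDerivAt_frobInner A (hγ t) (hγ t)).fun_neg
    rw [hsymA (γ₁ t) (γ t), ← two_mul] at this
    exact this
  have hf' : HasDerivAt (fun t => -(2 * frobInner (A * γ t) (γ₁ t)))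
      (-(2 * (frobInner (A * γ₁ 0) (γ₁ 0) + frobInner (A * γ 0) γ₂))) 0 :=
    ((hasDerivAt_frobInner A (hγ 0) hγ₁).const_mul 2).fun_neg
  obtain ⟨h1, h2⟩ := deriv_zero_and_nonneg_of_isLocalMin hf hf' hlocal
  rw [hγ0, hγ₁0] at h1 h2
  exact ⟨by linarith, by linarith⟩

lemma rowBlock_certificate_mul {p' : ℕ} (A : Matrix (Fin n × Fin d) (Fin n × Fin d) ℝ)
    (S : Matrix (Fin n × Fin d) (Fin p) ℝ) (X : Matrix (Fin n × Fin d) (Fin p') ℝ) (i : Fin n) :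
    rowBlock (certificate A S * X) i
      = symBlock (A * (S * Sᵀ)) i * rowBlock X i - rowBlock (A * X) i := by
  rw [certificate, Matrix.sub_mul, ← rowBlock_symBlockDiag_mul]
  rfl

/-- Every tangent vector is `S_i Ω_i` with `Ω_i` skew, so the exponential curves realize all tangent
directions. -/
theorem isSecondOrderCritical_of_isLocalMinOn (hA : A.IsSymm) (hS : S ∈ stiefel n p d)
    (hmin : IsLocalMinOn (objective A) (stiefel n p d) S) : IsSecondOrderCritical A S := by
  have hS' : ∀ i, rowBlock S i * (rowBlock S i)ᵀ = 1 := hS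
  let Λ : Fin n → Matrix (Fin d) (Fin d) ℝ := fun i => symBlock (A * (S * Sᵀ)) i
  have hΛ : ∀ i, (Λ i)ᵀ = Λ i := fun i => transpose_symBlock _ _
  -- the skew generators of a tangent vector
  let Ω : Matrix (Fin n × Fin d) (Fin p) ℝ → Fin n → Matrix (Fin p) (Fin p) ℝ := fun T i =>
    (rowBlock S i)ᵀ * rowBlock T i - (rowBlock T i)ᵀ * rowBlock S i
      - (rowBlock S i)ᵀ * (rowBlock T i * (rowBlock S i)ᵀ) * rowBlock S i
  have hskew : ∀ T ∈ tangent S, ∀ i, rowBlock S i * (rowBlock T i)ᵀ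
      = -(rowBlock T i * (rowBlock S i)ᵀ) := fun T hT i => by
    have h : rowBlock T i * (rowBlock S i)ᵀ + rowBlock S i * (rowBlock T i)ᵀ = 0 := hT i
    rw [add_comm] at h
    exact eq_neg_of_add_eq_zero_left h
  have hΩ : ∀ T ∈ tangent S, ∀ i, (Ω T i)ᵀ = -Ω T i := by
    intro T hT i
    simp only [Ω, Matrix.transpose_sub, Matrix.transpose_mul, Matrix.transpose_transpose]
    rw [hskew T hT i]
    simp only [Matrix.mul_neg, Matrix.neg_mul, Matrix.mul_assoc]
    abel
  have hSΩ : ∀ T ∈ tangent S, ∀ i, rowBlock S i * Ω T i = rowBlock T i := by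
    intro T hT i
    simp only [Ω, Matrix.mul_sub, ← Matrix.mul_assoc, hS' i, Matrix.one_mul]
    rw [hskew T hT i]
    simp
  have key : ∀ T ∈ tangent S, frobInner (A * S) T = 0 ∧
      frobInner (A * T) T + frobInner (A * S) (stack fun i => rowBlock T i * Ω T i) ≤ 0 := by
    intro T hT
    have := critical_along_exp hA hS hmin (hΩ T hT)
    simpa only [hSΩ T hT, stack_rowBlock] using this
  -- The gradient `X` is itself tangent. Testing with `X` gives `‖X‖² = 0`, since the symmetric
  -- multiplier is orthogonal to the skew matrix `X_i S_iᵀ`.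
  have hCS : certificate A S * S = 0 := by
    set X := certificate A S * S with hX
    have hXi : ∀ i, rowBlock X i = Λ i * rowBlock S i - rowBlock (A * S) i := fun i =>
      rowBlock_certificate_mul A S S i
    have hXT : X ∈ tangent S := by
      intro i
      have h2 : rowBlock S i * (rowBlock X i)ᵀ = (rowBlock X i * (rowBlock S i)ᵀ)ᵀ := by
        rw [Matrix.transpose_mul, Matrix.transpose_transpose]
      have h1 : rowBlock X i * (rowBlock S i)ᵀ = Λ i - rowBlock (A * S) i * (rowBlock S i)ᵀ := by
        rw [hXi, Matrix.sub_mul, Matrix.mul_assoc, hS' i, Matrix.mul_one]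
      rw [h2, h1, Matrix.transpose_sub, hΛ]
      simp only [Λ, symBlock_mul_mul_transpose]
      module
    have h0 : frobInner X X = 0 := by
      have h1 := (key X hXT).1
      have h2 : frobInner X X = ∑ i, frobInner (Λ i) (rowBlock X i * (rowBlock S i)ᵀ)
          - frobInner (A * S) X := by
        rw [frobInner_eq_sum_rowBlock X X, frobInner_eq_sum_rowBlock (A * S) X,
          ← Finset.sum_sub_distrib]
        refine Finset.sum_congr rfl fun i _ => ?_
        calc frobInner (rowBlock X i) (rowBlock X i)
            = frobInner (Λ i * rowBlock S i - rowBlock (A * S) i) (rowBlock X i) := by rw [← hXi]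
          _ = _ := by rw [frobInner_sub_left, frobInner_mul_right]
      rw [h2, h1, sub_zero]
      refine Finset.sum_eq_zero fun i _ => frobInner_eq_zero_of_symm_of_skew (hΛ i) ?_
      rw [Matrix.transpose_mul, Matrix.transpose_transpose, hskew X hXT]
    exact eq_zero_of_frobInner_self h0.le
  refine ⟨hS, hCS, fun T hT => ?_⟩
  have h2 := (key T hT).2
  have hAS : ∀ i, rowBlock (A * S) i = Λ i * rowBlock S i := by
    intro i
    have := rowBlock_certificate_mul A S S i
    rw [hCS] at this
    exact (sub_eq_zero.mp this.symm).symm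
  -- The acceleration of the curve supplies the multiplier term of the Hessian, because `A S = Λ S`
  -- and `Ω_i S_iᵀ = -T_iᵀ`.
  have h3 : frobInner (A * S) (stack fun i => rowBlock T i * Ω T i)
      = -∑ i, frobInner (Λ i * rowBlock T i) (rowBlock T i) := by
    rw [frobInner_eq_sum_rowBlock, ← Finset.sum_neg_distrib]
    refine Finset.sum_congr rfl fun i _ => ?_
    have hΩS : Ω T i * (rowBlock S i)ᵀ = -(rowBlock T i)ᵀ := by
      have := congrArg Matrix.transpose (hSΩ T hT i)
      rw [Matrix.transpose_mul, hΩ T hT i, Matrix.neg_mul] at this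
      rw [← this, neg_neg]
    rw [rowBlock_stack, hAS, frobInner_mul_right, Matrix.mul_assoc, hΩS, frobInner_mul_right]
    simp [frobInner]
  have h4 : frobInner (certificate A S) (T * Tᵀ)
      = ∑ i, frobInner (Λ i * rowBlock T i) (rowBlock T i) - frobInner (A * T) T := by
    rw [← frobInner_mul_right (certificate A S) T T, frobInner_eq_sum_rowBlock,
      frobInner_eq_sum_rowBlock (A * T), ← Finset.sum_sub_distrib]
    refine Finset.sum_congr rfl fun i _ => ?_
    rw [rowBlock_certificate_mul, frobInner_sub_left]
  rw [h4]
  linarith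

end Critical

/-! ### The landscape -/

section Landscape
variable {n d : ℕ}

lemma transpose_mul_eq_sum_rowBlock {κ l : Type*} (X : Matrix (Fin n × Fin d) κ ℝ)
    (Y : Matrix (Fin n × Fin d) l ℝ) : Xᵀ * Y = ∑ i, (rowBlock X i)ᵀ * rowBlock Y i := by
  ext a b
  simp only [Matrix.mul_apply, Matrix.sum_apply, Fintype.sum_prod_type]
  rfl

variable {p : ℕ} {Z : Matrix (Fin n × Fin d) (Fin d) ℝ}

/-- The stacked matrix with blocks `Z_i U_i`. -/
def frameLift (Z : Matrix (Fin n × Fin d) (Fin d) ℝ) (U : Fin n → Matrix (Fin d) (Fin p) ℝ) :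
    Matrix (Fin n × Fin d) (Fin p) ℝ :=
  stack fun i => rowBlock Z i * U i

lemma frameLift_add (U V : Fin n → Matrix (Fin d) (Fin p) ℝ) :
    frameLift Z (U + V) = frameLift Z U + frameLift Z V := by
  apply ext_rowBlock
  intro i
  exact Matrix.mul_add (rowBlock Z i) (U i) (V i)

lemma frameLift_smul (c : ℝ) (U : Fin n → Matrix (Fin d) (Fin p) ℝ) :
    frameLift Z (c • U) = c • frameLift Z U := by
  apply ext_rowBlock
  intro i
  exact Matrix.mul_smul (rowBlock Z i) c (U i)

lemma frameLift_const (C : Matrix (Fin d) (Fin p) ℝ) : frameLift Z (fun _ => C) = Z * C := rfl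

lemma rowBlock_frameLift (U : Fin n → Matrix (Fin d) (Fin p) ℝ) (i : Fin n) :
    rowBlock (frameLift Z U) i = rowBlock Z i * U i := rfl

/-- The bilinear form of `L` in the coordinates given by `frameLift`. -/
noncomputable def liftForm (L : Matrix (Fin n × Fin d) (Fin n × Fin d) ℝ)
    (Z : Matrix (Fin n × Fin d) (Fin d) ℝ) (p : ℕ) :
    LinearMap.BilinForm ℝ (Fin n → Matrix (Fin d) (Fin p) ℝ) :=
  LinearMap.mk₂ ℝ (fun U V => frobInner (L * frameLift Z U) (frameLift Z V))
    (by intro U V W; rw [frameLift_add, Matrix.mul_add, frobInner_add_left])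
    (by intro c U W; rw [frameLift_smul, Matrix.mul_smul, frobInner_smul_left, smul_eq_mul])
    (by intro U V W; rw [frameLift_add, frobInner_add_right])
    (by intro c U W; rw [frameLift_smul, frobInner_smul_right, smul_eq_mul])

lemma liftForm_apply (L : Matrix (Fin n × Fin d) (Fin n × Fin d) ℝ)
    (U V : Fin n → Matrix (Fin d) (Fin p) ℝ) :
    liftForm L Z p U V = frobInner (L * frameLift Z U) (frameLift Z V) := rfl

variable (hZ : Z ∈ stiefel n d d)
include hZ

lemma rowBlock_mul_transpose_self (i : Fin n) : rowBlock Z i * (rowBlock Z i)ᵀ = 1 := hZ i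

lemma transpose_rowBlock_mul_self (i : Fin n) : (rowBlock Z i)ᵀ * rowBlock Z i = 1 :=
  mul_eq_one_comm.mp (hZ i)

lemma transpose_mul_frameLift (U : Fin n → Matrix (Fin d) (Fin p) ℝ) :
    Zᵀ * frameLift Z U = ∑ i, U i := by
  rw [transpose_mul_eq_sum_rowBlock]
  refine Finset.sum_congr rfl fun i _ => ?_
  rw [rowBlock_frameLift, ← Matrix.mul_assoc, transpose_rowBlock_mul_self hZ, Matrix.one_mul]

lemma transpose_mul_self_eq_smul : Zᵀ * Z = (n : ℝ) • (1 : Matrix (Fin d) (Fin d) ℝ) := by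
  have := transpose_mul_frameLift hZ (fun _ => (1 : Matrix (Fin d) (Fin d) ℝ))
  rw [frameLift_const, Matrix.mul_one] at this
  rw [this, Finset.sum_const, Finset.card_univ, Fintype.card_fin, Nat.cast_smul_eq_nsmul]

/-- In the rotated coordinates `Zᵀ` sums the blocks, so projecting off the range of `Z` subtracts
the mean; this turns the spectral bounds on `L` into bounds by the covariance form. -/
lemma frobInner_projection_frameLift (U : Fin n → Matrix (Fin d) (Fin p) ℝ) :
    frobInner ((1 - (n : ℝ)⁻¹ • (Z * Zᵀ)) * frameLift Z U) (frameLift Z U) = covForm n d p U U := by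
  rw [Matrix.sub_mul, Matrix.one_mul, Matrix.smul_mul, frobInner_sub_left, frobInner_smul_left,
    Matrix.mul_assoc, frobInner_mul_left Z, transpose_mul_frameLift hZ, covForm_apply,
    frobInner_eq_sum_rowBlock (frameLift Z U)]
  congr 1
  refine Finset.sum_congr rfl fun i _ => ?_
  rw [rowBlock_frameLift, frobInner_mul_left, ← Matrix.mul_assoc, transpose_rowBlock_mul_self hZ,
    Matrix.one_mul]

omit hZ in
lemma frobInner_mul_self_nonneg {m k : Type*} [Fintype m] [Fintype k] {M : Matrix m m ℝ}
    (hM : M.PosSemidef) (X : Matrix m k ℝ) : 0 ≤ frobInner (M * X) X := by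
  have h := (hM.conjTranspose_mul_mul_same X).trace_nonneg
  rwa [Matrix.conjTranspose_eq_transpose_of_trivial, Matrix.mul_assoc, Matrix.trace_mul_comm] at h

variable {A : Matrix (Fin n × Fin d) (Fin n × Fin d) ℝ}

/-- Either the rotated blocks have positive variance, and the dual bound at the optimal `τ`
contradicts the eigenvalue ratio, or they all coincide with one frame `C` and `S = Z C`. -/
lemma mul_transpose_eq_of_critical (hd : 1 ≤ d) (hp : d + 1 ≤ p) (hn : 2 ≤ n)
    (hL : (certificate A Z).PosSemidef) (hLZ : certificate A Z * Z = 0)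
    (hpos : 0 < kthEigenvalue hL.isHermitian (d + 1))
    (hratio : maxEigenvalue hL.isHermitian / kthEigenvalue hL.isHermitian (d + 1) < alphaG p d)
    {S : Matrix (Fin n × Fin d) (Fin p) ℝ} (hS : IsSecondOrderCritical A S) :
    S * Sᵀ = Z * Zᵀ := by
  have hn0 : 0 < n := by omega
  have hn' : (0 : ℝ) < n := by exact_mod_cast hn0
  have hd' : (1 : ℝ) ≤ d := by exact_mod_cast hd
  have hcard : d + 1 ≤ Fintype.card (Fin n × Fin d) := by simp; nlinarith
  have hle := kthEigenvalue_le_maxEigenvalue hL.isHermitian (by omega) hcard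
  obtain ⟨hlo, hhi⟩ := posSemidef_of_spectral_gap hL hn' (transpose_mul_self_eq_smul hZ) hLZ hcard hpos
  set lam := kthEigenvalue hL.isHermitian (d + 1)
  set μ := maxEigenvalue hL.isHermitian
  set L := certificate A Z with hLdef
  have hμ : 0 < μ := hpos.trans_le hle
  obtain ⟨⟨hSS, hCS, hhess⟩⟩ : Nonempty (IsSecondOrderCritical A S) := ⟨hS⟩
  have hSi : ∀ i, rowBlock S i * (rowBlock S i)ᵀ = 1 := hSS
  have hZ1 := rowBlock_mul_transpose_self hZ
  have hZ2 := transpose_rowBlock_mul_self hZ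
  -- the rotated family
  let R : Fin n → Matrix (Fin d) (Fin p) ℝ := fun i => (rowBlock Z i)ᵀ * rowBlock S i
  have hZR : ∀ i, rowBlock Z i * R i = rowBlock S i := by
    intro i
    simp only [R]
    rw [← Matrix.mul_assoc, hZ1, Matrix.one_mul]
  have hlift : frameLift Z R = S := ext_rowBlock fun i => hZR i
  have hR : ∀ i, R i * (R i)ᵀ = 1 := by
    intro i
    simp only [R, Matrix.transpose_mul, Matrix.transpose_transpose]
    rw [Matrix.mul_assoc, ← Matrix.mul_assoc (rowBlock S i), hSi, Matrix.one_mul, hZ2]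
  -- the difference of the two certificates is block diagonal
  let Δ : Fin n → Matrix (Fin d) (Fin d) ℝ := fun i =>
    symBlock (A * (S * Sᵀ)) i - symBlock (A * (Z * Zᵀ)) i
  have hΔ : ∀ i, (Δ i)ᵀ = Δ i := fun i => by
    simp only [Δ, Matrix.transpose_sub, transpose_symBlock]
  have hCL : ∀ (X : Matrix (Fin n × Fin d) (Fin p) ℝ) i,
      rowBlock (certificate A S * X) i = rowBlock (L * X) i + Δ i * rowBlock X i := by
    intro X i
    rw [rowBlock_certificate_mul, rowBlock_certificate_mul, Matrix.sub_mul]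
    abel
  let D : Fin n → Matrix (Fin d) (Fin d) ℝ := fun i => (rowBlock Z i)ᵀ * Δ i * rowBlock Z i
  have hD : ∀ i, (D i)ᵀ = D i := fun i => by
    simp only [D, Matrix.transpose_mul, Matrix.transpose_transpose, hΔ, Matrix.mul_assoc]
  have hLsymm : Lᵀ = L := by
    have := hL.isHermitian
    rwa [Matrix.IsHermitian, Matrix.conjTranspose_eq_transpose_of_trivial] at this
  by_cases hv : 0 < 1 - frobInner (famMean R) (famMean R) / d
  · exfalso
    have hα : 1 < alphaG p d := by
      refine lt_of_le_of_lt ?_ hratio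
      rwa [one_le_div hpos]
    obtain ⟨τ, hτ, hτα⟩ := (isGreatest_alphaG hd hp).1
    have hfeas := (feasible_spec hd hp hτ).1.1.2
    rw [hτα] at hfeas
    set α := alphaG p d
    have hα0 : 0 < α := by linarith
    have hinv : α⁻¹ < 1 := inv_lt_one_of_one_lt₀ hα
    have hx : 1 - α⁻¹ ∈ Ioo (0 : ℝ) 1 := ⟨by linarith, by linarith [inv_pos.mpr hα0]⟩
    have hlt : μ * α⁻¹ < lam := by
      rw [div_lt_iff₀ hpos] at hratio
      rw [← div_eq_mul_inv, div_lt_iff₀ hα0]; linarith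
    obtain ⟨u, v, w, h1, h2, h3, h4, h5, h6⟩ := rFun_mul_le_of_critical hn0 hd hp hR
      (liftForm L Z p)
      (fun U V => by
        rw [liftForm_apply, liftForm_apply, frobInner_mul_left, hLsymm, frobInner_comm])
      (fun C U => by
        rw [liftForm_apply, frameLift_const, ← Matrix.mul_assoc, hLZ, Matrix.zero_mul,
          frobInner_zero_left])
      hμ hx.1 (lam := lam) (by linarith)
      (fun U => by
        have := frobInner_mul_self_nonneg hlo (frameLift Z U)
        rw [Matrix.sub_mul, Matrix.smul_mul, frobInner_sub_left, frobInner_smul_left,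
          frobInner_projection_frameLift hZ] at this
        rw [liftForm_apply]; linarith)
      (fun U => by
        have := frobInner_mul_self_nonneg hhi (frameLift Z U)
        rw [Matrix.sub_mul, Matrix.smul_mul, frobInner_sub_left, frobInner_smul_left,
          frobInner_projection_frameLift hZ] at this
        rw [liftForm_apply]; linarith)
      hD
      (fun U => by
        rw [liftForm_apply, hlift, frobInner_eq_sum_rowBlock, ← Finset.sum_neg_distrib]
        refine Finset.sum_congr rfl fun i _ => ?_
        have h0 := hCL S i
        rw [hCS] at h0
        have h0' : rowBlock (L * S) i = -(Δ i * rowBlock S i) :=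
          eq_neg_of_add_eq_zero_left h0.symm
        rw [h0', rowBlock_frameLift]
        simp only [D]
        rw [Matrix.mul_assoc, Matrix.mul_assoc, hZR, frobInner_mul_left (rowBlock Z i)ᵀ,
          Matrix.transpose_transpose]
        simp [frobInner])
      (fun T hT => by
        have hmem : frameLift Z T ∈ tangent S := by
          intro i
          rw [rowBlock_frameLift, ← hZR i]
          have e : rowBlock Z i * T i * (rowBlock Z i * R i)ᵀ
              + rowBlock Z i * R i * (rowBlock Z i * T i)ᵀ
              = rowBlock Z i * (T i * (R i)ᵀ + R i * (T i)ᵀ) * (rowBlock Z i)ᵀ := by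
            simp only [Matrix.transpose_mul, Matrix.mul_add, Matrix.add_mul, Matrix.mul_assoc]
          rw [e, hT i, Matrix.mul_zero, Matrix.zero_mul]
        have h := hhess _ hmem
        rw [← frobInner_mul_right (certificate A S), frobInner_eq_sum_rowBlock] at h
        simp only [hCL, frobInner_add_left, Finset.sum_add_distrib] at h
        rw [← frobInner_eq_sum_rowBlock] at h
        rw [liftForm_apply]
        refine h.trans (le_of_eq ?_)
        congr 1
        refine Finset.sum_congr rfl fun i _ => ?_
        rw [rowBlock_frameLift, ← frobInner_mul_right (D i)]
        simp only [D]
        rw [Matrix.mul_assoc, Matrix.mul_assoc, frobInner_mul_left (rowBlock Z i)ᵀ,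
          Matrix.transpose_transpose])
      hv hτ
    have hg : gFun p d u v w (1 - α⁻¹) τ ≤ GFun p d (1 - α⁻¹) τ :=
      (isLUB_GFun hd hp hτ hx).1 ⟨u, v, w, h1, h2, h3, h4, h5, rfl⟩
    have hr := rFun_pos hd hp τ
    -- The chain `r λ ≤ μ g ≤ μ G ≤ μ r α⁻¹ < r λ` closes the contradiction.
    have h7 := mul_le_mul_of_nonneg_left (hg.trans hfeas) hμ.le
    have h8 := mul_lt_mul_of_pos_left hlt hr
    nlinarith
  · -- all blocks agree
    have hcov := covForm_frames hR hn0 hd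
    have hcov0 : covForm n d p R R ≤ 0 := by
      rw [hcov]
      exact mul_nonpos_of_nonneg_of_nonpos (by positivity) (not_lt.mp hv)
    have hsum : ∑ i, R i = (n : ℝ) • famMean R := by
      rw [famMean, smul_smul, mul_inv_cancel₀ hn'.ne', one_smul]
    have hvar : ∑ i, frobInner (R i - famMean R) (R i - famMean R) = covForm n d p R R := by
      simp only [frobInner_sub_left, frobInner_sub_right, Finset.sum_sub_distrib,
        ← frobInner_sum_left, ← frobInner_sum_right, hsum, covForm_apply, frobInner_smul_left,
        frobInner_smul_right, Finset.sum_const, Finset.card_univ, Fintype.card_fin, nsmul_eq_mul]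
      field_simp
      ring
    have heq : ∀ i, R i = famMean R := by
      intro i
      refine sub_eq_zero.mp (eq_zero_of_frobInner_self ?_)
      refine le_trans ?_ (hvar.le.trans hcov0)
      exact Finset.single_le_sum (f := fun i => frobInner (R i - famMean R) (R i - famMean R))
        (fun i _ => frobInner_self_nonneg _) (Finset.mem_univ i)
    have hSZ : S = Z * famMean R := by
      rw [← hlift, ← frameLift_const]
      congr 1
      exact funext heq
    have hMM : famMean R * (famMean R)ᵀ = 1 := by
      rw [← heq ⟨0, hn0⟩]; exact hR _
    rw [hSZ, Matrix.transpose_mul, Matrix.mul_assoc, ← Matrix.mul_assoc (famMean R), hMM,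
      Matrix.one_mul]

omit hZ in
-- The block-diagonal multiplier pairs with `X_i X_iᵀ = 1`, so on the feasible set it contributes a
-- constant.
lemma objective_eq_certificate (Z : Matrix (Fin n × Fin d) (Fin d) ℝ)
    {X : Matrix (Fin n × Fin d) (Fin p) ℝ} (hX : X ∈ stiefel n p d) :
    objective A X = frobInner (certificate A Z * X) X
      - ∑ i, (symBlock (A * (Z * Zᵀ)) i).trace := by
  have hX' : ∀ i, rowBlock X i * (rowBlock X i)ᵀ = 1 := hX
  rw [objective_eq, frobInner_eq_sum_rowBlock (certificate A Z * X), frobInner_eq_sum_rowBlock (A * X),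
    ← Finset.sum_sub_distrib, ← Finset.sum_neg_distrib]
  refine Finset.sum_congr rfl fun i _ => ?_
  rw [rowBlock_certificate_mul, frobInner_sub_left, frobInner_mul_right (symBlock _ i), hX',
    frobInner_one_right]
  ring

omit hZ in
-- Up to that constant the objective is a nonnegative quadratic form, and it vanishes at `S` because
-- it depends only on `S Sᵀ`.
lemma isMinOn_of_mul_transpose_eq (hL : (certificate A Z).PosSemidef)
    (hLZ : certificate A Z * Z = 0) {S : Matrix (Fin n × Fin d) (Fin p) ℝ}
    (hS : S ∈ stiefel n p d) (hSZ : S * Sᵀ = Z * Zᵀ) :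
    IsMinOn (objective A) (stiefel n p d) S := by
  intro X hX
  have h0 : frobInner (certificate A Z * S) S = 0 := by
    rw [frobInner_mul_right, hSZ, ← frobInner_mul_right, hLZ, frobInner_zero_left]
  have h1 := frobInner_mul_self_nonneg hL X
  change objective A S ≤ objective A X
  rw [objective_eq_certificate Z hS, objective_eq_certificate Z hX, h0]
  linarith

theorem benignLandscape_of_lt_alphaG (hd : 1 ≤ d) (hp : d + 1 ≤ p) (hn : 2 ≤ n) (hA : A.IsSymm)
    (hL : (certificate A Z).PosSemidef) (hLZ : certificate A Z * Z = 0)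
    (hpos : 0 < kthEigenvalue hL.isHermitian (d + 1))
    (hratio : maxEigenvalue hL.isHermitian / kthEigenvalue hL.isHermitian (d + 1) < alphaG p d) :
    BenignLandscape p A Z := by
  have key : ∀ S : Matrix (Fin n × Fin d) (Fin p) ℝ, IsSecondOrderCritical A S →
      IsMinOn (objective A) (stiefel n p d) S ∧ S * Sᵀ = Z * Zᵀ := by
    intro S hS
    have h := mul_transpose_eq_of_critical hZ hd hp hn hL hLZ hpos hratio hS
    exact ⟨isMinOn_of_mul_transpose_eq hL hLZ hS.1 h, h⟩
  exact ⟨key, fun S hS hmin => (key S (isSecondOrderCritical_of_isLocalMinOn hA hS hmin)).1⟩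

end Landscape

end LowRankSync

theorem theorem3 (p d : ℕ) (hd : 1 ≤ d) (hp : d + 1 ≤ p) :
    -- `G` is the supremum it stands for, in the range of `x = 1 - α⁻¹`, `α > 1`
    (∀ τ ∈ Icc (0 : ℝ) 1, ∀ x ∈ Ioo (0 : ℝ) 1,
      IsLUB {y : ℝ | ∃ u v w : ℝ, 0 ≤ u ∧ u ≤ w ∧ w ≤ v ∧ 0 < v ∧ v ≤ 1 ∧
        y = gFun p d u v w x τ} (GFun p d x τ)) ∧
    -- for each `τ` there is a largest feasible `α`
    (∀ τ ∈ Icc (0 : ℝ) 1, IsGreatest (feasible p d τ) (alphaAt p d τ)) ∧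
    -- closed form, `d = 1`
    (d = 1 → ∀ τ ∈ Icc (0 : ℝ) 1, ∀ α : ℝ, α ≠ 0 →
      (((p : ℝ) - 1) / p ≤ (1 - α⁻¹) * (1 - τ ^ 2) ^ 2 + 2 * τ ^ 2 →
        (alphaAt p d τ = α ↔
          α = ((p : ℝ) - 1 + (1 - τ ^ 2) ^ 2) / (2 * τ ^ 2 + (1 - τ ^ 2) ^ 2))) ∧
      ((1 - α⁻¹) * (1 - τ ^ 2) ^ 2 + 2 * τ ^ 2 ≤ ((p : ℝ) - 1) / p →
        (alphaAt p d τ = α ↔ α = p))) ∧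
    -- closed form, `d ≥ 2`, `h(τ) ≥ 1`
    (2 ≤ d → ∀ τ ∈ Ico (0 : ℝ) 1, 1 ≤ hFun p d τ → ∀ α : ℝ, α ≠ 0 →
      (1 / (d * qFun d τ) ≤ 1 - α⁻¹ →
        (alphaAt p d τ = α ↔ IsGreatest (firstCaseSet p d τ) α)) ∧
      ((2 - hFun p d τ) / (d * qFun d τ) ≤ 1 - α⁻¹ → 1 - α⁻¹ ≤ 1 / (d * qFun d τ) →
        (alphaAt p d τ = α ↔
          α = (d * qFun d τ ^ 2 + rFun p d τ) / (d * qFun d τ ^ 2 + 2 * d * τ ^ 2))) ∧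
      (1 - α⁻¹ ≤ (2 - hFun p d τ) / (d * qFun d τ) →
        (alphaAt p d τ = α ↔
          α = rFun p d τ / (2 * (qFun d τ + d * τ ^ 2) - qFun d τ * hFun p d τ)))) ∧
    -- closed form, `d ≥ 2`, `τ = 1`, where `h(τ) = +∞` and only the second case is left
    (2 ≤ d → alphaAt p d 1 = ((p : ℝ) + d - 2) / (2 * d)) ∧
    -- closed form, `d ≥ 2`, `h(τ) ≤ 1`
    (2 ≤ d → ∀ τ ∈ Ico (0 : ℝ) 1, hFun p d τ ≤ 1 → ∀ α : ℝ, α ≠ 0 →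
      (1 / (d * qFun d τ * hFun p d τ) ≤ 1 - α⁻¹ →
        (alphaAt p d τ = α ↔ IsGreatest (firstCaseSet p d τ) α)) ∧
      (1 - α⁻¹ ≤ 1 / (d * qFun d τ * hFun p d τ) →
        (alphaAt p d τ = α ↔
          α = rFun p d τ / (2 * (qFun d τ + d * τ ^ 2) - qFun d τ * hFun p d τ)))) ∧
    -- the maximum over `τ` and its values
    IsGreatest (alphaAt p d '' Icc 0 1) (alphaG p d) ∧
    (d = 1 → alphaG p d = p) ∧
    ((2 ≤ d ∧ d + 2 ≤ p) ∨ (p = d + 1 ∧ (d = 2 ∨ d = 3)) → 1 < alphaG p d) ∧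
    -- the landscape
    (∀ (n : ℕ), 2 ≤ n → ∀ (A : Matrix (Fin n × Fin d) (Fin n × Fin d) ℝ)
      (Z : Matrix (Fin n × Fin d) (Fin d) ℝ), A.IsSymm → Z ∈ stiefel n d d →
      ∀ hL : (certificate A Z).PosSemidef, certificate A Z * Z = 0 →
      0 < kthEigenvalue hL.isHermitian (d + 1) →
      maxEigenvalue hL.isHermitian / kthEigenvalue hL.isHermitian (d + 1) < alphaG p d →
      BenignLandscape p A Z) := by
  refine ⟨fun τ hτ x hx => isLUB_GFun hd hp hτ hx, fun τ hτ => (feasible_spec hd hp hτ).1, ?_,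
    fun hd2 τ hτ hh α hα => alphaAt_eq_iff_of_one_le_hFun hd2 hp hτ hh hα,
    fun hd2 => alphaAt_one hd2 hp,
    fun hd2 τ hτ hh α hα => alphaAt_eq_iff_of_hFun_le_one hd2 hp hτ hh hα,
    isGreatest_alphaG hd hp, ?_, one_lt_alphaG,
    fun n hn A Z hA hZ hL hLZ hpos hratio =>
      benignLandscape_of_lt_alphaG hZ hd hp hn hA hL hLZ hpos hratio⟩
  · rintro rfl τ hτ α hα
    exact alphaAt_eq_iff_of_dim_one hp hτ hα
  · rintro rfl
    exact alphaG_of_dim_one hp
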